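/- **Setting.** Let $d\ge 2$, let $\Omega\subset\mathbb R^d$ be bounded and open (for instance a bounded Lipschitz domain), $T>0$, $\nu\ge 0$. $L^2_\sigma$ and $H^1_{0,\sigma}$ are the closures of $C^\infty_{c,\sigma}(\Omega;\mathbb R^d)$ (smooth, compactly supported, divergence free; also written $C^\infty_{0,\sigma}$) in $L^2(\Omega)$ and $H^1(\Omega)$. Put $\mathbb X=L^\infty(0,T;L^2_\sigma)\cap L^2(0,T;H^1_{0,\sigma})$ and $\mathbb Y=\mathbb X\cap L^2(0,T;H^2)\cap L^1(0,T;W^{1,\infty})\cap H^1(0,T;(L^2_\sigma)^*)$ if $\nu>0$, and $\mathbb X=L^\infty(0,T;L^2_\sigma)$ and $\mathbb Y=\mathbb X\cap L^1(0,T;W^{1,\infty})\cap H^1(0,T;(L^2_\sigma)^*)$ if $\nu=0$. Let $f\in L^2(0,T;H^{-1})+L^1(0,T;L^2)$ if $\nu>0$ and $f\in L^1(0,T;L^2)$ if $\nu=0$. Put $\mathcal R(v|\tilde v)=\frac12\|v-\tilde v\|_{L^2}^2$, $\langle\mathcal A_\nu(\tilde v),z\rangle=(\partial_t\tilde v,z)+((\tilde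 v\cdot\nabla)\tilde v,z)+\nu(\nabla\tilde v,\nabla z)-\langle f,z\rangle$, and, for $\mathcal K:L^2_\sigma\to[0,\infty]$, $$\mathcal W_\nu(v|\tilde v)=\nu\|\nabla v-\nabla\tilde v\|_{L^2}^2-\int_\Omega((v-\tilde v)\cdot\nabla)(v-\tilde v)\cdot\tilde v\,dx+\mathcal K(\tilde v)\mathcal R(v|\tilde v)\quad(\nu>0),$$ $$\mathcal W_0(v|\tilde v)=\int_\Omega(v-\tilde v)\cdot(\nabla\tilde v)_{\rm sym}(v-\tilde v)\,dx+\mathcal K(\tilde v)\mathcal R(v|\tilde v).$$ Let $\mathcal D(\mathcal K)=\{\tilde v\in\mathbb X:\mathcal K(\tilde v)\in L^1(0,T)\}$. $\mathcal K$ is *admissible* if $\mathcal K(0)=0$; $\mathcal W_\nu(v|\tilde v)\ge0$ a.e. in $(0,T)$ for all $v\in\mathbb X$, $\tilde v\in\mathbb Y\cap\mathcal D(\mathcal K)$; $C^1([0,T];C^\infty_{c,\sigma})\subset\mathcal D(\mathcal K)$; and $\mathbb Y\cap\mathcal D(\mathcal K)$ has a topology in which $C^1([0,T];C^\infty_{c,\sigma})$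 is dense, which makes $\mathcal K:\mathbb Y\cap\mathcal D(\mathcal K)\to L^1(0,T)$ continuous, and which makes continuous the functionals $\tilde v\mapsto\int_0^T(\tilde v,g)\,dt$ for $g\in L^1(0,T;L^2)$, $\tilde v\mapsto\int_0^T(\partial_t\tilde v,h)\,dt$ for $h\in L^2(0,T;L^2_\sigma)$, $\tilde v\mapsto\int_0^T\!\int_\Omega\nabla\tilde v:M\,dx\,dt$ for $M\in L^\infty(0,T;L^1)$ and, if $\nu>0$, also for $M\in L^2(0,T;L^2)$. **Proposition.** Let $\mathcal K$ be admissible, $v\in\mathbb X$, $\xi\in L^\infty(0,T)$, $\xi\ge0$, and $E=\frac12\|v\|_{L^2}^2+\xi$. The following are equivalent. 1. (Relative energy inequality.) For all $\tilde v\in\mathbb Y\cap\mathcal D(\mathcal K)$ the function $F=\mathcal R(v|\tilde v)+\xi$ has essential one-sided limits everywhere in $[0,T]$ (at the end points both $F(t+)$ and $F(t-)$ denote the limit from inside), and for all $0\le s\le t\le T$ $$F(t+)+\int_s^t\Big(\mathcal W_\nu(v|\tilde v)+\langle\mathcal A_\nu(\tilde v),v-\tilde v\rangle-\mathcal K(\tilde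 v)(\mathcal R(v|\tilde v)+\xi)\Big)d\tau\le F(s-).$$ 2. (Locally in time.) For all $\tilde v\in\mathbb Y\cap\mathcal D(\mathcal K)$ the function $\mathcal R(v|\tilde v)+\xi$ is of bounded variation in $(0,T)$, and, as Radon measures on $(0,T)$, $$\frac{d}{dt}\big[\mathcal R(v|\tilde v)+\xi\big]+\mathcal W_\nu(v|\tilde v)+\langle\mathcal A_\nu(\tilde v),v-\tilde v\rangle-\mathcal K(\tilde v)\big[\mathcal R(v|\tilde v)+\xi\big]\le0.$$ 3. (Reduced.) For all time-independent $\tilde v\in C^\infty_{0,\sigma}(\Omega)$ the function $E-(v,\tilde v)$ is of bounded variation in $(0,T)$, and, as Radon measures on $(0,T)$, $$\partial_t\big(E-(v,\tilde v)\big)+\nu(\nabla v,\nabla v-\nabla\tilde v)+(v\otimes v;\nabla\tilde v)-\langle f,v-\tilde v\rangle+\mathcal K(\tilde v)\big(\tfrac12\|v\|_{L^2}^2-E\big)\le0.$$ In each of 1–3 the integrability on $(0,T)$ of the terms without time derivative is part of the assertion. -/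

import Mathlib

open MeasureTheory Set Filter Topology
open scoped ContDiff

noncomputable section

namespace EnergyVariational

/-- The Euclidean space of dimension `d`. -/
abbrev Vec (d : ℕ) : Type := EuclideanSpace ℝ (Fin d)

/-- Real `d × d` matrices with the Frobenius inner product. The entry `(i, j)` of a gradient is
the `j`-th partial derivative of the `i`-th component. -/
abbrev Mat (d : ℕ) : Type := EuclideanSpace ℝ (Fin d × Fin d)

/-- Third order tensors, for second derivatives of vector fields. -/
abbrev Tens (d : ℕ) : Type := EuclideanSpace ℝ (Fin d × Fin d × Fin d)

/-- Lebesgue measure on the time interval `(0, T)`. -/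
abbrev timeMeas (T : ℝ) : Measure ℝ := volume.restrict (Ioo 0 T)

/-- `L²(Ω; ℝᵈ)`. -/
abbrev L2 {d : ℕ} (Ω : Set (Vec d)) := Lp (Vec d) 2 (volume.restrict Ω)

/-- `L²(Ω; ℝᵈˣᵈ)`. -/
abbrev L2Mat {d : ℕ} (Ω : Set (Vec d)) := Lp (Mat d) 2 (volume.restrict Ω)

/-! ### Test fields in space, solenoidal spaces, weak derivatives -/

/-- Classical gradient of a vector field. -/
def gradField {d : ℕ} (φ : Vec d → Vec d) (x : Vec d) : Mat d :=
  WithLp.toLp 2 fun ij => fderiv ℝ φ x (EuclideanSpace.single ij.2 1) ij.1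

/-- Smooth vector fields with compact support in `Ω`. -/
structure TestField {d : ℕ} (Ω : Set (Vec d)) where
  toFun : Vec d → Vec d
  smooth : ContDiff ℝ ∞ toFun
  compactSupp : HasCompactSupport toFun
  supp_subset : tsupport toFun ⊆ Ω

/-- Smooth divergence free vector fields with compact support in `Ω`. -/
structure SolField {d : ℕ} (Ω : Set (Vec d)) extends TestField Ω where
  div_free : ∀ x, ∑ i, fderiv ℝ toFun x (EuclideanSpace.single i 1) i = 0

theorem TestField.memLp {d : ℕ} {Ω : Set (Vec d)} (φ : TestField Ω) :
    MemLp φ.toFun 2 (volume.restrict Ω) :=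
  φ.smooth.continuous.memLp_of_hasCompactSupport φ.compactSupp

theorem TestField.memLp_grad {d : ℕ} {Ω : Set (Vec d)} (φ : TestField Ω) :
    MemLp (gradField φ.toFun) 2 (volume.restrict Ω) := by
  refine Continuous.memLp_of_hasCompactSupport ?_ ?_
  · have h := φ.smooth.continuous_fderiv (by simp)
    unfold gradField
    fun_prop
  · have h := φ.compactSupp.fderiv (𝕜 := ℝ)
    refine h.mono ?_
    intro x hx
    contrapose! hx
    simp only [Function.mem_support, ne_eq, not_not] at hx ⊢
    ext ij
    simp [gradField, hx]

/-- The class of a test field in `L²`. -/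
def TestField.toL2 {d : ℕ} {Ω : Set (Vec d)} (φ : TestField Ω) : L2 Ω := φ.memLp.toLp

/-- The class of the gradient of a test field in `L²`. -/
def TestField.gradL2 {d : ℕ} {Ω : Set (Vec d)} (φ : TestField Ω) : L2Mat Ω := φ.memLp_grad.toLp

/-- `L²_σ(Ω)`: the closure in `L²` of the smooth compactly supported solenoidal fields (these form
a linear space, so that taking the span adds nothing). -/
abbrev L2sol {d : ℕ} (Ω : Set (Vec d)) : Submodule ℝ (L2 Ω) :=
  (Submodule.span ℝ (range fun φ : SolField Ω => φ.toL2)).topologicalClosure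

/-- A smooth compactly supported solenoidal field as an element of `L²_σ(Ω)`. -/
def SolField.toL2sol {d : ℕ} {Ω : Set (Vec d)} (φ : SolField Ω) : L2sol Ω :=
  ⟨φ.toL2, Submodule.le_topologicalClosure _ (Submodule.subset_span ⟨φ, rfl⟩)⟩

/-- `H¹₀(Ω; ℝᵈ)`, realised as the closure of the pairs `(φ, ∇φ)` in `L² × L²`, `φ` smooth with
compact support in `Ω` (the norm of the product is equivalent to the `H¹` norm). -/
abbrev H10 {d : ℕ} (Ω : Set (Vec d)) : Submodule ℝ (L2 Ω × L2Mat Ω) :=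
  (Submodule.span ℝ (range fun φ : TestField Ω => (φ.toL2, φ.gradL2))).topologicalClosure

/-- `g` is the weak `j`-th partial derivative of `f` in `Ω`. -/
def HasWeakPartial {d : ℕ} (Ω : Set (Vec d)) (f g : Vec d → ℝ) (j : Fin d) : Prop :=
  ∀ φ : Vec d → ℝ, ContDiff ℝ ∞ φ → HasCompactSupport φ → tsupport φ ⊆ Ω →
    ∫ x in Ω, f x * fderiv ℝ φ x (EuclideanSpace.single j 1) = -∫ x in Ω, g x * φ x

/-- `G` is the weak gradient of the vector field `u` in `Ω`. -/
def HasWeakGrad {d : ℕ} (Ω : Set (Vec d)) (u : Vec d → Vec d) (G : Vec d → Mat d) : Prop :=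
  ∀ i j, HasWeakPartial Ω (fun x => u x i) (fun x => G x (i, j)) j

open Classical in
/-- The weak gradient of `u`, if there is one in `L²` (it is then unique); `0` otherwise. -/
def grad {d : ℕ} {Ω : Set (Vec d)} (u : L2sol Ω) : L2Mat Ω :=
  if h : ∃ G : L2Mat Ω, HasWeakGrad Ω (u : L2 Ω) G then h.choose else 0

/-- `u ∈ H¹_{0,σ}(Ω)`: the pair `(u, ∇u)` is in the closure, with respect to the `H¹` norm, of the
smooth compactly supported solenoidal fields. -/
def MemH10sol {d : ℕ} {Ω : Set (Vec d)} (u : L2sol Ω) : Prop :=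
  ((u : L2 Ω), grad u) ∈ closure (range fun φ : SolField Ω => (φ.toL2, φ.gradL2))

/-! ### The function spaces in space and time -/

/-- The energy space `𝕏 = L^∞(0,T; L²_σ) ∩ L²(0,T; H¹_{0,σ})` for `ν > 0`, and
`𝕏₀ = L^∞(0,T; L²_σ)` for `ν = 0`. -/
structure MemX {d : ℕ} {Ω : Set (Vec d)} (ν T : ℝ) (v : ℝ → L2sol Ω) : Prop where
  bounded : MemLp v ⊤ (timeMeas T)
  memH10sol : 0 < ν → ∀ᵐ t ∂timeMeas T, MemH10sol (v t)
  grad_memLp : 0 < ν → MemLp (fun t => grad (v t)) 2 (timeMeas T)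

/-- `u ∈ L¹(0,T; W^{1,∞}(Ω))`, in the sense of Bochner. -/
def MemL1W1inf {d : ℕ} {Ω : Set (Vec d)} (T : ℝ) (u : ℝ → L2sol Ω) : Prop :=
  ∃ (U : ℝ → Lp (Vec d) ⊤ (volume.restrict Ω)) (G : ℝ → Lp (Mat d) ⊤ (volume.restrict Ω)),
    Integrable U (timeMeas T) ∧ Integrable G (timeMeas T) ∧
      ∀ᵐ t ∂timeMeas T, (U t =ᵐ[volume.restrict Ω] (u t : L2 Ω)) ∧
        HasWeakGrad Ω (u t : L2 Ω) (G t)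

/-- For `u` with first derivatives in `L²(0,T; L²)`: the second derivatives are in `L²(0,T; L²)`
too, so that `u ∈ L²(0,T; H²(Ω))`. -/
def MemL2H2 {d : ℕ} {Ω : Set (Vec d)} (T : ℝ) (u : ℝ → L2sol Ω) : Prop :=
  ∃ D : ℝ → Lp (Tens d) 2 (volume.restrict Ω), MemLp D 2 (timeMeas T) ∧
    ∀ᵐ t ∂timeMeas T, ∀ i j k,
      HasWeakPartial Ω (fun x => grad (u t) x (i, j)) (fun x => D t x (i, j, k)) k

/-- `u` lies in the space of test functions
`𝕐 = 𝕏 ∩ L²(0,T; H²) ∩ L¹(0,T; W^{1,∞}) ∩ H¹(0,T; (L²_σ)^*)` for `ν > 0`, respectively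
`𝕐₀ = 𝕏₀ ∩ L¹(0,T; W^{1,∞}) ∩ H¹(0,T; (L²_σ)^*)` for `ν = 0`, and `du` is its time derivative.
The dual of `L²_σ` is identified with `L²_σ` by the Riesz isomorphism, and `u` is taken as its
continuous representative on `[0, T]`. -/
structure MemY {d : ℕ} {Ω : Set (Vec d)} (ν T : ℝ) (u du : ℝ → L2sol Ω) : Prop where
  memX : MemX ν T u
  memL2H2 : 0 < ν → MemL2H2 T u
  memL1W1inf : MemL1W1inf T u
  deriv_memLp : MemLp du 2 (timeMeas T)
  eq_integral : ∀ t ∈ Icc 0 T, u t = u 0 + ∫ τ in (0 : ℝ)..t, du τ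

/-- `𝒦(u) ∈ L¹(0,T)`; the domain `𝒟(𝒦)` consists of the `u ∈ 𝕏` with this property. -/
def MemDom {d : ℕ} {Ω : Set (Vec d)} (T : ℝ) (K : L2sol Ω → ENNReal) (u : ℝ → L2sol Ω) : Prop :=
  AEMeasurable (fun t => K (u t)) (timeMeas T) ∧ ∫⁻ t, K (u t) ∂timeMeas T ≠ ⊤

/-- The set `𝕐 ∩ 𝒟(𝒦)`. Each element carries its time derivative. -/
structure TestFun {d : ℕ} {Ω : Set (Vec d)} (ν T : ℝ) (K : L2sol Ω → ENNReal) where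
  u : ℝ → L2sol Ω
  du : ℝ → L2sol Ω
  memY : MemY ν T u du
  memDom : MemDom T K u

theorem TestFun.integrable_K {d : ℕ} {Ω : Set (Vec d)} {ν T : ℝ} {K : L2sol Ω → ENNReal}
    (p : TestFun ν T K) : Integrable (fun t => (K (p.u t)).toReal) (timeMeas T) :=
  integrable_toReal_of_lintegral_ne_top p.memDom.1 p.memDom.2

/-- `w ∈ C¹([0,T]; C^∞_{c,σ}(Ω))` with time derivative `w'`: the supports stay in a fixed compact
subset of `Ω`, and all spatial derivatives of `w` are continuously differentiable in time. -/
structure IsC1Curve {d : ℕ} {Ω : Set (Vec d)} (T : ℝ) (w w' : ℝ → SolField Ω) : Prop where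
  common_supp : ∃ C : Set (Vec d), IsCompact C ∧ C ⊆ Ω ∧
    ∀ t ∈ Icc 0 T, tsupport (w t).toFun ⊆ C
  hasDeriv : ∀ (m : ℕ) (x : Vec d), ∀ t ∈ Icc 0 T,
    HasDerivWithinAt (fun τ => iteratedFDeriv ℝ m (w τ).toFun x)
      (iteratedFDeriv ℝ m (w' t).toFun x) (Icc 0 T) t
  cont : ∀ m : ℕ, ContinuousOn
    (fun q : ℝ × Vec d => iteratedFDeriv ℝ m (w q.1).toFun q.2) (Icc 0 T ×ˢ univ)
  cont_deriv : ∀ m : ℕ, ContinuousOn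
    (fun q : ℝ × Vec d => iteratedFDeriv ℝ m (w' q.1).toFun q.2) (Icc 0 T ×ˢ univ)

/-! ### Relative energy, relative form, system operator -/

/-- The relative energy `ℛ(v | w) = ½ ‖v - w‖²`. -/
def relEnergy {d : ℕ} {Ω : Set (Vec d)} (v w : L2sol Ω) : ℝ := 1 / 2 * ‖v - w‖ ^ 2

/-- `∫_Ω (a · ∇) b · c`, where `B` is the gradient of `b`. -/
def convection {d : ℕ} (Ω : Set (Vec d)) (a : Vec d → Vec d) (B : Vec d → Mat d)
    (c : Vec d → Vec d) : ℝ :=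
  ∫ x in Ω, ∑ i, ∑ j, a x j * B x (i, j) * c x i

/-- `∫_Ω a · (B_sym a)`, with the symmetric part `B_sym` of `B`. -/
def symForm {d : ℕ} (Ω : Set (Vec d)) (a : Vec d → Vec d) (B : Vec d → Mat d) : ℝ :=
  ∫ x in Ω, ∑ i, ∑ j, a x i * (1 / 2 * (B x (i, j) + B x (j, i))) * a x j

/-- The relative form `𝒲_ν(v | w)`, for `ν > 0` and for `ν = 0`. -/
def relForm {d : ℕ} {Ω : Set (Vec d)} (ν : ℝ) (K : L2sol Ω → ENNReal) (v w : L2sol Ω) : ℝ :=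
  if 0 < ν then
    ν * ‖grad v - grad w‖ ^ 2
      - convection Ω ((v - w : L2sol Ω) : L2 Ω) (grad v - grad w : L2Mat Ω) (w : L2 Ω)
      + (K w).toReal * relEnergy v w
  else
    symForm Ω ((v - w : L2sol Ω) : L2 Ω) (grad w) + (K w).toReal * relEnergy v w

/-- Right-hand sides: `f = f₁ + f₂ ∈ L²(0,T; H⁻¹) + L¹(0,T; L²)` for `ν > 0`, and
`f = f₂ ∈ L¹(0,T; L²)` for `ν = 0`. -/
structure Force {d : ℕ} (Ω : Set (Vec d)) (ν T : ℝ) where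
  f₁ : ℝ → StrongDual ℝ (H10 Ω)
  f₂ : ℝ → L2 Ω
  memLp₁ : MemLp f₁ 2 (timeMeas T)
  integrable₂ : Integrable f₂ (timeMeas T)
  inviscid : ν = 0 → f₁ = 0

open Classical in
/-- The duality pairing `⟨f(t), z⟩` (for `ν > 0` it is used for `z ∈ H¹_{0,σ} ⊆ H¹₀`). -/
def Force.pair {d : ℕ} {Ω : Set (Vec d)} {ν T : ℝ} (f : Force Ω ν T) (t : ℝ) (z : L2sol Ω) : ℝ :=
  (if h : ((z : L2 Ω), grad z) ∈ H10 Ω then f.f₁ t ⟨_, h⟩ else 0) + inner ℝ (f.f₂ t) (z : L2 Ω)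

/-- `⟨𝒜_ν(w), z⟩ = ⟨∂ₜw + (w · ∇)w - ν Δw - f, z⟩` at time `t`, with `dw` the time derivative of
`w`, and with the Laplacian in the weak sense. -/
def sysOp {d : ℕ} {Ω : Set (Vec d)} {ν T : ℝ} (f : Force Ω ν T) (t : ℝ) (w dw z : L2sol Ω) : ℝ :=
  inner ℝ dw z + convection Ω (w : L2 Ω) (grad w) (z : L2 Ω) + ν * inner ℝ (grad w) (grad z)
    - f.pair t z

/-! ### Admissible forms -/

/-- `𝒦 : L²_σ(Ω) → [0, ∞]` is an admissible form. The topology on the test functions is fine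
enough for `𝒦` to be continuous with values in `L¹(0,T)`, and for the test functions, their time
derivatives and their gradients to depend continuously on the test function in the weak topologies
of `L^∞(0,T; L²)`, `L²(0,T; L²_σ)`, `L¹(0,T; L^∞)` and (`ν > 0`) `L²(0,T; L²)`, these spaces being
tested against `L¹(0,T; L²)`, `L²(0,T; L²_σ)`, `L^∞(0,T; L¹)`, `L²(0,T; L²)`. -/
structure IsAdmissible {d : ℕ} {Ω : Set (Vec d)} (ν T : ℝ) (K : L2sol Ω → ENNReal) : Prop where
  map_zero : K 0 = 0
  curve_memDom : ∀ w w' : ℝ → SolField Ω, IsC1Curve T w w' → MemDom T K fun t => (w t).toL2sol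
  exists_topology : ∃ _τ : TopologicalSpace (TestFun ν T K),
    (Continuous fun p : TestFun ν T K => p.integrable_K.toL1) ∧
    (∀ g : ℝ → L2 Ω, Integrable g (timeMeas T) →
      Continuous fun p : TestFun ν T K => ∫ t in Ioo 0 T, inner ℝ (p.u t : L2 Ω) (g t)) ∧
    (∀ h : ℝ → L2sol Ω, MemLp h 2 (timeMeas T) →
      Continuous fun p : TestFun ν T K => ∫ t in Ioo 0 T, inner ℝ (p.du t) (h t)) ∧
    (∀ M : ℝ → Lp (Mat d) 1 (volume.restrict Ω), MemLp M ⊤ (timeMeas T) →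
      Continuous fun p : TestFun ν T K =>
        ∫ t in Ioo 0 T, ∫ x in Ω, inner ℝ (grad (p.u t) x) (M t x)) ∧
    (0 < ν → ∀ M : ℝ → L2Mat Ω, MemLp M 2 (timeMeas T) →
      Continuous fun p : TestFun ν T K => ∫ t in Ioo 0 T, inner ℝ (grad (p.u t)) (M t)) ∧
    Dense {p : TestFun ν T K | ∃ w w' : ℝ → SolField Ω, IsC1Curve T w w' ∧
      ∀ t ∈ Icc 0 T, p.u t = (w t).toL2sol}
  nonneg : ∀ v : ℝ → L2sol Ω, MemX ν T v → ∀ p : TestFun ν T K,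
    ∀ᵐ t ∂timeMeas T, 0 ≤ relForm ν K (v t) (p.u t)

/-! ### The three inequalities -/

/-- `a` is the limit from the right, `F(t+)`, of the (almost everywhere defined) function `F` on
`(0, T)`; at `t = T` it is the limit from inside the interval. -/
def IsRightLim (T : ℝ) (F : ℝ → ℝ) (t a : ℝ) : Prop :=
  Tendsto F (𝓝[if t < T then Ioo t T else Ioo 0 T] t ⊓ ae volume) (𝓝 a)

/-- `a` is the limit from the left, `F(t-)`, of the (almost everywhere defined) function `F` on
`(0, T)`; at `t = 0` it is the limit from inside the interval. -/
def IsLeftLim (T : ℝ) (F : ℝ → ℝ) (t a : ℝ) : Prop :=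
  Tendsto F (𝓝[if 0 < t then Ioo 0 t else Ioo 0 T] t ⊓ ae volume) (𝓝 a)

/-- `F` is of bounded variation on `(0, T)` and its distributional derivative is the finite signed
Radon measure `D`. -/
def HasBVDeriv (T : ℝ) (F : ℝ → ℝ) (D : SignedMeasure ℝ) : Prop :=
  IntegrableOn F (Ioo 0 T) ∧
    ∀ φ : ℝ → ℝ, ContDiff ℝ ∞ φ → HasCompactSupport φ → tsupport φ ⊆ Ioo 0 T →
      ∫ t in Ioo 0 T, deriv φ t * F t =
        -(∫ t, φ t ∂D.toJordanDecomposition.posPart - ∫ t, φ t ∂D.toJordanDecomposition.negPart)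

/-- `dF/dt + g ≤ 0` in `(0, T)`, where `F` is of bounded variation: an inequality between Radon
measures. -/
def DerivAddNonpos (T : ℝ) (F g : ℝ → ℝ) : Prop :=
  IntegrableOn g (Ioo 0 T) ∧ ∃ D : SignedMeasure ℝ, HasBVDeriv T F D ∧
    ∀ B : Set ℝ, MeasurableSet B → B ⊆ Ioo 0 T → D B + ∫ t in B, g t ≤ 0

/-- `𝒲_ν(v | w) + ⟨𝒜_ν(w), v - w⟩ - 𝒦(w) [ℛ(v | w) + ξ]` at time `t`. -/
def relRate {d : ℕ} {Ω : Set (Vec d)} {ν T : ℝ} {K : L2sol Ω → ENNReal} (f : Force Ω ν T)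
    (v : ℝ → L2sol Ω) (ξ : ℝ → ℝ) (p : TestFun ν T K) (t : ℝ) : ℝ :=
  relForm ν K (v t) (p.u t) + sysOp f t (p.u t) (p.du t) (v t - p.u t)
    - (K (p.u t)).toReal * (relEnergy (v t) (p.u t) + ξ t)

/-- The relative energy inequality. -/
def RelativeEnergyInequality {d : ℕ} {Ω : Set (Vec d)} {ν T : ℝ} (K : L2sol Ω → ENNReal)
    (f : Force Ω ν T) (v : ℝ → L2sol Ω) (ξ : ℝ → ℝ) : Prop :=
  ∀ p : TestFun ν T K, IntegrableOn (relRate f v ξ p) (Ioo 0 T) ∧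
    ∃ Fr Fl : ℝ → ℝ,
      (∀ t ∈ Icc 0 T, IsRightLim T (fun τ => relEnergy (v τ) (p.u τ) + ξ τ) t (Fr t)) ∧
      (∀ t ∈ Icc 0 T, IsLeftLim T (fun τ => relEnergy (v τ) (p.u τ) + ξ τ) t (Fl t)) ∧
      ∀ s ∈ Icc 0 T, ∀ t ∈ Icc s T, Fr t + ∫ τ in s..t, relRate f v ξ p τ ≤ Fl s

/-- The locally-in-time version. -/
def LocalInequality {d : ℕ} {Ω : Set (Vec d)} {ν T : ℝ} (K : L2sol Ω → ENNReal)
    (f : Force Ω ν T) (v : ℝ → L2sol Ω) (ξ : ℝ → ℝ) : Prop :=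
  ∀ p : TestFun ν T K,
    DerivAddNonpos T (fun t => relEnergy (v t) (p.u t) + ξ t) (relRate f v ξ p)

/-- The energy `E = ½ ‖v‖² + ξ`. -/
def energy {d : ℕ} {Ω : Set (Vec d)} (v : ℝ → L2sol Ω) (ξ : ℝ → ℝ) (t : ℝ) : ℝ :=
  1 / 2 * ‖v t‖ ^ 2 + ξ t

/-- The reduced locally-in-time version, with test functions that do not depend on time. -/
def ReducedInequality {d : ℕ} {Ω : Set (Vec d)} {ν T : ℝ} (K : L2sol Ω → ENNReal)
    (f : Force Ω ν T) (v : ℝ → L2sol Ω) (ξ : ℝ → ℝ) : Prop :=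
  ∀ φ : SolField Ω,
    DerivAddNonpos T (fun t => energy v ξ t - inner ℝ (v t) φ.toL2sol) fun t =>
      ν * inner ℝ (grad (v t)) (grad (v t) - φ.gradL2)
        + (∫ x in Ω, ∑ i, ∑ j,
            ((v t : L2 Ω) x i * (v t : L2 Ω) x j) * gradField φ.toFun x (i, j))
        - f.pair t (v t - φ.toL2sol)
        + (K φ.toL2sol).toReal * (1 / 2 * ‖v t‖ ^ 2 - energy v ξ t)

end EnergyVariational

end

/-!
Along a test function `ṽ`, the sum of the form `W` and of the pairing with the system operator is
`A(ṽ) + (v - ṽ, ∂ₜṽ) + K(ṽ) R(v|ṽ)` with `A` affine in `ṽ`, because the convective term is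
skew-symmetric. Since `R(v|ṽ) + ξ = E - (v, ṽ) + ½‖ṽ‖²`, the terms `(ṽ, ∂ₜṽ)` cancel, and both the
relative energy inequality and its local form say that
`∂ₜ(E - (v, ṽ)) + A(ṽ) - K(ṽ) ξ + (v, ∂ₜṽ) ≤ 0` in the sense of distributions. That the form with
one-sided limits, the one with measures and the distributional one agree is a fact about real
functions: `F' + g ≤ 0` means that `F` is almost everywhere equal to a decreasing function minus a
primitive of `g`.

The reduced inequality is the case of constant `ṽ`. To return to a curve `w` of smooth fields,
freeze `w` at the time `s`, test the inequality in `t` with `θ(t) ρ_ε(t - s)`, and integrate over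
`s`; as `ε → 0` the derivative of the mollifier is moved onto `w` and produces `(v, ∂ₜw)`. General
test functions follow by density, because once tested with `θ` the inequality is a closed condition
on `ṽ` in the topology which makes `K` continuous.
-/

noncomputable section

namespace EnergyVariational

section Mollifier

variable {E X : Type*} [NormedAddCommGroup E] [InnerProductSpace ℝ E]
  [NormedAddCommGroup X] [NormedSpace ℝ X]

/-- A sequence of smooth bump functions shrinking to the origin. -/
def mollifierBump (E : Type*) [NormedAddCommGroup E] (n : ℕ) : ContDiffBump (0 : E) where
  rIn := 1 / ((n : ℝ) + 1)
  rOut := 2 / ((n : ℝ) + 1)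
  rIn_pos := by positivity
  rIn_lt_rOut := by gcongr; norm_num

theorem tendsto_mollifierBump_rOut (E : Type*) [NormedAddCommGroup E] :
    Tendsto (fun n => (mollifierBump E n).rOut) atTop (𝓝 0) := by
  simpa [mollifierBump, div_eq_mul_inv] using
    (tendsto_one_div_add_atTop_nhds_zero_nat (𝕜 := ℝ)).const_mul 2

variable [FiniteDimensional ℝ E] [MeasurableSpace E] [BorelSpace E]

/-- The standard mollifiers: even, nonnegative, of unit mass, supported in the ball of radius
`(mollifierBump E n).rOut`. -/
def mollifier (E : Type*) [NormedAddCommGroup E] [InnerProductSpace ℝ E] [FiniteDimensional ℝ E]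
    [MeasurableSpace E] [BorelSpace E] (n : ℕ) : E → ℝ :=
  (mollifierBump E n).normed volume

theorem mollifier_nonneg (n : ℕ) (x : E) : 0 ≤ mollifier E n x :=
  (mollifierBump E n).nonneg_normed x

theorem mollifier_sub_comm (n : ℕ) (x y : E) : mollifier E n (x - y) = mollifier E n (y - x) := by
  rw [← neg_sub]
  exact (mollifierBump E n).normed_neg _

theorem contDiff_mollifier (n : ℕ) : ContDiff ℝ ∞ (mollifier E n) :=
  (mollifierBump E n).contDiff_normed

theorem continuous_mollifier (n : ℕ) : Continuous (mollifier E n) :=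
  (contDiff_mollifier n).continuous

theorem hasCompactSupport_mollifier (n : ℕ) : HasCompactSupport (mollifier E n) :=
  (mollifierBump E n).hasCompactSupport_normed

theorem mollifier_eq_zero {n : ℕ} {x : E} (hx : (mollifierBump E n).rOut ≤ ‖x‖) :
    mollifier E n x = 0 := by
  have hx' : x ∉ Function.support ((mollifierBump E n).normed volume) := by
    rw [(mollifierBump E n).support_normed_eq, Metric.mem_ball, dist_zero_right]
    exact hx.not_gt
  exact Function.notMem_support.1 hx'

theorem exists_bound_mollifier (n : ℕ) : ∃ C, ∀ x, ‖mollifier E n x‖ ≤ C :=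
  (continuous_mollifier n).bounded_above_of_compact_support (hasCompactSupport_mollifier n)

theorem integrable_mollifier_sub (n : ℕ) (x : E) : Integrable fun y => mollifier E n (x - y) :=
  (mollifierBump E n).integrable_normed.comp_sub_left x

theorem integral_mollifier_sub (n : ℕ) (x : E) : ∫ y, mollifier E n (x - y) = 1 := by
  rw [integral_sub_left_eq_self (mollifier E n) volume x]
  exact (mollifierBump E n).integral_normed

theorem convolution_mollifier (n : ℕ) (g : E → X) :
    convolution (mollifier E n) g (ContinuousLinearMap.lsmul ℝ ℝ)
      = fun x => ∫ y, mollifier E n (x - y) • g y :=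
  funext fun _ => convolution_eq_swap _

theorem ae_tendsto_integral_mollifier_smul [CompleteSpace X] {g : E → X}
    (hg : LocallyIntegrable g) :
    ∀ᵐ x, Tendsto (fun n => ∫ y, mollifier E n (x - y) • g y) atTop (𝓝 (g x)) := by
  filter_upwards [ContDiffBump.ae_convolution_tendsto_right_of_locallyIntegrable (K := 2)
    (tendsto_mollifierBump_rOut E)
    (Eventually.of_forall fun n => by simp [mollifierBump, div_eq_mul_inv]) hg] with x hx
  exact hx.congr fun n => congrFun (convolution_mollifier n g) x

theorem continuous_integral_mollifier_smul {g : E → X} (hg : LocallyIntegrable g) (n : ℕ) :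
    Continuous fun x => ∫ y, mollifier E n (x - y) • g y := by
  rw [← convolution_mollifier]
  exact (hasCompactSupport_mollifier n).continuous_convolution_left
    (ContinuousLinearMap.lsmul ℝ ℝ) (continuous_mollifier n) hg

theorem contDiff_integral_mollifier_smul {g : E → X} (hg : LocallyIntegrable g) (n : ℕ) :
    ContDiff ℝ ∞ fun x => ∫ y, mollifier E n (x - y) • g y := by
  rw [← convolution_mollifier]
  exact (hasCompactSupport_mollifier n).contDiff_convolution_left
    (ContinuousLinearMap.lsmul ℝ ℝ) (contDiff_mollifier n) hg

theorem fderiv_integral_mollifier_smul {g : E → X} (hg : LocallyIntegrable g) (n : ℕ) (x a : E) :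
    fderiv ℝ (fun x => ∫ y, mollifier E n (x - y) • g y) x a
      = ∫ y, fderiv ℝ (mollifier E n) (x - y) a • g y := by
  let L : ℝ →L[ℝ] X →L[ℝ] X := ContinuousLinearMap.lsmul ℝ ℝ
  have hc := hasCompactSupport_mollifier (E := E) n
  have hdiff := hc.hasFDerivAt_convolution_left L ((contDiff_mollifier n).of_le (by simp)) hg x
  have hint : ConvolutionExistsAt (fderiv ℝ (mollifier E n)) g x (L.precompL E) :=
    (hc.fderiv (𝕜 := ℝ)).convolutionExists_left (L.precompL E)
      ((contDiff_mollifier n).continuous_fderiv (by simp)) hg x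
  rw [← convolution_mollifier, hdiff.fderiv, convolution_def,
    ContinuousLinearMap.integral_apply hint, ← integral_sub_left_eq_self _ volume x]
  simp [L]

theorem norm_integral_mollifier_smul_le {g : E → X} {C : ℝ} (hg : ∀ᵐ y, ‖g y‖ ≤ C) (n : ℕ)
    (x : E) : ‖∫ y, mollifier E n (x - y) • g y‖ ≤ C := by
  calc ‖∫ y, mollifier E n (x - y) • g y‖ ≤ ∫ y, mollifier E n (x - y) * C := by
        refine norm_integral_le_of_norm_le ((integrable_mollifier_sub n x).mul_const C) ?_
        filter_upwards [hg] with y hy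
        rw [norm_smul, Real.norm_of_nonneg (mollifier_nonneg n _)]
        exact mul_le_mul_of_nonneg_left hy (mollifier_nonneg n _)
    _ = C := by rw [integral_mul_const, integral_mollifier_sub, one_mul]

theorem tendsto_setIntegral_bilin_mollifier_smul [CompleteSpace X] {Y Z : Type*}
    [NormedAddCommGroup Y] [NormedSpace ℝ Y] [NormedAddCommGroup Z] [NormedSpace ℝ Z]
    (B : X →L[ℝ] Y →L[ℝ] Z) {S : Set E} {g : E → X} {h : E → Y} (hg : MemLp g ⊤)
    (hh : IntegrableOn h S) :
    Tendsto (fun n => ∫ x in S, B (∫ y, mollifier E n (x - y) • g y) (h x)) atTop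
      (𝓝 (∫ x in S, B (g x) (h x))) := by
  have hgl : LocallyIntegrable g := hg.locallyIntegrable le_top
  refine tendsto_integral_of_dominated_convergence (fun x => ‖B‖ * lpNorm g ⊤ volume * ‖h x‖)
    (fun n => ?_) (hh.norm.const_mul _) (fun n => ?_) ?_
  · exact B.aestronglyMeasurable_comp₂
      (continuous_integral_mollifier_smul hgl n).aestronglyMeasurable hh.1
  · refine Eventually.of_forall fun x => (B.le_opNorm₂ _ _).trans ?_
    gcongr
    exact norm_integral_mollifier_smul_le (ae_le_lpNorm_exponent_top hg) n x
  · filter_upwards [ae_restrict_of_ae (ae_tendsto_integral_mollifier_smul hgl)] with x hx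
    exact ((B.flip (h x)).continuous.tendsto _).comp hx

end Mollifier

section SignedMeasure

variable {α : Type*} [MeasurableSpace α]

theorem isFiniteMeasure_variation_signedMeasure (D : SignedMeasure α) :
    IsFiniteMeasure D.variation := by
  rw [← SignedMeasure.totalVariation_eq_variation]
  infer_instance

theorem integral_signedMeasure_eq_posPart_sub_negPart {D : SignedMeasure α} {φ : α → ℝ}
    (hφ : D.Integrable φ) :
    ∫ᵛ x, φ x ∂<•D = ∫ x, φ x ∂D.toJordanDecomposition.posPart
      - ∫ x, φ x ∂D.toJordanDecomposition.negPart := by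
  have hφ' : Integrable φ D.totalVariation := by
    rwa [SignedMeasure.totalVariation_eq_variation]
  obtain ⟨hpos, hneg⟩ := integrable_add_measure.1 hφ'
  conv_lhs => rw [← D.toSignedMeasure_toJordanDecomposition, JordanDecomposition.toSignedMeasure]
  rw [VectorMeasure.integral_sub_vectorMeasure, VectorMeasure.integral_toSignedMeasure,
    VectorMeasure.integral_toSignedMeasure]
  · rwa [VectorMeasure.Integrable, Measure.variation_toSignedMeasure]
  · rwa [VectorMeasure.Integrable, Measure.variation_toSignedMeasure]

theorem integral_withDensityᵥ {μ : Measure α} {g φ : α → ℝ} (hg : Integrable g μ)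
    (hφ : (μ.withDensityᵥ g).Integrable φ) :
    ∫ᵛ x, φ x ∂<•(μ.withDensityᵥ g) = ∫ x, φ x * g x ∂μ := by
  rw [VectorMeasure.Integrable, Measure.variation_withDensityᵥ hg] at hφ
  have hpart {k : α → ℝ} (hk : Integrable k μ) (hkg : ∀ x, ENNReal.ofReal (k x) ≤ ‖g x‖ₑ) :
      Integrable φ (μ.withDensity fun x => ENNReal.ofReal (k x)) ∧
      Integrable (fun x => φ x * max (k x) 0) μ ∧
      ∫ x, φ x ∂μ.withDensity (fun x => ENNReal.ofReal (k x)) = ∫ x, φ x * max (k x) 0 ∂μ := by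
    have hint := hφ.mono_measure (withDensity_mono (Eventually.of_forall hkg))
    have hmeas := hk.1.aemeasurable.ennreal_ofReal
    have hfin : ∀ᵐ x ∂μ, ENNReal.ofReal (k x) < ⊤ :=
      Eventually.of_forall fun x => ENNReal.ofReal_lt_top
    refine ⟨hint, ?_, ?_⟩
    · refine ((integrable_withDensity_iff_integrable_smul₀' hmeas hfin).1 hint).congr ?_
      exact Eventually.of_forall fun x => by
        simp only [smul_eq_mul, ENNReal.toReal_ofReal', mul_comm]
    · rw [integral_withDensity_eq_integral_toReal_smul₀ hmeas hfin]
      simp only [smul_eq_mul, ENNReal.toReal_ofReal', mul_comm]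
  obtain ⟨hpos, hpos', hposEq⟩ := hpart hg fun x => by
    rw [← ofReal_norm]; exact ENNReal.ofReal_le_ofReal (le_abs_self _)
  obtain ⟨hneg, hneg', hnegEq⟩ := hpart hg.neg fun x => by
    rw [← ofReal_norm]; exact ENNReal.ofReal_le_ofReal (neg_le_abs _)
  have := isFiniteMeasure_withDensity_ofReal hg.2
  have := isFiniteMeasure_withDensity_ofReal hg.neg.2
  rw [withDensityᵥ_eq_withDensity_pos_part_sub_withDensity_neg_part hg,
    VectorMeasure.integral_sub_vectorMeasure, VectorMeasure.integral_toSignedMeasure,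
    VectorMeasure.integral_toSignedMeasure]
  · simp only [Pi.neg_apply] at hnegEq hneg'
    rw [hposEq, hnegEq, ← integral_sub hpos' hneg']
    exact integral_congr_ae (Eventually.of_forall fun x => by
      simp only [← mul_sub, max_zero_sub_max_neg_zero_eq_self])
  · rwa [VectorMeasure.Integrable, Measure.variation_toSignedMeasure]
  · rwa [VectorMeasure.Integrable, Measure.variation_toSignedMeasure]

theorem integral_signedMeasure_nonpos {D : SignedMeasure α} {S : Set α} (hS : MeasurableSet S)
    (hD : ∀ B, MeasurableSet B → B ⊆ S → D B ≤ 0) {φ : α → ℝ} (hφ : ∀ x, 0 ≤ φ x)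
    (hφS : ∀ x ∉ S, φ x = 0) : ∫ᵛ x, φ x ∂<•D ≤ 0 := by
  have hDS : D ≤[S] 0 := VectorMeasure.restrict_le_restrict_of_subset_le _ _ fun B hB hBS =>
    hD B hB hBS
  have hrestrict : D.restrict S = -(D.toMeasureOfLEZero S hS hDS).toSignedMeasure := by
    ext B hB
    rw [D.restrict_apply hS hB, FunLike.coe_neg, Pi.neg_apply,
      Measure.toSignedMeasure_apply_measurable hB,
      SignedMeasure.toMeasureOfLEZero_real_apply _ _ _ hB,
      neg_neg, inter_comm]
  rw [← VectorMeasure.setIntegral_eq_integral_of_forall_compl_eq_zero hS hφS, hrestrict,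
    VectorMeasure.integral_neg_vectorMeasure, VectorMeasure.integral_toSignedMeasure,
    neg_nonpos]
  exact integral_nonneg hφ

end SignedMeasure

section TimeTest

variable {T : ℝ} {θ g : ℝ → ℝ}

/-- Test functions in time: smooth functions with compact support in `(0, T)`. -/
structure IsTimeTest (T : ℝ) (θ : ℝ → ℝ) : Prop where
  smooth : ContDiff ℝ ∞ θ
  compactSupp : HasCompactSupport θ
  supp_subset : tsupport θ ⊆ Ioo 0 T

namespace IsTimeTest

theorem eq_zero (hθ : IsTimeTest T θ) {t : ℝ} (ht : t ∉ Ioo 0 T) : θ t = 0 :=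
  image_eq_zero_of_notMem_tsupport fun h => ht (hθ.supp_subset h)

protected theorem deriv (hθ : IsTimeTest T θ) : IsTimeTest T (deriv θ) where
  smooth := contDiff_infty_iff_deriv.1 hθ.smooth |>.2
  compactSupp := hθ.compactSupp.deriv
  supp_subset := (closure_mono support_deriv_subset).trans
    ((isClosed_tsupport θ).closure_eq.subset.trans hθ.supp_subset)

theorem mul_contDiff (hθ : IsTimeTest T θ) {ρ : ℝ → ℝ} (hρ : ContDiff ℝ ∞ ρ) :
    IsTimeTest T fun t => θ t * ρ t :=
  ⟨hθ.smooth.mul hρ, hθ.compactSupp.mul_right, tsupport_mul_subset_left.trans hθ.supp_subset⟩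

theorem exists_bound (hθ : IsTimeTest T θ) : ∃ C, ∀ t, ‖θ t‖ ≤ C :=
  hθ.smooth.continuous.bounded_above_of_compact_support hθ.compactSupp

theorem integrable (hθ : IsTimeTest T θ) (μ : Measure ℝ) [IsFiniteMeasure μ] :
    Integrable θ μ := by
  obtain ⟨C, hC⟩ := hθ.exists_bound
  exact Integrable.of_bound hθ.smooth.continuous.aestronglyMeasurable C (Eventually.of_forall hC)

theorem memLp_top (hθ : IsTimeTest T θ) : MemLp θ ⊤ (timeMeas T) := by
  obtain ⟨C, hC⟩ := hθ.exists_bound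
  exact memLp_top_of_bound hθ.smooth.continuous.aestronglyMeasurable C (Eventually.of_forall hC)

theorem integrable_mul (hθ : IsTimeTest T θ) (hg : IntegrableOn g (Ioo 0 T)) :
    IntegrableOn (fun t => θ t * g t) (Ioo 0 T) := by
  obtain ⟨C, hC⟩ := hθ.exists_bound
  exact hg.bdd_mul (c := C) hθ.smooth.continuous.aestronglyMeasurable (Eventually.of_forall hC)

theorem setIntegral_deriv_mul (hθ : IsTimeTest T θ) (F : ℝ → ℝ) :
    ∫ t in Ioo 0 T, deriv θ t * F t = ∫ t, deriv θ t * F t :=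
  setIntegral_eq_integral_of_forall_compl_eq_zero fun t ht => by
    rw [hθ.deriv.eq_zero ht, zero_mul]

theorem integral_deriv (hθ : IsTimeTest T θ) : ∫ t, deriv θ t = 0 :=
  integral_eq_zero_of_hasDerivAt_of_integrable
    (fun t => (hθ.smooth.differentiable (by simp) t).hasDerivAt)
    (hθ.deriv.smooth.continuous.integrable_of_hasCompactSupport hθ.compactSupp.deriv)
    (hθ.smooth.continuous.integrable_of_hasCompactSupport hθ.compactSupp)

theorem integral_deriv_mul_measureReal_Iic (hθ : IsTimeTest T θ) (μ : Measure ℝ)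
    [IsFiniteMeasure μ] : ∫ t, deriv θ t * μ.real (Iic t) = -∫ t, θ t ∂μ := by
  have hswap := integral_integral_swap (μ := volume) (ν := μ)
    (f := fun t s => {q : ℝ × ℝ | q.2 ≤ q.1}.indicator (fun q => deriv θ q.1) (t, s)) <| by
    refine ((Integrable.mul_prod
      (hθ.deriv.smooth.continuous.integrable_of_hasCompactSupport hθ.compactSupp.deriv)
      (integrable_const (1 : ℝ))).congr (Eventually.of_forall fun q => mul_one _)).indicator ?_
    exact measurableSet_le measurable_snd measurable_fst
  have hleft (t : ℝ) : ∫ s, {q : ℝ × ℝ | q.2 ≤ q.1}.indicator (fun q => deriv θ q.1) (t, s) ∂μ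
      = deriv θ t * μ.real (Iic t) := by
    rw [mul_comm, ← smul_eq_mul, ← setIntegral_const, ← integral_indicator measurableSet_Iic]
    rfl
  have hright (s : ℝ) : ∫ t, {q : ℝ × ℝ | q.2 ≤ q.1}.indicator (fun q => deriv θ q.1) (t, s)
      = -θ s := by
    rw [← hθ.compactSupp.integral_Ioi_deriv_eq (hθ.smooth.of_le (by simp)) s,
      ← integral_Ici_eq_integral_Ioi, ← integral_indicator measurableSet_Ici]
    rfl
  simp_rw [hleft, hright] at hswap
  rw [hswap, integral_neg]

end IsTimeTest

theorem exists_measure_integral_deriv_mul_antitone {k : ℝ → ℝ} (hk : Antitone k) :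
    ∃ μ : Measure ℝ, IsFiniteMeasure μ ∧
      ∀ θ, IsTimeTest T θ → ∫ t in Ioo 0 T, deriv θ t * k t = ∫ t, θ t ∂μ := by
  set f := hk.neg.stieltjesFunction with hf
  set μ : Measure ℝ := f.measure.restrict (Ioo 0 T) with hμ
  have : IsFiniteMeasure μ := ⟨by
    rw [hμ, Measure.restrict_apply_univ, StieltjesFunction.measure_Ioo]
    exact ENNReal.ofReal_lt_top⟩
  have hkμ : ∀ᵐ t ∂timeMeas T, k t = -f 0 - μ.real (Iic t) := by
    filter_upwards [ae_restrict_mem measurableSet_Ioo,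
      ae_restrict_of_ae (hk.neg.countable_not_continuousAt.ae_notMem volume)] with t ht hcont
    have hft : f t = -k t := by
      rw [hf, hk.neg.stieltjesFunction_eq]
      exact (not_not.1 hcont).continuousWithinAt.rightLim_eq
    have hIoc : Iic t ∩ Ioo 0 T = Ioc 0 t := by
      ext x
      exact ⟨fun hx => ⟨hx.2.1, hx.1⟩, fun hx => ⟨hx.2, hx.1, hx.2.trans_lt ht.2⟩⟩
    rw [hμ, Measure.real, Measure.restrict_apply measurableSet_Iic, hIoc,
      StieltjesFunction.measure_Ioc, ENNReal.toReal_ofReal (sub_nonneg.2 (f.mono ht.1.le)), hft]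
    ring
  refine ⟨μ, this, fun θ hθ => ?_⟩
  have hint : IntegrableOn (fun t => μ.real (Iic t)) (Ioo 0 T) := by
    have hmono : Monotone fun t => μ.real (Iic t) := fun s t hst =>
      measureReal_mono (Iic_subset_Iic.2 hst)
    refine Integrable.of_bound hmono.measurable.aestronglyMeasurable (μ.real univ)
      (Eventually.of_forall fun t => ?_)
    rw [Real.norm_of_nonneg measureReal_nonneg]
    exact measureReal_mono (subset_univ _)
  calc ∫ t in Ioo 0 T, deriv θ t * k t
      = ∫ t in Ioo 0 T, (deriv θ t * -f 0 - deriv θ t * μ.real (Iic t)) :=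
        integral_congr_ae (hkμ.mono fun t ht => by simp only [ht, mul_sub])
    _ = ∫ t, θ t ∂μ := by
        rw [integral_sub (hθ.deriv.integrable_mul (integrable_const _))
          (hθ.deriv.integrable_mul hint), hθ.setIntegral_deriv_mul, hθ.setIntegral_deriv_mul,
          hθ.integral_deriv_mul_measureReal_Iic, integral_mul_const, hθ.integral_deriv]
        ring

end TimeTest

section Primitive

variable {T : ℝ} {g : ℝ → ℝ}

theorem intervalIntegrable_of_integrableOn_Ioo {V : Type*} [NormedAddCommGroup V] {g : ℝ → V}
    (hg : IntegrableOn g (Ioo 0 T)) {s t : ℝ} (hs : s ∈ Icc 0 T) (ht : t ∈ Icc 0 T) :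
    IntervalIntegrable g volume s t :=
  (((integrableOn_Icc_iff_integrableOn_Ioo).2 hg).mono_set
    (uIcc_subset_Icc hs ht)).intervalIntegrable

theorem continuousOn_primitive_Icc {V : Type*} [NormedAddCommGroup V] [NormedSpace ℝ V]
    {g : ℝ → V} (hg : IntegrableOn g (Ioo 0 T)) :
    ContinuousOn (fun t => ∫ s in (0 : ℝ)..t, g s) (Icc 0 T) := by
  rcases le_or_gt 0 T with hT | hT
  · have h := intervalIntegral.continuousOn_primitive_interval (f := g) (a := 0) (b := T)
      (μ := volume) (by rwa [uIcc_of_le hT, integrableOn_Icc_iff_integrableOn_Ioo])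
    rwa [uIcc_of_le hT] at h
  · simp [Icc_eq_empty hT.not_ge]

theorem memLp_top_of_continuousOn_Icc {V : Type*} [NormedAddCommGroup V] {g : ℝ → V}
    (hg : ContinuousOn g (Icc 0 T)) : MemLp g ⊤ (timeMeas T) := by
  obtain ⟨C, hC⟩ := isCompact_Icc.exists_bound_of_continuousOn hg
  refine memLp_top_of_bound ((hg.aestronglyMeasurable_of_isCompact isCompact_Icc
    measurableSet_Icc).mono_measure (Measure.restrict_mono_set _ Ioo_subset_Icc_self)) C ?_
  filter_upwards [ae_restrict_mem measurableSet_Ioo] with t ht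
  exact hC t (Ioo_subset_Icc_self ht)

theorem integral_deriv_mul_primitive {θ : ℝ → ℝ} (hθ : IsTimeTest T θ)
    (hg : IntegrableOn g (Ioo 0 T)) (c : ℝ) :
    ∫ t in Ioo 0 T, deriv θ t * (c + ∫ s in (0 : ℝ)..t, g s) = -∫ t in Ioo 0 T, θ t * g t := by
  rcases le_or_gt T 0 with hT | hT
  · simp [Ioo_eq_empty hT.not_gt]
  have hgi : IntervalIntegrable g volume 0 T :=
    intervalIntegrable_of_integrableOn_Ioo hg (left_mem_Icc.2 hT.le) (right_mem_Icc.2 hT.le)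
  have hac := hgi.absolutelyContinuousOnInterval_intervalIntegral (c := 0) (by simp)
  have hθac : AbsolutelyContinuousOnInterval θ 0 T :=
    (hθ.smooth.of_le (by simp)).contDiffOn.absolutelyContinuousOnInterval
  have hparts := hθac.integral_mul_deriv_eq_deriv_mul hac
  have hderiv : ∫ t in (0 : ℝ)..T, θ t * deriv (fun x => ∫ s in (0 : ℝ)..x, g s) t
      = ∫ t in (0 : ℝ)..T, θ t * g t := by
    refine intervalIntegral.integral_congr_ae ?_
    filter_upwards [hgi.ae_hasDerivAt_integral] with t ht htm
    rw [(ht (uIoc_subset_uIcc htm) 0 (by simp)).deriv]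
  have hprim : IntegrableOn (fun t => ∫ s in (0 : ℝ)..t, g s) (Ioo 0 T) :=
    (memLp_top_of_continuousOn_Icc (continuousOn_primitive_Icc hg)).integrable le_top
  simp only [intervalIntegral.integral_of_le hT.le, integral_Ioc_eq_integral_Ioo] at hparts hderiv
  rw [hderiv, hθ.eq_zero (by simp), hθ.eq_zero (by simp)] at hparts
  simp_rw [mul_add]
  rw [integral_add (hθ.deriv.integrable_mul (integrable_const _)) (hθ.deriv.integrable_mul hprim),
    hθ.setIntegral_deriv_mul, integral_mul_const, hθ.integral_deriv, hparts]
  ring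

/-- The primitive of `g` vanishing at the origin; `dF/dt + g ≤ 0` says that `F + prim g` is
nonincreasing. -/
def prim (g : ℝ → ℝ) (t : ℝ) : ℝ := ∫ s in (0 : ℝ)..t, g s

theorem continuousOn_prim (hg : IntegrableOn g (Ioo 0 T)) : ContinuousOn (prim g) (Icc 0 T) :=
  continuousOn_primitive_Icc hg

theorem memLp_top_prim (hg : IntegrableOn g (Ioo 0 T)) : MemLp (prim g) ⊤ (timeMeas T) :=
  memLp_top_of_continuousOn_Icc (continuousOn_prim hg)

theorem prim_sub_prim (hg : IntegrableOn g (Ioo 0 T)) {s t : ℝ} (hs : s ∈ Icc 0 T)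
    (ht : t ∈ Icc 0 T) : prim g t - prim g s = ∫ τ in s..t, g τ :=
  have h0 : (0 : ℝ) ∈ Icc 0 T := left_mem_Icc.2 (hs.1.trans hs.2)
  intervalIntegral.integral_interval_sub_left (intervalIntegrable_of_integrableOn_Ioo hg h0 ht)
    (intervalIntegrable_of_integrableOn_Ioo hg h0 hs)

end Primitive

section MollifiedIndicator

variable {n : ℕ} {s t T : ℝ}

/-- The mollification of the indicator function of the interval `[s, t]`. -/
def mollifiedIndicator (n : ℕ) (s t x : ℝ) : ℝ := ∫ y in s..t, mollifier ℝ n (x - y)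

theorem hasDerivAt_mollifiedIndicator (n : ℕ) (s t x : ℝ) :
    HasDerivAt (mollifiedIndicator n s t) (mollifier ℝ n (x - s) - mollifier ℝ n (x - t)) x := by
  have hcont := continuous_mollifier (E := ℝ) n
  have hprim (a : ℝ) : HasDerivAt (fun x => prim (mollifier ℝ n) (x - a))
      (mollifier ℝ n (x - a)) x :=
    HasDerivAt.comp_sub_const x a (hcont.integral_hasStrictDerivAt 0 (x - a)).hasDerivAt
  refine ((hprim s).sub (hprim t)).congr_of_eventuallyEq (Eventually.of_forall fun x => ?_)
  change ∫ y in s..t, mollifier ℝ n (x - y) = prim _ _ - prim _ _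
  rw [intervalIntegral.integral_comp_sub_left, prim, prim,
    intervalIntegral.integral_interval_sub_left (hcont.intervalIntegrable _ _)
      (hcont.intervalIntegrable _ _)]

theorem contDiff_mollifiedIndicator (n : ℕ) (s t : ℝ) :
    ContDiff ℝ ∞ (mollifiedIndicator n s t) := by
  rw [contDiff_infty_iff_deriv]
  refine ⟨fun x => (hasDerivAt_mollifiedIndicator n s t x).differentiableAt, ?_⟩
  rw [funext fun x => (hasDerivAt_mollifiedIndicator n s t x).deriv]
  exact ((contDiff_mollifier n).comp (contDiff_id.sub contDiff_const)).sub
    ((contDiff_mollifier n).comp (contDiff_id.sub contDiff_const))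

theorem mollifiedIndicator_nonneg (hst : s ≤ t) (x : ℝ) : 0 ≤ mollifiedIndicator n s t x :=
  intervalIntegral.integral_nonneg hst fun _ _ => mollifier_nonneg n _

theorem support_mollifiedIndicator_subset (hst : s ≤ t) :
    Function.support (mollifiedIndicator n s t)
      ⊆ Icc (s - (mollifierBump ℝ n).rOut) (t + (mollifierBump ℝ n).rOut) := by
  intro x hx
  by_contra hx'
  refine hx ((intervalIntegral.integral_congr fun y hy => ?_).trans
    intervalIntegral.integral_zero)
  rw [uIcc_of_le hst] at hy
  refine mollifier_eq_zero (le_abs.2 ?_)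
  rw [mem_Icc, not_and_or, not_le, not_le] at hx'
  exact hx'.symm.imp (fun h => by linarith [hy.2]) fun h => by linarith [hy.1]

theorem isTimeTest_mollifiedIndicator (hst : s ≤ t) (hs : (mollifierBump ℝ n).rOut < s)
    (ht : (mollifierBump ℝ n).rOut < T - t) : IsTimeTest T (mollifiedIndicator n s t) where
  smooth := contDiff_mollifiedIndicator n s t
  compactSupp := HasCompactSupport.of_support_subset_isCompact isCompact_Icc
    (support_mollifiedIndicator_subset hst)
  supp_subset := (closure_minimal (support_mollifiedIndicator_subset hst) isClosed_Icc).trans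
    (Icc_subset_Ioo (sub_pos.2 hs) (by linarith))

end MollifiedIndicator

section AEAntitone

variable {T : ℝ} {F g H : ℝ → ℝ}

/-- `H` agrees almost everywhere on `(0, T)` with a nonincreasing function. All forms of the
inequality `dF/dt + g ≤ 0` amount to this property of `F + prim g`. -/
def AEAntitone (T : ℝ) (H : ℝ → ℝ) : Prop :=
  ∃ k : ℝ → ℝ, Antitone k ∧ H =ᵐ[timeMeas T] k

theorem aeAntitone_of_antitoneOn (hH : MemLp H ⊤ (timeMeas T)) {S : Set ℝ}
    (hS : AntitoneOn H S) (hae : ∀ᵐ t ∂timeMeas T, t ∈ S) : AEAntitone T H := by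
  set C := lpNorm H ⊤ (timeMeas T)
  obtain ⟨k, hk, hkH⟩ := (hS.mono (inter_subset_left (t := {t | ‖H t‖ ≤ C})))
    |>.exists_antitone_extension
      ⟨-C, by rintro _ ⟨t, ht, rfl⟩; exact (abs_le.1 ht.2).1⟩
      ⟨C, by rintro _ ⟨t, ht, rfl⟩; exact (abs_le.1 ht.2).2⟩
  refine ⟨k, hk, ?_⟩
  filter_upwards [hae, ae_le_lpNorm_exponent_top hH] with t htS htC
  exact hkH ⟨htS, htC⟩

theorem integral_mollifier_smul_le_of_integral_deriv_nonneg (hH : IntegrableOn H (Ioo 0 T))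
    (h : ∀ θ, IsTimeTest T θ → (∀ t, 0 ≤ θ t) → 0 ≤ ∫ t in Ioo 0 T, deriv θ t * H t) {n : ℕ}
    {s t : ℝ} (hst : s ≤ t) (hs : (mollifierBump ℝ n).rOut < s)
    (ht : (mollifierBump ℝ n).rOut < T - t) :
    ∫ y, mollifier ℝ n (t - y) • (Ioo 0 T).indicator H y
      ≤ ∫ y, mollifier ℝ n (s - y) • (Ioo 0 T).indicator H y := by
  have hmoll (x : ℝ) : ∫ y, mollifier ℝ n (x - y) • (Ioo 0 T).indicator H y
      = ∫ y in Ioo 0 T, mollifier ℝ n (y - x) * H y := by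
    rw [← integral_indicator measurableSet_Ioo]
    congr 1
    ext y
    rw [indicator_mul_right, mollifier_sub_comm, smul_eq_mul]
  have hint (x : ℝ) : IntegrableOn (fun y => mollifier ℝ n (y - x) * H y) (Ioo 0 T) := by
    obtain ⟨C, hC⟩ := exists_bound_mollifier (E := ℝ) n
    exact hH.bdd_mul (c := C)
      ((continuous_mollifier n).comp (continuous_id.sub continuous_const)).aestronglyMeasurable
      (Eventually.of_forall fun y => hC _)
  have htest := h _ (isTimeTest_mollifiedIndicator hst hs ht) (mollifiedIndicator_nonneg hst)
  simp_rw [(hasDerivAt_mollifiedIndicator n s t _).deriv, sub_mul] at htest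
  rw [integral_sub (hint s) (hint t), sub_nonneg] at htest
  rwa [hmoll, hmoll]

theorem aeAntitone_of_integral_deriv_nonneg (hH : MemLp H ⊤ (timeMeas T))
    (h : ∀ θ, IsTimeTest T θ → (∀ t, 0 ≤ θ t) → 0 ≤ ∫ t in Ioo 0 T, deriv θ t * H t) :
    AEAntitone T H := by
  have hHi : IntegrableOn H (Ioo 0 T) := hH.integrable le_top
  have hlebesgue := ae_restrict_of_ae (s := Ioo 0 T) <| ae_tendsto_integral_mollifier_smul
    ((integrable_indicator_iff measurableSet_Ioo).2 hHi).locallyIntegrable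
  refine aeAntitone_of_antitoneOn (S := {t | t ∈ Ioo 0 T ∧ Tendsto (fun n => ∫ y,
    mollifier ℝ n (t - y) • (Ioo 0 T).indicator H y) atTop (𝓝 (H t))}) hH ?_ ?_
  · intro s hs t ht hst
    refine le_of_tendsto_of_tendsto ht.2 hs.2 ?_
    have hr := tendsto_mollifierBump_rOut ℝ
    filter_upwards [hr.eventually_lt_const hs.1.1,
      hr.eventually_lt_const (sub_pos.2 ht.1.2)] with n hns hnt
    exact integral_mollifier_smul_le_of_integral_deriv_nonneg hHi h hst hns hnt
  · filter_upwards [hlebesgue, ae_restrict_mem measurableSet_Ioo] with t hlim ht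
    rw [indicator_of_mem ht] at hlim
    exact ⟨ht, hlim⟩

end AEAntitone

section DistributionalInequality

variable {T : ℝ} {F g : ℝ → ℝ}

/-- The inequality `dF/dt + g ≤ 0` in the sense of distributions on `(0, T)`. -/
def WeakNonpos (T : ℝ) (F g : ℝ → ℝ) : Prop :=
  ∀ θ, IsTimeTest T θ → (∀ t, 0 ≤ θ t) →
    -(∫ t in Ioo 0 T, deriv θ t * F t) + ∫ t in Ioo 0 T, θ t * g t ≤ 0

theorem integral_deriv_mul_add_prim {θ : ℝ → ℝ} (hθ : IsTimeTest T θ)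
    (hF : IntegrableOn F (Ioo 0 T)) (hg : IntegrableOn g (Ioo 0 T)) :
    ∫ t in Ioo 0 T, deriv θ t * (F t + prim g t)
      = (∫ t in Ioo 0 T, deriv θ t * F t) - ∫ t in Ioo 0 T, θ t * g t := by
  have hparts := integral_deriv_mul_primitive hθ hg 0
  simp only [zero_add] at hparts
  simp_rw [mul_add]
  rw [integral_add (hθ.deriv.integrable_mul hF)
      (hθ.deriv.integrable_mul ((memLp_top_prim hg).integrable le_top)),
    sub_eq_add_neg, ← hparts]
  rfl

theorem WeakNonpos.aeAntitone (h : WeakNonpos T F g) (hF : MemLp F ⊤ (timeMeas T))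
    (hg : IntegrableOn g (Ioo 0 T)) : AEAntitone T fun t => F t + prim g t :=
  aeAntitone_of_integral_deriv_nonneg (hF.add (memLp_top_prim hg)) fun θ hθ hθ0 => by
    rw [integral_deriv_mul_add_prim hθ (hF.integrable le_top) hg]
    linarith [h θ hθ hθ0]

theorem AEAntitone.derivAddNonpos (h : AEAntitone T fun t => F t + prim g t)
    (hF : IntegrableOn F (Ioo 0 T)) (hg : IntegrableOn g (Ioo 0 T)) : DerivAddNonpos T F g := by
  obtain ⟨k, hk, hFk⟩ := h
  obtain ⟨μ, hμ, hkμ⟩ := exists_measure_integral_deriv_mul_antitone (T := T) hk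
  refine ⟨hg, -(timeMeas T).withDensityᵥ g - μ.toSignedMeasure, ⟨hF, fun φ h1 h2 h3 => ?_⟩,
    fun B hB hBT => ?_⟩
  · have hφ : IsTimeTest T φ := ⟨h1, h2, h3⟩
    have hint (D : SignedMeasure ℝ) : D.Integrable φ :=
      have := isFiniteMeasure_variation_signedMeasure D
      hφ.integrable _
    rw [← integral_signedMeasure_eq_posPart_sub_negPart (hint _),
      VectorMeasure.integral_sub_vectorMeasure (hint _) (hint _),
      VectorMeasure.integral_neg_vectorMeasure, VectorMeasure.integral_toSignedMeasure,
      integral_withDensityᵥ hg (hint _), ← hkμ φ hφ]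
    have hcongr := integral_congr_ae (hFk.mono fun t ht => congrArg (deriv φ t * ·) ht)
    linarith [integral_deriv_mul_add_prim hφ hF hg]
  · rw [sub_apply, neg_apply, withDensityᵥ_apply hg hB,
      Measure.restrict_restrict hB, inter_eq_left.2 hBT,
      Measure.toSignedMeasure_apply_measurable hB]
    linarith [measureReal_nonneg (μ := μ) (s := B)]

theorem DerivAddNonpos.weakNonpos (h : DerivAddNonpos T F g) : WeakNonpos T F g := by
  obtain ⟨hg, D, ⟨-, hD⟩, hneg⟩ := h
  intro θ hθ hθ0
  have hint (D : SignedMeasure ℝ) : D.Integrable θ :=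
    have := isFiniteMeasure_variation_signedMeasure D
    hθ.integrable _
  rw [hD θ hθ.smooth hθ.compactSupp hθ.supp_subset, neg_neg,
    ← integral_signedMeasure_eq_posPart_sub_negPart (hint _), ← integral_withDensityᵥ hg (hint _),
    ← VectorMeasure.integral_add_vectorMeasure (hint _) (hint _)]
  refine integral_signedMeasure_nonpos measurableSet_Ioo (fun B hB hBT => ?_) hθ0
    fun t ht => hθ.eq_zero ht
  rw [add_apply, withDensityᵥ_apply hg hB, Measure.restrict_restrict hB, inter_eq_left.2 hBT]
  exact hneg B hB hBT

theorem derivAddNonpos_iff_weakNonpos (hF : MemLp F ⊤ (timeMeas T))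
    (hg : IntegrableOn g (Ioo 0 T)) : DerivAddNonpos T F g ↔ WeakNonpos T F g :=
  ⟨fun h => h.weakNonpos, fun h => (h.aeAntitone hF hg).derivAddNonpos (hF.integrable le_top) hg⟩

end DistributionalInequality

section OneSidedLimits

variable {T : ℝ} {F g : ℝ → ℝ}

/-- The inequality `dF/dt + g ≤ 0` in integrated form, with essential one-sided limits. -/
def LimNonpos (T : ℝ) (F g : ℝ → ℝ) : Prop :=
  ∃ Fr Fl : ℝ → ℝ, (∀ t ∈ Icc 0 T, IsRightLim T F t (Fr t)) ∧
    (∀ t ∈ Icc 0 T, IsLeftLim T F t (Fl t)) ∧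
      ∀ s ∈ Icc 0 T, ∀ t ∈ Icc s T, Fr t + ∫ τ in s..t, g τ ≤ Fl s

theorem tendsto_sub_prim_of_ae_eq {k : ℝ → ℝ} (hg : IntegrableOn g (Ioo 0 T))
    (hFk : (fun t => F t + prim g t) =ᵐ[timeMeas T] k) {A : Set ℝ} (hA : A ⊆ Ioo 0 T) {t a : ℝ}
    (ht : t ∈ Icc 0 T) (hka : Tendsto k (𝓝[A] t) (𝓝 a)) :
    Tendsto F (𝓝[A] t ⊓ ae volume) (𝓝 (a - prim g t)) := by
  have hprim : Tendsto (prim g) (𝓝[A] t) (𝓝 (prim g t)) :=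
    (continuousOn_prim hg t ht).mono_left (nhdsWithin_mono _ (hA.trans Ioo_subset_Icc_self))
  refine ((hka.sub hprim).mono_left inf_le_left).congr' ?_
  have hmem : ∀ᶠ x in 𝓝[A] t, x ∈ A := self_mem_nhdsWithin
  filter_upwards [hmem.filter_mono inf_le_left,
    ((ae_restrict_iff' measurableSet_Ioo).1 hFk).filter_mono inf_le_right] with x hx hFx
  rw [← hFx (hA hx), add_sub_cancel_right]

theorem AEAntitone.limNonpos (h : AEAntitone T fun t => F t + prim g t) (hT : 0 < T)
    (hg : IntegrableOn g (Ioo 0 T)) : LimNonpos T F g := by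
  obtain ⟨k, hk, hFk⟩ := h
  have hright {t : ℝ} : Tendsto k (𝓝[Ioo t T] t) (𝓝 (Function.rightLim k t)) :=
    (hk.tendsto_rightLim t).mono_left (nhdsWithin_mono _ Ioo_subset_Ioi_self)
  have hleft {t : ℝ} : Tendsto k (𝓝[Ioo 0 t] t) (𝓝 (Function.leftLim k t)) :=
    (hk.tendsto_leftLim t).mono_left (nhdsWithin_mono _ Ioo_subset_Iio_self)
  refine ⟨fun t => (if t < T then Function.rightLim k t else Function.leftLim k t) - prim g t,
    fun t => (if 0 < t then Function.leftLim k t else Function.rightLim k t) - prim g t,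
    fun t ht => ?_, fun t ht => ?_, fun s hs t ht => ?_⟩
  · simp only [IsRightLim]
    split_ifs with htT
    · exact tendsto_sub_prim_of_ae_eq hg hFk (Ioo_subset_Ioo_left ht.1) ht hright
    · obtain rfl : t = T := le_antisymm ht.2 (not_lt.1 htT)
      exact tendsto_sub_prim_of_ae_eq hg hFk Subset.rfl ht hleft
  · simp only [IsLeftLim]
    split_ifs with ht0
    · exact tendsto_sub_prim_of_ae_eq hg hFk (Ioo_subset_Ioo_right ht.2) ht hleft
    · obtain rfl : t = 0 := le_antisymm (not_lt.1 ht0) ht.1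
      exact tendsto_sub_prim_of_ae_eq hg hFk Subset.rfl ht hright
  · have hlim : (if t < T then Function.rightLim k t else Function.leftLim k t)
        ≤ if 0 < s then Function.leftLim k s else Function.rightLim k s := by
      split_ifs with htT hs0 hs0
      · exact hk.rightLim_le_leftLim ht.1
      · exact hk.rightLim ht.1
      · exact hk.leftLim ht.1
      · exact hk.leftLim_le_rightLim (by linarith [hs.1])
    rw [← prim_sub_prim hg hs ⟨hs.1.trans ht.1, ht.2⟩]
    linarith

theorem ae_hasDerivAt_prim (hg : IntegrableOn g (Ioo 0 T)) :
    ∀ᵐ t ∂timeMeas T, HasDerivAt (prim g) (g t) t := by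
  rcases le_or_gt T 0 with hT | hT
  · simp [Ioo_eq_empty hT.not_gt]
  have hgi : IntervalIntegrable g volume 0 T :=
    intervalIntegrable_of_integrableOn_Ioo hg (left_mem_Icc.2 hT.le) (right_mem_Icc.2 hT.le)
  filter_upwards [ae_restrict_mem measurableSet_Ioo,
    ae_restrict_of_ae hgi.ae_hasDerivAt_integral] with t ht hderiv
  exact hderiv (by rw [uIcc_of_le hT.le]; exact Ioo_subset_Icc_self ht) 0 left_mem_uIcc

theorem stronglyMeasurableAtFilter_of_integrableOn_Ioo (hg : IntegrableOn g (Ioo 0 T)) {t : ℝ}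
    (ht : t ∈ Ioo 0 T) : StronglyMeasurableAtFilter g (𝓝 t) :=
  ⟨Ioo 0 T, Ioo_mem_nhds ht.1 ht.2, hg.1⟩

theorem ae_eq_of_isRightLim {Fr : ℝ → ℝ} (hF : IntegrableOn F (Ioo 0 T))
    (hr : ∀ t ∈ Icc 0 T, IsRightLim T F t (Fr t)) : F =ᵐ[timeMeas T] Fr := by
  filter_upwards [ae_restrict_mem measurableSet_Ioo, ae_hasDerivAt_prim hF] with t ht hderiv
  have htIcc := Ioo_subset_Icc_self ht
  have hlim := hr t htIcc
  rw [IsRightLim, if_pos ht.2, nhdsWithin_Ioo_eq_nhdsGT ht.2] at hlim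
  have hderivRight := intervalIntegral.integral_hasDerivWithinAt_of_tendsto_ae_right (s := Ici t)
    (t := Ioi t) (intervalIntegrable_of_integrableOn_Ioo hF
      (left_mem_Icc.2 (htIcc.1.trans htIcc.2)) htIcc)
    ((stronglyMeasurableAtFilter_of_integrableOn_Ioo hF ht).filter_mono nhdsWithin_le_nhds) hlim
  exact (uniqueDiffWithinAt_Ici t).eq_deriv _ hderiv.hasDerivWithinAt hderivRight

theorem ae_eq_of_isLeftLim {Fl : ℝ → ℝ} (hF : IntegrableOn F (Ioo 0 T))
    (hl : ∀ t ∈ Icc 0 T, IsLeftLim T F t (Fl t)) : F =ᵐ[timeMeas T] Fl := by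
  filter_upwards [ae_restrict_mem measurableSet_Ioo, ae_hasDerivAt_prim hF] with t ht hderiv
  have htIcc := Ioo_subset_Icc_self ht
  have hlim := hl t htIcc
  rw [IsLeftLim, if_pos ht.1, nhdsWithin_Ioo_eq_nhdsLT ht.1] at hlim
  have hfilter : 𝓝[≤] t ⊓ ae volume ≤ 𝓝[<] t := by
    refine le_inf (inf_le_left.trans nhdsWithin_le_nhds) (le_principal_iff.2 ?_)
    have hmem : ∀ᶠ x in 𝓝[≤] t, x ≤ t := self_mem_nhdsWithin
    filter_upwards [hmem.filter_mono inf_le_left,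
      (Measure.ae_ne volume t).filter_mono inf_le_right] with x hx hxt
    exact lt_of_le_of_ne hx hxt
  have hderivLeft := intervalIntegral.integral_hasDerivWithinAt_of_tendsto_ae_right (s := Iic t)
    (t := Iic t) (intervalIntegrable_of_integrableOn_Ioo hF
      (left_mem_Icc.2 (htIcc.1.trans htIcc.2)) htIcc)
    ((stronglyMeasurableAtFilter_of_integrableOn_Ioo hF ht).filter_mono nhdsWithin_le_nhds)
    (hlim.mono_left (le_inf hfilter inf_le_right))
  exact (uniqueDiffWithinAt_Iic t).eq_deriv _ hderiv.hasDerivWithinAt hderivLeft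

theorem LimNonpos.aeAntitone (h : LimNonpos T F g) (hF : MemLp F ⊤ (timeMeas T))
    (hg : IntegrableOn g (Ioo 0 T)) : AEAntitone T fun t => F t + prim g t := by
  obtain ⟨Fr, Fl, hr, hl, hle⟩ := h
  refine aeAntitone_of_antitoneOn (S := {t | t ∈ Ioo 0 T ∧ F t = Fr t ∧ F t = Fl t})
    (hF.add (memLp_top_prim hg)) ?_ ?_
  · rintro s ⟨hs, -, hsl⟩ t ⟨ht, htr, -⟩ hst
    have hineq := hle s (Ioo_subset_Icc_self hs) t ⟨hst, ht.2.le⟩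
    rw [← prim_sub_prim hg (Ioo_subset_Icc_self hs) (Ioo_subset_Icc_self ht), ← htr, ← hsl]
      at hineq
    simp only
    linarith
  · have hFi : IntegrableOn F (Ioo 0 T) := hF.integrable le_top
    filter_upwards [ae_restrict_mem measurableSet_Ioo, ae_eq_of_isRightLim hFi hr,
      ae_eq_of_isLeftLim hFi hl] with t ht htr htl using ⟨ht, htr, htl⟩

theorem limNonpos_iff_weakNonpos (hT : 0 < T) (hF : MemLp F ⊤ (timeMeas T))
    (hg : IntegrableOn g (Ioo 0 T)) : LimNonpos T F g ↔ WeakNonpos T F g :=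
  ⟨fun h => ((h.aeAntitone hF hg).derivAddNonpos (hF.integrable le_top) hg).weakNonpos,
    fun h => (h.aeAntitone hF hg).limNonpos hT hg⟩

end OneSidedLimits

/-- The real inner product as a continuous bilinear map (`innerSL ℝ` is conjugate linear by its
type, which obstructs the use of results on bilinear maps). -/
def innerB (E : Type*) [NormedAddCommGroup E] [InnerProductSpace ℝ E] : E →L[ℝ] E →L[ℝ] ℝ :=
  innerSL ℝ

section WeakGradient

variable {d : ℕ} {Ω : Set (Vec d)}

/-- The classical divergence of a vector field. -/
def divField (Φ : Vec d → Vec d) (x : Vec d) : ℝ :=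
  ∑ i, fderiv ℝ Φ x (EuclideanSpace.single i 1) i

theorem sum_fderiv_single_mul {η : Vec d → ℝ} (x a : Vec d) :
    ∑ i, fderiv ℝ η x (EuclideanSpace.single i 1) * a i = fderiv ℝ η x a := by
  have ha : a = ∑ i, a i • EuclideanSpace.single i (1 : ℝ) := by
    ext j
    simp [Finset.sum_apply, Pi.single_apply]
  conv_rhs => rw [ha, map_sum]
  simp [mul_comm]

theorem divField_smul {η : Vec d → ℝ} {Φ : Vec d → Vec d} {x : Vec d}
    (hη : DifferentiableAt ℝ η x) (hΦ : DifferentiableAt ℝ Φ x) :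
    divField (fun y => η y • Φ y) x = fderiv ℝ η x (Φ x) + η x * divField Φ x := by
  unfold divField
  rw [fderiv_fun_smul hη hΦ, Finset.mul_sum, ← sum_fderiv_single_mul x (Φ x),
    ← Finset.sum_add_distrib]
  exact Finset.sum_congr rfl fun i _ => by simp [add_comm]

theorem fderiv_coord {Φ : Vec d → Vec d} {x : Vec d} (hΦ : DifferentiableAt ℝ Φ x)
    (i : Fin d) (a : Vec d) : fderiv ℝ (fun y => Φ y i) x a = fderiv ℝ Φ x a i :=
  congrArg (· a) ((EuclideanSpace.proj i : Vec d →L[ℝ] ℝ).hasFDerivAt.comp x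
    hΦ.hasFDerivAt).fderiv

theorem hasCompactSupport_coord {Φ : Vec d → Vec d} (hΦ : HasCompactSupport Φ) (i : Fin d) :
    HasCompactSupport fun y => Φ y i :=
  hΦ.comp_left (g := fun z : Vec d => z i) rfl

theorem tsupport_coord_subset (Φ : Vec d → Vec d) (i : Fin d) :
    tsupport (fun y => Φ y i) ⊆ tsupport Φ :=
  tsupport_comp_subset (g := fun z : Vec d => z i) rfl Φ

theorem continuous_fderiv_apply {η : Vec d → ℝ} (hη : ContDiff ℝ ∞ η) (a : Vec d) :
    Continuous fun x => fderiv ℝ η x a :=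
  (hη.continuous_fderiv (by simp)).clm_apply continuous_const

theorem hasCompactSupport_fderiv_apply {η : Vec d → ℝ} (hc : HasCompactSupport η) (a : Vec d) :
    HasCompactSupport fun x => fderiv ℝ η x a :=
  (hc.fderiv (𝕜 := ℝ)).comp_left (g := fun L : Vec d →L[ℝ] ℝ => L a) rfl

theorem integrableOn_mul_of_hasCompactSupport {w η : Vec d → ℝ} (hw : IntegrableOn w Ω)
    (hη : Continuous η) (hc : HasCompactSupport η) : IntegrableOn (fun x => w x * η x) Ω := by
  obtain ⟨C, hC⟩ := hη.bounded_above_of_compact_support hc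
  exact hw.mul_bdd (c := C) hη.aestronglyMeasurable (Eventually.of_forall hC)

theorem TestField.exists_bound (Φ : TestField Ω) : ∃ C, ∀ x, ‖Φ.toFun x‖ ≤ C :=
  Φ.smooth.continuous.bounded_above_of_compact_support Φ.compactSupp

theorem TestField.integrableOn_inner (Φ : TestField Ω) {r : Vec d → Vec d}
    (hr : IntegrableOn r Ω) : IntegrableOn (fun x => inner ℝ (Φ.toFun x) (r x)) Ω := by
  obtain ⟨C, hC⟩ := Φ.exists_bound
  refine (hr.norm.const_mul C).mono' (Φ.smooth.continuous.aestronglyMeasurable.inner hr.1)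
    (Eventually.of_forall fun x => (norm_inner_le_norm _ _).trans ?_)
  gcongr
  exact hC x

/-- A scalar multiple of a test field, as a test field. -/
def TestField.smul (Φ : TestField Ω) {η : Vec d → ℝ} (hη : ContDiff ℝ ∞ η) : TestField Ω where
  toFun x := η x • Φ.toFun x
  smooth := ContDiff.smul hη Φ.smooth
  compactSupp := HasCompactSupport.smul_left (f := η) Φ.compactSupp
  supp_subset := (closure_mono (Function.support_smul_subset_right η _)).trans Φ.supp_subset

theorem SolField.divField_eq_zero (φ : SolField Ω) (x : Vec d) : divField φ.toFun x = 0 :=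
  φ.div_free x

/-- `G` is the weak gradient of the scalar function `w` in `Ω`; used for the components of vector
fields, the rows of whose weak gradients are such `G`. -/
def HasScalarWeakGrad (Ω : Set (Vec d)) (w : Vec d → ℝ) (G : Vec d → Vec d) : Prop :=
  ∀ j, HasWeakPartial Ω w (fun x => G x j) j

namespace HasScalarWeakGrad

variable {w : Vec d → ℝ} {G : Vec d → Vec d}

theorem integral_mul_divField (h : HasScalarWeakGrad Ω w G) (hw : IntegrableOn w Ω)
    (hG : IntegrableOn G Ω) (Φ : TestField Ω) :
    ∫ x in Ω, w x * divField Φ.toFun x = -∫ x in Ω, inner ℝ (Φ.toFun x) (G x) := by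
  have hΦ j : ContDiff ℝ ∞ fun x => Φ.toFun x j := contDiff_euclidean.1 Φ.smooth j
  have hc j := hasCompactSupport_coord Φ.compactSupp j
  have hGj j : IntegrableOn (fun x => G x j) Ω :=
    (EuclideanSpace.proj j : Vec d →L[ℝ] ℝ).integrable_comp hG
  have hpart j := h j _ (hΦ j) (hc j) ((tsupport_coord_subset _ j).trans Φ.supp_subset)
  have hdiv x : divField Φ.toFun x
      = ∑ j, fderiv ℝ (fun y => Φ.toFun y j) x (EuclideanSpace.single j 1) := by
    simp only [fderiv_coord (Φ.smooth.differentiable (by simp) x)]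
    rfl
  simp only [hdiv, Finset.mul_sum, PiLp.inner_apply, RCLike.inner_apply, conj_trivial]
  rw [integral_finsetSum, integral_finsetSum, ← Finset.sum_neg_distrib]
  · exact Finset.sum_congr rfl fun j _ => hpart j
  · exact fun j _ => integrableOn_mul_of_hasCompactSupport (hGj j) (hΦ j).continuous (hc j)
  · exact fun j _ => integrableOn_mul_of_hasCompactSupport hw (continuous_fderiv_apply (hΦ j) _)
      (hasCompactSupport_fderiv_apply (hc j) _)

theorem integral_mul_fderiv_solField (h : HasScalarWeakGrad Ω w G) (hw : IntegrableOn w Ω)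
    (hG : IntegrableOn G Ω) (φ : SolField Ω) {η : Vec d → ℝ} (hη : ContDiff ℝ ∞ η) :
    ∫ x in Ω, w x * fderiv ℝ η x (φ.toFun x)
      = -∫ x in Ω, η x * inner ℝ (φ.toFun x) (G x) := by
  have hdiv x : divField (fun y => η y • φ.toFun y) x = fderiv ℝ η x (φ.toFun x) := by
    rw [divField_smul (hη.differentiable (by simp) x) (φ.smooth.differentiable (by simp) x),
      φ.divField_eq_zero, mul_zero, add_zero]
  simpa only [TestField.smul, hdiv, real_inner_smul_left] using
    h.integral_mul_divField hw hG (φ.toTestField.smul hη)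

theorem integral_mul_fderiv_mollifier (h : HasScalarWeakGrad Ω w G) (hw : IntegrableOn w Ω)
    (hG : IntegrableOn G Ω) {n : ℕ} {x : Vec d}
    (hx : Metric.closedBall x (mollifierBump (Vec d) n).rOut ⊆ Ω) (a : Vec d) :
    ∫ y in Ω, w y * fderiv ℝ (mollifier (Vec d) n) (x - y) a
      = ∫ y in Ω, mollifier (Vec d) n (x - y) * inner ℝ a (G y) := by
  have hsmooth : ContDiff ℝ ∞ fun y => mollifier (Vec d) n (x - y) :=
    (contDiff_mollifier n).comp (contDiff_const.sub contDiff_id)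
  have hsupp : tsupport (fun y => mollifier (Vec d) n (x - y) • a)
      ⊆ Metric.closedBall x (mollifierBump (Vec d) n).rOut := by
    refine closure_minimal (fun y hy => ?_) Metric.isClosed_closedBall
    contrapose! hy
    rw [Metric.mem_closedBall, not_le, dist_comm, dist_eq_norm] at hy
    simp [mollifier_eq_zero hy.le]
  let Φ : TestField Ω :=
    { toFun := fun y => mollifier (Vec d) n (x - y) • a
      smooth := hsmooth.smul contDiff_const
      compactSupp := HasCompactSupport.of_support_subset_isCompact
        (isCompact_closedBall x _) ((subset_tsupport _).trans hsupp)
      supp_subset := hsupp.trans hx }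
  have hdiv y : divField Φ.toFun y = -fderiv ℝ (mollifier (Vec d) n) (x - y) a := by
    refine (divField_smul (Φ := fun _ => a) (hsmooth.differentiable (by simp) y)
      (differentiableAt_const _)).trans ?_
    have hρ := (((contDiff_mollifier (E := Vec d) n).differentiable (by simp)
      (x - y)).hasFDerivAt.comp y ((hasFDerivAt_id y).const_sub x)).fderiv
    rw [Function.comp_def] at hρ
    simp [hρ, divField]
  have hΦ := h.integral_mul_divField hw hG Φ
  simp only [hdiv, mul_neg, integral_neg, neg_inj] at hΦ
  simpa only [Φ, real_inner_smul_left] using hΦ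

theorem fderiv_mollification (h : HasScalarWeakGrad Ω w G) (hΩ : MeasurableSet Ω)
    (hw : IntegrableOn w Ω) (hG : IntegrableOn G Ω) {n : ℕ} {x : Vec d}
    (hx : Metric.closedBall x (mollifierBump (Vec d) n).rOut ⊆ Ω) (a : Vec d) :
    fderiv ℝ (fun z => ∫ y, mollifier (Vec d) n (z - y) • Ω.indicator w y) x a
      = inner ℝ a (∫ y, mollifier (Vec d) n (x - y) • Ω.indicator G y) := by
  have hw₀ : Integrable (Ω.indicator w) := (integrable_indicator_iff hΩ).2 hw
  have hG₀ : Integrable (Ω.indicator G) := (integrable_indicator_iff hΩ).2 hG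
  obtain ⟨C, hC⟩ := exists_bound_mollifier (E := Vec d) n
  have hint : Integrable fun y => mollifier (Vec d) n (x - y) • Ω.indicator G y :=
    hG₀.bdd_smul C ((continuous_mollifier n).comp
      (continuous_const.sub continuous_id)).aestronglyMeasurable
      (Eventually.of_forall fun y => hC _)
  rw [fderiv_integral_mollifier_smul hw₀.locallyIntegrable, ← integral_inner hint]
  calc ∫ y, fderiv ℝ (mollifier (Vec d) n) (x - y) a • Ω.indicator w y
      = ∫ y in Ω, w y * fderiv ℝ (mollifier (Vec d) n) (x - y) a := by
        rw [← integral_indicator hΩ]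
        simp only [indicator_mul_left, smul_eq_mul, mul_comm]
    _ = ∫ y in Ω, mollifier (Vec d) n (x - y) * inner ℝ a (G y) :=
        h.integral_mul_fderiv_mollifier hw hG hx a
    _ = ∫ y, inner ℝ a (mollifier (Vec d) n (x - y) • Ω.indicator G y) := by
        rw [← integral_indicator hΩ]
        refine integral_congr_ae (Eventually.of_forall fun y => ?_)
        by_cases hy : y ∈ Ω <;> simp [hy, inner_smul_right]

theorem integral_mul_inner_mollification (h : HasScalarWeakGrad Ω w G) (hΩ : MeasurableSet Ω)
    (hw : IntegrableOn w Ω) (hG : IntegrableOn G Ω) (φ : SolField Ω) {n : ℕ}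
    (hn : Metric.cthickening (mollifierBump (Vec d) n).rOut (tsupport φ.toFun) ⊆ Ω) :
    ∫ x in Ω, w x * inner ℝ (φ.toFun x) (∫ y, mollifier (Vec d) n (x - y) • Ω.indicator G y)
      = -∫ x in Ω, (∫ y, mollifier (Vec d) n (x - y) • Ω.indicator w y)
          * inner ℝ (φ.toFun x) (G x) := by
  have hw₀ : Integrable (Ω.indicator w) := (integrable_indicator_iff hΩ).2 hw
  rw [← h.integral_mul_fderiv_solField hw hG φ
    (contDiff_integral_mollifier_smul hw₀.locallyIntegrable n)]
  congr 1 with x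
  by_cases hx : x ∈ tsupport φ.toFun
  · rw [h.fderiv_mollification hΩ hw hG
      ((Metric.closedBall_subset_cthickening hx _).trans hn)]
  · rw [image_eq_zero_of_notMem_tsupport hx, inner_zero_left, map_zero]

/-- Mollification justifies the formal computation `∫ w φ · ∇w = ½ ∫ φ · ∇(w²) = 0`. -/
theorem integral_mul_inner_solField (h : HasScalarWeakGrad Ω w G) (hΩ : IsOpen Ω)
    (hΩb : Bornology.IsBounded Ω) (hw : MemLp w ⊤ (volume.restrict Ω))
    (hG : MemLp G ⊤ (volume.restrict Ω)) (φ : SolField Ω) :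
    ∫ x in Ω, w x * inner ℝ (φ.toFun x) (G x) = 0 := by
  have : IsFiniteMeasure (volume.restrict Ω) := isFiniteMeasure_restrict.2 hΩb.measure_lt_top.ne
  have hwi : IntegrableOn w Ω := hw.integrable le_top
  have hGi : IntegrableOn G Ω := hG.integrable le_top
  have hw₀ : MemLp (Ω.indicator w) ⊤ := (memLp_indicator_iff_restrict hΩ.measurableSet).2 hw
  have hG₀ : MemLp (Ω.indicator G) ⊤ := (memLp_indicator_iff_restrict hΩ.measurableSet).2 hG
  let W (n : ℕ) (x : Vec d) : ℝ := ∫ y, mollifier (Vec d) n (x - y) • Ω.indicator w y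
  let DW (n : ℕ) (x : Vec d) : Vec d := ∫ y, mollifier (Vec d) n (x - y) • Ω.indicator G y
  obtain ⟨C, hC⟩ := φ.exists_bound
  have hφw : IntegrableOn (fun x => w x • φ.toFun x) Ω :=
    hwi.smul_bdd C φ.smooth.continuous.aestronglyMeasurable (Eventually.of_forall hC)
  have hlim_grad : Tendsto (fun n => ∫ x in Ω, w x * inner ℝ (φ.toFun x) (DW n x)) atTop
      (𝓝 (∫ x in Ω, w x * inner ℝ (φ.toFun x) (G x))) := by
    have hlim : Tendsto (fun n => ∫ x in Ω, inner ℝ (w x • φ.toFun x) (DW n x)) atTop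
        (𝓝 (∫ x in Ω, inner ℝ (w x • φ.toFun x) (Ω.indicator G x))) :=
      tendsto_setIntegral_bilin_mollifier_smul (innerB (Vec d)).flip hG₀ hφw
    simp only [real_inner_smul_left] at hlim
    rwa [setIntegral_congr_fun hΩ.measurableSet fun x hx => by rw [indicator_of_mem hx]] at hlim
  have hlim_fun : Tendsto (fun n => ∫ x in Ω, W n x * inner ℝ (φ.toFun x) (G x)) atTop
      (𝓝 (∫ x in Ω, w x * inner ℝ (φ.toFun x) (G x))) := by
    have hlim : Tendsto (fun n => ∫ x in Ω, W n x * inner ℝ (φ.toFun x) (G x)) atTop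
        (𝓝 (∫ x in Ω, Ω.indicator w x * inner ℝ (φ.toFun x) (G x))) :=
      tendsto_setIntegral_bilin_mollifier_smul (ContinuousLinearMap.mul ℝ ℝ) hw₀
        (φ.toTestField.integrableOn_inner hGi)
    rwa [setIntegral_congr_fun hΩ.measurableSet fun x hx => by rw [indicator_of_mem hx]] at hlim
  obtain ⟨δ, hδ, hδΩ⟩ := φ.compactSupp.isCompact.exists_cthickening_subset_open hΩ φ.supp_subset
  have hskew : ∀ᶠ n in atTop, ∫ x in Ω, w x * inner ℝ (φ.toFun x) (DW n x)
      = -∫ x in Ω, W n x * inner ℝ (φ.toFun x) (G x) :=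
    ((tendsto_mollifierBump_rOut (Vec d)).eventually_lt_const hδ).mono fun n hn =>
      h.integral_mul_inner_mollification hΩ.measurableSet hwi hGi φ
        ((Metric.cthickening_mono hn.le _).trans hδΩ)
  exact self_eq_neg.1 (tendsto_nhds_unique (hlim_grad.congr' hskew) hlim_fun.neg)

end HasScalarWeakGrad

end WeakGradient

section FunctionSpaces

variable {d : ℕ} {Ω : Set (Vec d)}

theorem memLp_single {ι : Type*} [Fintype ι] [DecidableEq ι] {η : Vec d → ℝ}
    (hη : Continuous η) (hc : HasCompactSupport η) (k : ι) :
    MemLp (fun x => EuclideanSpace.single k (η x)) 2 (volume.restrict Ω) := by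
  have h : Continuous fun r : ℝ => EuclideanSpace.single k r :=
    (PiLp.continuous_toLp 2 _).comp (continuous_single (A := fun _ => ℝ) k)
  exact (h.comp hη).memLp_of_hasCompactSupport (hc.comp_left (by simp))

theorem inner_toLp_single {ι : Type*} [Fintype ι] [DecidableEq ι] {η : Vec d → ℝ}
    (hη : Continuous η) (hc : HasCompactSupport η) (k : ι)
    (u : Lp (EuclideanSpace ℝ ι) 2 (volume.restrict Ω)) :
    inner ℝ (memLp_single hη hc k).toLp u = ∫ x in Ω, u x k * η x := by
  rw [L2.inner_def]
  refine integral_congr_ae ?_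
  filter_upwards [(memLp_single (Ω := Ω) hη hc k).coeFn_toLp] with x hx
  rw [hx, EuclideanSpace.inner_single_left]
  simp [mul_comm]

/-- The continuous functional `(u, G) ↦ ∫_Ω (uᵢ ∂ⱼη + G_{ij} η)` on `L² × L²`, which vanishes if `G`
is the weak gradient of `u`. -/
def weakFunctional (Ω : Set (Vec d)) {η : Vec d → ℝ} (hη : ContDiff ℝ ∞ η)
    (hc : HasCompactSupport η) (i j : Fin d) : (L2 Ω × L2Mat Ω) →L[ℝ] ℝ :=
  (innerSL ℝ (memLp_single (Ω := Ω) (continuous_fderiv_apply hη (EuclideanSpace.single j 1))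
      (hasCompactSupport_fderiv_apply hc _) i).toLp).comp (ContinuousLinearMap.fst ℝ _ _)
    + (innerSL ℝ (memLp_single (Ω := Ω) hη.continuous hc (i, j)).toLp).comp
      (ContinuousLinearMap.snd ℝ _ _)

theorem weakFunctional_eq_zero_iff {η : Vec d → ℝ} (hη : ContDiff ℝ ∞ η)
    (hc : HasCompactSupport η) (i j : Fin d) (p : L2 Ω × L2Mat Ω) :
    weakFunctional Ω hη hc i j p = 0 ↔
      ∫ x in Ω, p.1 x i * fderiv ℝ η x (EuclideanSpace.single j 1)
        = -∫ x in Ω, p.2 x (i, j) * η x := by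
  rw [← inner_toLp_single (continuous_fderiv_apply hη _) (hasCompactSupport_fderiv_apply hc _),
    ← inner_toLp_single hη.continuous hc, eq_neg_iff_add_eq_zero]
  rfl

theorem HasWeakPartial.congr {w w' G G' : Vec d → ℝ} {j : Fin d} (h : HasWeakPartial Ω w G j)
    (hw : w =ᵐ[volume.restrict Ω] w') (hG : G =ᵐ[volume.restrict Ω] G') :
    HasWeakPartial Ω w' G' j := by
  intro η hη hc hsupp
  have hleft : ∫ x in Ω, w' x * fderiv ℝ η x (EuclideanSpace.single j 1)
      = ∫ x in Ω, w x * fderiv ℝ η x (EuclideanSpace.single j 1) :=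
    integral_congr_ae (hw.mono fun x hx => by simp only [hx])
  have hright : ∫ x in Ω, G' x * η x = ∫ x in Ω, G x * η x :=
    integral_congr_ae (hG.mono fun x hx => by simp only [hx])
  rw [hleft, hright, h η hη hc hsupp]

theorem HasWeakGrad.congr {u u' : Vec d → Vec d} {G G' : Vec d → Mat d} (h : HasWeakGrad Ω u G)
    (hu : u =ᵐ[volume.restrict Ω] u') (hG : G =ᵐ[volume.restrict Ω] G') :
    HasWeakGrad Ω u' G' := fun i j =>
  (h i j).congr (hu.mono fun _ hx => congrArg (fun y : Vec d => y i) hx)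
    (hG.mono fun _ hx => congrArg (fun A : Mat d => A (i, j)) hx)

theorem hasWeakPartial_of_contDiff {f : Vec d → ℝ} (hf : ContDiff ℝ ∞ f) (j : Fin d) :
    HasWeakPartial Ω f (fun x => fderiv ℝ f x (EuclideanSpace.single j 1)) j := by
  intro η hη hc hsupp
  have hparts := integral_mul_fderiv_eq_neg_fderiv_mul_of_integrable (μ := volume)
    (f := f) (g := η) (v := EuclideanSpace.single j (1 : ℝ))
    (((continuous_fderiv_apply hf _).mul hη.continuous).integrable_of_hasCompactSupport
      hc.mul_left)
    ((hf.continuous.mul (continuous_fderiv_apply hη _)).integrable_of_hasCompactSupport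
      (hasCompactSupport_fderiv_apply hc _).mul_left)
    ((hf.continuous.mul hη.continuous).integrable_of_hasCompactSupport hc.mul_left)
    (fun x _ => hf.differentiable (by simp) x) (fun x _ => hη.differentiable (by simp) x)
  rw [setIntegral_eq_integral_of_forall_compl_eq_zero, hparts,
    setIntegral_eq_integral_of_forall_compl_eq_zero]
  · intro x hx
    rw [image_eq_zero_of_notMem_tsupport fun h => hx (hsupp h), mul_zero]
  · intro x hx
    rw [image_eq_zero_of_notMem_tsupport fun h => hx (hsupp (tsupport_fderiv_subset ℝ h)),
      zero_apply, mul_zero]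

theorem TestField.hasWeakGrad (φ : TestField Ω) : HasWeakGrad Ω φ.toFun (gradField φ.toFun) := by
  intro i j
  convert hasWeakPartial_of_contDiff (contDiff_euclidean.1 φ.smooth i) j using 2 with x
  rw [fderiv_coord (φ.smooth.differentiable (by simp) x)]
  rfl

theorem hasWeakGrad_of_mem_H10 {p : L2 Ω × L2Mat Ω} (hp : p ∈ H10 Ω) :
    HasWeakGrad Ω p.1 p.2 := by
  intro i j η hη hc hsupp
  rw [← weakFunctional_eq_zero_iff hη hc]
  have hle : H10 Ω ≤ (weakFunctional Ω hη hc i j : L2 Ω × L2Mat Ω →ₗ[ℝ] ℝ).ker := by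
    refine Submodule.topologicalClosure_minimal _ (Submodule.span_le.2 ?_)
      (ContinuousLinearMap.isClosed_ker _)
    rintro _ ⟨φ, rfl⟩
    refine (weakFunctional_eq_zero_iff hη hc i j _).2 ?_
    exact φ.hasWeakGrad.congr φ.memLp.coeFn_toLp.symm φ.memLp_grad.coeFn_toLp.symm i j η hη hc
      hsupp
  exact hle hp

theorem HasWeakPartial.ae_eq (hΩ : IsOpen Ω) {w g g' : Vec d → ℝ} {j : Fin d}
    (h : HasWeakPartial Ω w g j) (h' : HasWeakPartial Ω w g' j) (hg : IntegrableOn g Ω)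
    (hg' : IntegrableOn g' Ω) : g =ᵐ[volume.restrict Ω] g' := by
  have hzero : ∀ᵐ x, x ∈ Ω → g x - g' x = 0 := by
    refine hΩ.ae_eq_zero_of_integral_contDiff_smul_eq_zero
      (hg.sub hg').locallyIntegrableOn fun η hη hc hsupp => ?_
    rw [← setIntegral_eq_integral_of_forall_compl_eq_zero (s := Ω) fun x hx => by
      rw [image_eq_zero_of_notMem_tsupport fun h => hx (hsupp h), zero_smul]]
    simp_rw [smul_eq_mul, mul_sub, mul_comm (η _)]
    rw [integral_sub (integrableOn_mul_of_hasCompactSupport hg hη.continuous hc)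
      (integrableOn_mul_of_hasCompactSupport hg' hη.continuous hc)]
    linarith [h η hη hc hsupp, h' η hη hc hsupp]
  rw [EventuallyEq, ae_restrict_iff' hΩ.measurableSet]
  filter_upwards [hzero] with x hx hxΩ
  exact sub_eq_zero.1 (hx hxΩ)

theorem HasWeakGrad.ae_eq (hΩ : IsOpen Ω) {u : Vec d → Vec d} {G G' : Vec d → Mat d}
    (h : HasWeakGrad Ω u G) (h' : HasWeakGrad Ω u G') (hG : IntegrableOn G Ω)
    (hG' : IntegrableOn G' Ω) : G =ᵐ[volume.restrict Ω] G' := by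
  have hcoord (k : Fin d × Fin d) : ∀ᵐ x ∂volume.restrict Ω, G x k = G' x k :=
    (h k.1 k.2).ae_eq hΩ (h' k.1 k.2)
      ((EuclideanSpace.proj k : Mat d →L[ℝ] ℝ).integrable_comp hG)
      ((EuclideanSpace.proj k : Mat d →L[ℝ] ℝ).integrable_comp hG')
  filter_upwards [ae_all_iff.2 hcoord] with x hx
  ext k
  exact hx k

theorem grad_eq (hΩ : IsOpen Ω) (hΩb : Bornology.IsBounded Ω) {u : L2sol Ω} {G : L2Mat Ω}
    (h : HasWeakGrad Ω (u : L2 Ω) G) : grad u = G := by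
  have : IsFiniteMeasure (volume.restrict Ω) :=
    isFiniteMeasure_restrict.2 hΩb.measure_lt_top.ne
  have hex : ∃ G : L2Mat Ω, HasWeakGrad Ω (u : L2 Ω) G := ⟨G, h⟩
  have hgrad : HasWeakGrad Ω (u : L2 Ω) (grad u) := by
    rw [grad, dif_pos hex]
    exact hex.choose_spec
  exact Lp.ext (hgrad.ae_eq hΩ h ((Lp.memLp _).integrable one_le_two)
    ((Lp.memLp _).integrable one_le_two))

theorem grad_ae_eq (hΩ : IsOpen Ω) (hΩb : Bornology.IsBounded Ω) {u : L2sol Ω}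
    {G : Lp (Mat d) ⊤ (volume.restrict Ω)} (h : HasWeakGrad Ω (u : L2 Ω) G) :
    grad u =ᵐ[volume.restrict Ω] G := by
  have : IsFiniteMeasure (volume.restrict Ω) :=
    isFiniteMeasure_restrict.2 hΩb.measure_lt_top.ne
  have hG : MemLp G 2 (volume.restrict Ω) := (Lp.memLp G).mono_exponent le_top
  rw [grad_eq hΩ hΩb (h.congr EventuallyEq.rfl hG.coeFn_toLp.symm)]
  exact hG.coeFn_toLp

theorem grad_eq_of_mem_H10 (hΩ : IsOpen Ω) (hΩb : Bornology.IsBounded Ω) {u : L2sol Ω}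
    {G : L2Mat Ω} (h : ((u : L2 Ω), G) ∈ H10 Ω) : grad u = G :=
  grad_eq hΩ hΩb (hasWeakGrad_of_mem_H10 h)

theorem SolField.pair_mem_H10 (φ : SolField Ω) : (φ.toL2, φ.gradL2) ∈ H10 Ω :=
  Submodule.le_topologicalClosure _ (Submodule.subset_span ⟨φ.toTestField, rfl⟩)

theorem SolField.grad_toL2sol (hΩ : IsOpen Ω) (hΩb : Bornology.IsBounded Ω) (φ : SolField Ω) :
    grad φ.toL2sol = φ.gradL2 :=
  grad_eq_of_mem_H10 hΩ hΩb φ.pair_mem_H10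

theorem SolField.memH10sol (hΩ : IsOpen Ω) (hΩb : Bornology.IsBounded Ω) (φ : SolField Ω) :
    MemH10sol φ.toL2sol := by
  rw [MemH10sol, φ.grad_toL2sol hΩ hΩb]
  exact subset_closure ⟨φ, rfl⟩

theorem MemH10sol.mem_H10 {u : L2sol Ω} (h : MemH10sol u) : ((u : L2 Ω), grad u) ∈ H10 Ω := by
  have hcl : IsClosed (H10 Ω : Set (L2 Ω × L2Mat Ω)) := Submodule.isClosed_topologicalClosure _
  refine closure_minimal ?_ hcl h
  rintro _ ⟨φ, rfl⟩
  exact φ.pair_mem_H10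

theorem MemH10sol.sub_mem_H10 {u w : L2sol Ω} (hu : MemH10sol u) (hw : MemH10sol w) :
    (((u - w : L2sol Ω) : L2 Ω), grad u - grad w) ∈ H10 Ω :=
  (H10 Ω).sub_mem hu.mem_H10 hw.mem_H10

theorem MemH10sol.grad_sub (hΩ : IsOpen Ω) (hΩb : Bornology.IsBounded Ω) {u w : L2sol Ω}
    (hu : MemH10sol u) (hw : MemH10sol w) : grad (u - w) = grad u - grad w :=
  grad_eq_of_mem_H10 hΩ hΩb (hu.sub_mem_H10 hw)

end FunctionSpaces

section Convection

variable {d : ℕ} {Ω : Set (Vec d)}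

/-- The outer product of vectors, as a continuous bilinear map. -/
def outer (d : ℕ) : Vec d →L[ℝ] Vec d →L[ℝ] Mat d :=
  LinearMap.toContinuousBilinearMap <| LinearMap.mk₂ ℝ
    (fun a b => WithLp.toLp 2 fun ij : Fin d × Fin d => a ij.1 * b ij.2)
    (fun a a' b => by ext; simp [add_mul]) (fun c a b => by ext; simp [mul_assoc])
    (fun a b b' => by ext; simp [mul_add]) (fun c a b => by ext; simp [mul_left_comm])

theorem outer_apply (a b : Vec d) (ij : Fin d × Fin d) : outer d a b ij = a ij.1 * b ij.2 := rfl

/-- The `i`-th row of a matrix; the rows of a weak gradient are the weak gradients of the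
components. -/
def matRow (i : Fin d) : Mat d →L[ℝ] Vec d :=
  LinearMap.toContinuousLinearMap
    { toFun := fun B => WithLp.toLp 2 fun j => B (i, j)
      map_add' := fun _ _ => rfl
      map_smul' := fun _ _ => rfl }

theorem inner_outer (B : Mat d) (a b : Vec d) :
    inner ℝ B (outer d a b) = ∑ i, ∑ j, b j * B (i, j) * a i := by
  rw [PiLp.inner_apply, Fintype.sum_prod_type]
  simp only [outer_apply, RCLike.inner_apply, conj_trivial]
  exact Finset.sum_congr rfl fun i _ => Finset.sum_congr rfl fun j _ => by ring

theorem inner_outer_eq_sum_inner_matRow (B : Mat d) (a b : Vec d) :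
    inner ℝ B (outer d a b) = ∑ i, a i * inner ℝ b (matRow i B) := by
  rw [inner_outer]
  simp only [PiLp.inner_apply, RCLike.inner_apply, conj_trivial, Finset.mul_sum]
  refine Finset.sum_congr rfl fun i _ => Finset.sum_congr rfl fun j _ => ?_
  rw [mul_comm, mul_comm (b j)]
  rfl

theorem inner_matRow_gradField {ψ : Vec d → Vec d} {x : Vec d} (hψ : DifferentiableAt ℝ ψ x)
    (a : Vec d) (i : Fin d) :
    inner ℝ a (matRow i (gradField ψ x)) = fderiv ℝ (fun y => ψ y i) x a := by
  rw [← sum_fderiv_single_mul]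
  simp only [PiLp.inner_apply, RCLike.inner_apply, conj_trivial, fderiv_coord hψ]
  rfl

theorem convection_eq_integral_inner (a c : Vec d → Vec d) (B : Vec d → Mat d) :
    convection Ω a B c = ∫ x in Ω, inner ℝ (B x) (outer d (c x) (a x)) := by
  simp only [inner_outer]
  rfl

theorem symForm_eq_convection (a : Vec d → Vec d) (B : Vec d → Mat d) :
    symForm Ω a B = convection Ω a B a := by
  have hsplit x i j : a x i * (1 / 2 * (B x (i, j) + B x (j, i))) * a x j
      = 1 / 2 * (a x j * B x (i, j) * a x i) + 1 / 2 * (a x i * B x (j, i) * a x j) := by ring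
  unfold symForm convection
  congr 1 with x
  simp_rw [hsplit, Finset.sum_add_distrib, ← Finset.mul_sum]
  rw [Finset.sum_comm (f := fun i j => a x i * B x (j, i) * a x j)]
  ring

theorem TestField.memLp_top (φ : TestField Ω) : MemLp φ.toFun ⊤ (volume.restrict Ω) :=
  φ.smooth.continuous.memLp_of_hasCompactSupport φ.compactSupp

theorem integral_inner_outer_testField {u : Vec d → Vec d} {B : Vec d → Mat d}
    (hu : MemLp u ⊤ (volume.restrict Ω)) (hB : IntegrableOn B Ω) (φ : TestField Ω) :
    ∫ x in Ω, inner ℝ (B x) (outer d (u x) (φ.toFun x))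
      = ∑ i, ∫ x in Ω, u x i * inner ℝ (φ.toFun x) (matRow i (B x)) := by
  simp only [inner_outer_eq_sum_inner_matRow]
  refine integral_finsetSum _ fun i _ => ?_
  exact (φ.integrableOn_inner ((matRow i).integrable_comp hB)).mul_of_top_right
    (hu.continuousLinearMap_comp (EuclideanSpace.proj i : Vec d →L[ℝ] ℝ))

theorem HasWeakGrad.integral_inner_outer_eq_zero {u : Vec d → Vec d} {G : Vec d → Mat d}
    (h : HasWeakGrad Ω u G) (hΩ : IsOpen Ω) (hΩb : Bornology.IsBounded Ω)
    (hu : MemLp u ⊤ (volume.restrict Ω)) (hG : MemLp G ⊤ (volume.restrict Ω)) (φ : SolField Ω) :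
    ∫ x in Ω, inner ℝ (G x) (outer d (u x) (φ.toFun x)) = 0 := by
  have : IsFiniteMeasure (volume.restrict Ω) :=
    isFiniteMeasure_restrict.2 hΩb.measure_lt_top.ne
  have hrow (i : Fin d) : HasScalarWeakGrad Ω (fun x => u x i) (fun x => matRow i (G x)) := h i
  rw [integral_inner_outer_testField hu (hG.integrable le_top)]
  exact Finset.sum_eq_zero fun i _ => (hrow i).integral_mul_inner_solField hΩ hΩb
    (hu.continuousLinearMap_comp (EuclideanSpace.proj i : Vec d →L[ℝ] ℝ))
    (hG.continuousLinearMap_comp (matRow i)) φ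

theorem HasWeakGrad.integral_inner_gradField_outer {u : Vec d → Vec d} {G : Vec d → Mat d}
    (h : HasWeakGrad Ω u G) (hΩb : Bornology.IsBounded Ω)
    (hu : MemLp u ⊤ (volume.restrict Ω)) (hG : IntegrableOn G Ω) (ψ : TestField Ω)
    (φ : SolField Ω) :
    ∫ x in Ω, inner ℝ (gradField ψ.toFun x) (outer d (u x) (φ.toFun x))
      = -∫ x in Ω, inner ℝ (G x) (outer d (ψ.toFun x) (φ.toFun x)) := by
  have : IsFiniteMeasure (volume.restrict Ω) :=
    isFiniteMeasure_restrict.2 hΩb.measure_lt_top.ne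
  have hrow (i : Fin d) : HasScalarWeakGrad Ω (fun x => u x i) (fun x => matRow i (G x)) := h i
  rw [integral_inner_outer_testField hu (ψ.memLp_grad.integrable one_le_two),
    integral_inner_outer_testField ψ.memLp_top hG, ← Finset.sum_neg_distrib]
  refine Finset.sum_congr rfl fun i _ => ?_
  simp only [inner_matRow_gradField (ψ.smooth.differentiable (by simp) _)]
  exact (hrow i).integral_mul_fderiv_solField
    ((EuclideanSpace.proj i : Vec d →L[ℝ] ℝ).integrable_comp (hu.integrable le_top))
    ((matRow i).integrable_comp hG) φ (contDiff_euclidean.1 ψ.smooth i)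

/-- The tensor product `a ⊗ b ∈ L¹` of two fields in `L²`. -/
def tensor (Ω : Set (Vec d)) : L2 Ω →L[ℝ] L2 Ω →L[ℝ] Lp (Mat d) 1 (volume.restrict Ω) :=
  (outer d).holderL (volume.restrict Ω) 2 2 1

theorem coeFn_tensor (a b : L2 Ω) :
    tensor Ω a b =ᵐ[volume.restrict Ω] fun x => outer d (a x) (b x) :=
  (outer d).coeFn_holder a b

/-- The tensor product `U ⊗ a ∈ L²` of a bounded field and a field in `L²`. -/
def tensorTop (Ω : Set (Vec d)) :
    Lp (Vec d) ⊤ (volume.restrict Ω) →L[ℝ] L2 Ω →L[ℝ] L2Mat Ω :=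
  (outer d).holderL (volume.restrict Ω) ⊤ 2 2

theorem coeFn_tensorTop (U : Lp (Vec d) ⊤ (volume.restrict Ω)) (a : L2 Ω) :
    tensorTop Ω U a =ᵐ[volume.restrict Ω] fun x => outer d (U x) (a x) :=
  (outer d).coeFn_holder U a

/-- The duality pairing of bounded and of integrable matrix fields. -/
def matPair (Ω : Set (Vec d)) :
    Lp (Mat d) ⊤ (volume.restrict Ω) →L[ℝ] Lp (Mat d) 1 (volume.restrict Ω) →L[ℝ] ℝ :=
  (innerB (Mat d)).lpPairing (volume.restrict Ω) ⊤ 1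

theorem matPair_eq_integral (G : Lp (Mat d) ⊤ (volume.restrict Ω))
    (M : Lp (Mat d) 1 (volume.restrict Ω)) : matPair Ω G M = ∫ x in Ω, inner ℝ (G x) (M x) :=
  ContinuousLinearMap.lpPairing_eq_integral _ G M

theorem matPair_tensor (G : Lp (Mat d) ⊤ (volume.restrict Ω)) (a b : L2 Ω) :
    matPair Ω G (tensor Ω a b) = ∫ x in Ω, inner ℝ (G x) (outer d (a x) (b x)) := by
  rw [matPair_eq_integral]
  exact integral_congr_ae ((coeFn_tensor a b).mono fun x hx => by simp only [hx])

theorem inner_tensorTop (B : L2Mat Ω) (U : Lp (Vec d) ⊤ (volume.restrict Ω)) (a : L2 Ω) :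
    inner ℝ B (tensorTop Ω U a) = ∫ x in Ω, inner ℝ (B x) (outer d (U x) (a x)) := by
  rw [L2.inner_def]
  exact integral_congr_ae ((coeFn_tensorTop U a).mono fun x hx => by simp only [hx])

theorem convection_eq_matPair {G : Lp (Mat d) ⊤ (volume.restrict Ω)} {B : Vec d → Mat d}
    (hB : B =ᵐ[volume.restrict Ω] G) (a c : L2 Ω) :
    convection Ω a B c = matPair Ω G (tensor Ω c a) := by
  rw [matPair_tensor, convection_eq_integral_inner]
  exact integral_congr_ae (hB.mono fun x hx => by simp only [hx])

/-- `u ∈ W^{1,∞}`: the class of the bounded field `U` in `L²` is `u`, and its weak gradient is the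
bounded field `G`. -/
structure IsW1inf (u : L2 Ω) (U : Lp (Vec d) ⊤ (volume.restrict Ω))
    (G : Lp (Mat d) ⊤ (volume.restrict Ω)) : Prop where
  ae_eq : U =ᵐ[volume.restrict Ω] u
  hasWeakGrad : HasWeakGrad Ω u G

theorem bilin_eq_zero_of_span {E F : Type*} [NormedAddCommGroup E] [NormedSpace ℝ E]
    [NormedAddCommGroup F] [NormedSpace ℝ F] (B : E →L[ℝ] F →L[ℝ] ℝ) {s : Set E} {t : Set F}
    (h : ∀ x ∈ s, ∀ y ∈ t, B x y = 0) {x : E} {y : F}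
    (hx : x ∈ (Submodule.span ℝ s).topologicalClosure)
    (hy : y ∈ (Submodule.span ℝ t).topologicalClosure) : B x y = 0 := by
  have hy_zero : ∀ x ∈ s, B x y = 0 := fun x hx =>
    Submodule.topologicalClosure_minimal _ (t := (B x : F →ₗ[ℝ] ℝ).ker)
      (Submodule.span_le.2 fun z hz => h x hx z hz) (B x).isClosed_ker hy
  exact Submodule.topologicalClosure_minimal _ (t := (B.flip y : E →ₗ[ℝ] ℝ).ker)
    (Submodule.span_le.2 fun z hz => hy_zero z hz) (B.flip y).isClosed_ker hx

namespace IsW1inf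

variable {u : L2 Ω} {U : Lp (Vec d) ⊤ (volume.restrict Ω)}
  {G : Lp (Mat d) ⊤ (volume.restrict Ω)}

theorem hasWeakGrad_top (h : IsW1inf u U G) : HasWeakGrad Ω U G :=
  h.hasWeakGrad.congr h.ae_eq.symm EventuallyEq.rfl

theorem matPair_tensor_eq_zero (h : IsW1inf u U G) (hΩ : IsOpen Ω)
    (hΩb : Bornology.IsBounded Ω) (a : L2sol Ω) : matPair Ω G (tensor Ω u a) = 0 := by
  refine Submodule.topologicalClosure_minimal _
    (t := ((matPair Ω G).comp (tensor Ω u) : L2 Ω →ₗ[ℝ] ℝ).ker) (Submodule.span_le.2 ?_)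
    (ContinuousLinearMap.isClosed_ker _) a.2
  rintro _ ⟨φ, rfl⟩
  change matPair Ω G (tensor Ω u φ.toL2) = 0
  rw [matPair_tensor, ← h.hasWeakGrad_top.integral_inner_outer_eq_zero hΩ hΩb (Lp.memLp U)
    (Lp.memLp G) φ]
  refine integral_congr_ae ?_
  filter_upwards [h.ae_eq, φ.memLp.coeFn_toLp] with x hu hφ
  rw [hu, TestField.toL2, hφ]

theorem inner_gradL2_tensorTop (h : IsW1inf u U G) (hΩb : Bornology.IsBounded Ω)
    (ψ : TestField Ω) (φ : SolField Ω) :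
    inner ℝ ψ.gradL2 (tensorTop Ω U φ.toL2) = -matPair Ω G (tensor Ω ψ.toL2 φ.toL2) := by
  have : IsFiniteMeasure (volume.restrict Ω) :=
    isFiniteMeasure_restrict.2 hΩb.measure_lt_top.ne
  have hparts := h.hasWeakGrad_top.integral_inner_gradField_outer hΩb (Lp.memLp U)
    ((Lp.memLp G).integrable le_top) ψ φ
  rw [inner_tensorTop, matPair_tensor]
  convert hparts using 1
  · refine integral_congr_ae ?_
    filter_upwards [ψ.memLp_grad.coeFn_toLp, φ.memLp.coeFn_toLp] with x hψ hφ
    rw [TestField.gradL2, TestField.toL2, hψ, hφ]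
  · congr 1
    refine integral_congr_ae ?_
    filter_upwards [ψ.memLp.coeFn_toLp, φ.memLp.coeFn_toLp] with x hψ hφ
    rw [TestField.toL2, TestField.toL2, hψ, hφ]

theorem inner_tensorTop_of_mem_H10 (h : IsW1inf u U G) (hΩb : Bornology.IsBounded Ω)
    {p : L2 Ω × L2Mat Ω} (hp : p ∈ H10 Ω) (a : L2sol Ω) :
    inner ℝ p.2 (tensorTop Ω U a) = -matPair Ω G (tensor Ω p.1 a) := by
  have hzero := bilin_eq_zero_of_span
    ((((innerB (L2Mat Ω)).flip.comp (tensorTop Ω U)).flip.comp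
      (ContinuousLinearMap.snd ℝ (L2 Ω) (L2Mat Ω)))
      + ((ContinuousLinearMap.compL ℝ (L2 Ω) (Lp (Mat d) 1 (volume.restrict Ω)) ℝ
        (matPair Ω G)).comp ((tensor Ω).comp (ContinuousLinearMap.fst ℝ (L2 Ω) (L2Mat Ω)))))
    (s := range fun ψ : TestField Ω => (ψ.toL2, ψ.gradL2))
    (t := range fun φ : SolField Ω => φ.toL2) ?_ hp a.2
  · exact eq_neg_of_add_eq_zero_left hzero
  · rintro _ ⟨ψ, rfl⟩ _ ⟨φ, rfl⟩
    exact eq_neg_iff_add_eq_zero.1 (h.inner_gradL2_tensorTop hΩb ψ φ)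

theorem convection_eq_neg_matPair (h : IsW1inf u U G) (hΩb : Bornology.IsBounded Ω) {b : L2 Ω}
    {B : L2Mat Ω} (hb : (b, B) ∈ H10 Ω) (a : L2sol Ω) :
    convection Ω (a : L2 Ω) B u = -matPair Ω G (tensor Ω b a) := by
  rw [← h.inner_tensorTop_of_mem_H10 hΩb hb, inner_tensorTop, convection_eq_integral_inner]
  exact integral_congr_ae (h.ae_eq.mono fun x hx => by simp only [hx])

end IsW1inf

attribute [irreducible] tensor matPair tensorTop

end Convection

theorem exists_riesz_prod {E F : Type*} [NormedAddCommGroup E] [InnerProductSpace ℝ E]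
    [CompleteSpace E] [NormedAddCommGroup F] [InnerProductSpace ℝ F] [CompleteSpace F]
    {S : Submodule ℝ (E × F)} (hS : IsClosed (S : Set (E × F))) :
    ∃ (R₁ : StrongDual ℝ S →L[ℝ] E) (R₂ : StrongDual ℝ S →L[ℝ] F),
      ∀ (l : StrongDual ℝ S) (z : S),
        l z = inner ℝ (R₁ l) (z : E × F).1 + inner ℝ (R₂ l) (z : E × F).2 := by
  let e := WithLp.prodContinuousLinearEquiv 2 ℝ E F
  let S' : Submodule ℝ (WithLp 2 (E × F)) := S.comap (e : WithLp 2 (E × F) →ₗ[ℝ] E × F)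
  have hS' : IsClosed (S' : Set (WithLp 2 (E × F))) := hS.preimage e.continuous
  have : CompleteSpace S' := hS'.completeSpace_coe
  let restr : S' →L[ℝ] S := ((e : WithLp 2 (E × F) →L[ℝ] E × F).comp S'.subtypeL).codRestrict S
    fun x => x.2
  let riesz : StrongDual ℝ S' →L[ℝ] S' :=
    { toFun := (InnerProductSpace.toDual ℝ S').symm
      map_add' := map_add _
      map_smul' := fun c x => by simp only [map_smulₛₗ, RingHom.id_apply, conj_trivial]
      cont := (InnerProductSpace.toDual ℝ S').symm.continuous }
  let R := (e : WithLp 2 (E × F) →L[ℝ] E × F).comp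
    (S'.subtypeL.comp (riesz.comp (ContinuousLinearMap.precomp ℝ restr)))
  refine ⟨(ContinuousLinearMap.fst ℝ E F).comp R, (ContinuousLinearMap.snd ℝ E F).comp R,
    fun l z => ?_⟩
  let z' : S' := ⟨e.symm z, by
    change e (e.symm z) ∈ S
    rw [e.apply_symm_apply]
    exact z.2⟩
  have hz' : restr z' = z := Subtype.ext (e.apply_symm_apply _)
  have hriesz : inner ℝ (riesz (l.comp restr)) z' = l (restr z') :=
    InnerProductSpace.toDual_symm_apply (𝕜 := ℝ) (E := S')
  rw [← hz', ← hriesz, Submodule.coe_inner, WithLp.prod_inner_apply, hz']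
  rfl

theorem bilin_sub_identity {E F : Type*} [NormedAddCommGroup E] [NormedSpace ℝ E]
    [NormedAddCommGroup F] [NormedSpace ℝ F] (m : F →L[ℝ] ℝ) (B : E →L[ℝ] E →L[ℝ] F) {v w : E}
    (h : m (B w v) = 0) :
    m (B (v - w) (v - w)) + m (B (v - w) w) = m (B v v) := by
  simp only [map_sub, sub_apply, h]
  ring

section Rates

variable {d : ℕ} {Ω : Set (Vec d)} {ν T : ℝ}

/-- The gradient in the viscous case, and `0` in the inviscid case, where `𝕏` contains no
information on the gradient; it allows the two cases to be treated together. -/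
def vgrad (ν : ℝ) (u : L2sol Ω) : L2Mat Ω := if 0 < ν then grad u else 0

theorem vgrad_of_pos (hν : 0 < ν) (u : L2sol Ω) : vgrad ν u = grad u := if_pos hν

theorem vgrad_of_not_pos (hν : ¬ 0 < ν) (u : L2sol Ω) : vgrad ν u = 0 := if_neg hν

theorem vgrad_sub (hΩ : IsOpen Ω) (hΩb : Bornology.IsBounded Ω) {u w : L2sol Ω}
    (hu : 0 < ν → MemH10sol u) (hw : 0 < ν → MemH10sol w) :
    vgrad ν (u - w) = vgrad ν u - vgrad ν w := by
  by_cases hν : 0 < ν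
  · simp only [vgrad_of_pos hν]
    exact (hu hν).grad_sub hΩ hΩb (hw hν)
  · simp only [vgrad_of_not_pos hν, sub_zero]

theorem mul_inner_grad_eq (hν : 0 ≤ ν) (u w : L2sol Ω) :
    ν * inner ℝ (grad u) (grad w) = ν * inner ℝ (vgrad ν u) (vgrad ν w) := by
  obtain rfl | hpos := hν.eq_or_lt
  · rw [zero_mul, zero_mul]
  · rw [vgrad_of_pos hpos, vgrad_of_pos hpos]

/-- At time `t`, the functional `f` is `z ↦ (g, z) + (g₁, ∇z)`; the second term is absent in the
inviscid case. -/
def Force.IsReprAt (f : Force Ω ν T) (t : ℝ) (g : L2 Ω) (g₁ : L2Mat Ω) : Prop :=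
  ∀ z : L2sol Ω, (0 < ν → ((z : L2 Ω), grad z) ∈ H10 Ω) →
    f.pair t z = inner ℝ g (z : L2 Ω) + inner ℝ g₁ (vgrad ν z)

theorem memLp_clm_comp {α E F : Type*} [MeasurableSpace α] {μ : Measure α} {p : ENNReal}
    [NormedAddCommGroup E] [NormedSpace ℝ E] [NormedAddCommGroup F] [NormedSpace ℝ F]
    {f : α → StrongDual ℝ E} (hf : MemLp f p μ) (R : StrongDual ℝ E →L[ℝ] F) :
    MemLp (fun t => R (f t)) p μ :=
  hf.continuousLinearMap_comp R

theorem Force.exists_isReprAt (f : Force Ω ν T) (hν : 0 ≤ ν) :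
    ∃ (g : ℝ → L2 Ω) (g₁ : ℝ → L2Mat Ω), IntegrableOn g (Ioo 0 T) ∧ MemLp g₁ 2 (timeMeas T) ∧
      ∀ t, f.IsReprAt t (g t) (g₁ t) := by
  obtain h0 | hpos := hν.eq_or_lt
  · refine ⟨f.f₂, 0, f.integrable₂, MemLp.zero, fun t z _ => ?_⟩
    simp [Force.pair, f.inviscid h0.symm]
  · obtain ⟨R₁, R₂, hR⟩ := exists_riesz_prod (S := H10 Ω)
      (Submodule.isClosed_topologicalClosure _)
    have hR₁ : MemLp (fun t => R₁ (f.f₁ t)) 2 (timeMeas T) := memLp_clm_comp f.memLp₁ R₁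
    have hR₂ : MemLp (fun t => R₂ (f.f₁ t)) 2 (timeMeas T) := memLp_clm_comp f.memLp₁ R₂
    refine ⟨fun t => R₁ (f.f₁ t) + f.f₂ t, fun t => R₂ (f.f₁ t),
      (hR₁.integrable one_le_two).add f.integrable₂, hR₂, fun t z hz => ?_⟩
    calc f.pair t z = f.f₁ t ⟨_, hz hpos⟩ + inner ℝ (f.f₂ t) (z : L2 Ω) :=
          congrArg (· + _) (dif_pos (hz hpos))
      _ = inner ℝ (R₁ (f.f₁ t)) (z : L2 Ω) + inner ℝ (R₂ (f.f₁ t)) (grad z)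
            + inner ℝ (f.f₂ t) (z : L2 Ω) := congrArg (· + _) (hR _ _)
      _ = inner ℝ (R₁ (f.f₁ t)) (z : L2 Ω) + inner ℝ (f.f₂ t) (z : L2 Ω)
            + inner ℝ (R₂ (f.f₁ t)) (grad z) := add_right_comm _ _ _
      _ = inner ℝ (R₁ (f.f₁ t) + f.f₂ t) (z : L2 Ω) + inner ℝ (R₂ (f.f₁ t)) (vgrad ν z) :=
          congrArg₂ (· + ·) (inner_add_left _ _ _).symm
            (congrArg (inner ℝ _) (vgrad_of_pos hpos z).symm)

theorem integral_inner_grad_eq_matPair (hΩ : IsOpen Ω) (hΩb : Bornology.IsBounded Ω)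
    {u : L2sol Ω} {G : Lp (Mat d) ⊤ (volume.restrict Ω)} (h : HasWeakGrad Ω (u : L2 Ω) G)
    (M : Lp (Mat d) 1 (volume.restrict Ω)) :
    ∫ x in Ω, inner ℝ (grad u x) (M x) = matPair Ω G M := by
  rw [matPair_eq_integral]
  refine integral_congr_ae ?_
  filter_upwards [grad_ae_eq hΩ hΩb h] with x hx
  rw [hx]

theorem relForm_eq (hΩ : IsOpen Ω) (hΩb : Bornology.IsBounded Ω) (hν : 0 ≤ ν)
    (K : L2sol Ω → ENNReal) {v w : L2sol Ω} (hv : 0 < ν → MemH10sol v)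
    (hw : 0 < ν → MemH10sol w) {U : Lp (Vec d) ⊤ (volume.restrict Ω)}
    {G : Lp (Mat d) ⊤ (volume.restrict Ω)} (h : IsW1inf (w : L2 Ω) U G) :
    relForm ν K v w = ν * ‖vgrad ν v - vgrad ν w‖ ^ 2
      + matPair Ω G (tensor Ω ((v - w : L2sol Ω) : L2 Ω) ((v - w : L2sol Ω) : L2 Ω))
      + (K w).toReal * relEnergy v w := by
  obtain rfl | hpos := hν.eq_or_lt
  · have hs : symForm Ω ((v - w : L2sol Ω) : L2 Ω) (grad w)
        = matPair Ω G (tensor Ω ((v - w : L2sol Ω) : L2 Ω) ((v - w : L2sol Ω) : L2 Ω)) :=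
      (symForm_eq_convection _ _).trans
        (convection_eq_matPair (grad_ae_eq hΩ hΩb h.hasWeakGrad) _ _)
    refine (if_neg (lt_irrefl 0)).trans ?_
    rw [hs, zero_mul, zero_add]
  · have hgrad : vgrad ν v - vgrad ν w = grad v - grad w :=
      congrArg₂ (· - ·) (vgrad_of_pos hpos v) (vgrad_of_pos hpos w)
    have hconv (x : ℝ) :
        x - convection Ω ((v - w : L2sol Ω) : L2 Ω) (grad v - grad w : L2Mat Ω) (w : L2 Ω)
          = x + matPair Ω G (tensor Ω ((v - w : L2sol Ω) : L2 Ω) ((v - w : L2sol Ω) : L2 Ω)) :=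
      (congrArg (x - ·)
        (h.convection_eq_neg_matPair hΩb ((hv hpos).sub_mem_H10 (hw hpos)) _)).trans
        (sub_neg_eq_add _ _)
    have hnorm : ν * ‖grad v - grad w‖ ^ 2 = ν * ‖vgrad ν v - vgrad ν w‖ ^ 2 :=
      congrArg (fun B => ν * ‖B‖ ^ 2) hgrad.symm
    exact (if_pos hpos).trans (congrArg (· + _) ((hconv _).trans (congrArg (· + _) hnorm)))

theorem sub_mem_H10_of_pos (hΩ : IsOpen Ω) (hΩb : Bornology.IsBounded Ω) {v w : L2sol Ω}
    (hv : 0 < ν → MemH10sol v) (hw : 0 < ν → MemH10sol w) (hpos : 0 < ν) :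
    (((v - w : L2sol Ω) : L2 Ω), grad (v - w)) ∈ H10 Ω := by
  rw [(hv hpos).grad_sub hΩ hΩb (hw hpos)]
  exact (hv hpos).sub_mem_H10 (hw hpos)

theorem Force.IsReprAt.pair_sub (hΩ : IsOpen Ω) (hΩb : Bornology.IsBounded Ω)
    {f : Force Ω ν T} {t : ℝ} {g : L2 Ω} {g₁ : L2Mat Ω} (hf : f.IsReprAt t g g₁)
    {v w : L2sol Ω} (hv : 0 < ν → MemH10sol v) (hw : 0 < ν → MemH10sol w) :
    f.pair t (v - w)
      = inner ℝ g ((v - w : L2sol Ω) : L2 Ω) + inner ℝ g₁ (vgrad ν v - vgrad ν w) :=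
  (hf _ (sub_mem_H10_of_pos hΩ hΩb hv hw)).trans
    (congrArg (_ + inner ℝ g₁ ·) (vgrad_sub hΩ hΩb hv hw))

theorem sysOp_sub_eq (hΩ : IsOpen Ω) (hΩb : Bornology.IsBounded Ω) (hν : 0 ≤ ν)
    (f : Force Ω ν T) (t : ℝ) {v w : L2sol Ω} (dw : L2sol Ω) (hv : 0 < ν → MemH10sol v)
    (hw : 0 < ν → MemH10sol w) {U : Lp (Vec d) ⊤ (volume.restrict Ω)}
    {G : Lp (Mat d) ⊤ (volume.restrict Ω)} (h : IsW1inf (w : L2 Ω) U G) :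
    sysOp f t w dw (v - w) = inner ℝ dw (v - w)
      + matPair Ω G (tensor Ω ((v - w : L2sol Ω) : L2 Ω) w)
      + ν * inner ℝ (vgrad ν w) (vgrad ν v - vgrad ν w) - f.pair t (v - w) := by
  have hconv : convection Ω (w : L2 Ω) (grad w) ((v - w : L2sol Ω) : L2 Ω)
      = matPair Ω G (tensor Ω ((v - w : L2sol Ω) : L2 Ω) w) :=
    convection_eq_matPair (grad_ae_eq hΩ hΩb h.hasWeakGrad) _ _
  have hvisc := mul_inner_grad_eq hν w (v - w)
  rw [vgrad_sub hΩ hΩb hv hw] at hvisc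
  exact congrArg (· - _) (congrArg₂ (· + ·) (congrArg _ hconv) hvisc)

/-- `ν (∇v, ∇v - ∇w) + (v ⊗ v; ∇w) - ⟨f, v - w⟩` at time `t`. This is the rate of the reduced
inequality without the multiple of `𝒦(w)`. -/
def reducedRate (f : Force Ω ν T) (t : ℝ) (v w : L2sol Ω) : ℝ :=
  ν * inner ℝ (vgrad ν v) (vgrad ν v - vgrad ν w)
    + (∫ x in Ω, inner ℝ (grad w x) (tensor Ω v v x)) - f.pair t (v - w)

theorem relForm_add_sysOp (hΩ : IsOpen Ω) (hΩb : Bornology.IsBounded Ω) (hν : 0 ≤ ν)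
    (K : L2sol Ω → ENNReal) (f : Force Ω ν T) (t : ℝ) {v w : L2sol Ω} (dw : L2sol Ω)
    (hv : 0 < ν → MemH10sol v) (hw : 0 < ν → MemH10sol w)
    {U : Lp (Vec d) ⊤ (volume.restrict Ω)} {G : Lp (Mat d) ⊤ (volume.restrict Ω)}
    (h : IsW1inf (w : L2 Ω) U G) :
    relForm ν K v w + sysOp f t w dw (v - w)
      = reducedRate f t v w + inner ℝ dw (v - w) + (K w).toReal * relEnergy v w := by
  have hconv : matPair Ω G (tensor Ω ((v - w : L2sol Ω) : L2 Ω) ((v - w : L2sol Ω) : L2 Ω))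
      + matPair Ω G (tensor Ω ((v - w : L2sol Ω) : L2 Ω) w)
      = ∫ x in Ω, inner ℝ (grad w x) (tensor Ω v v x) :=
    (bilin_sub_identity (matPair Ω G) (tensor Ω) (h.matPair_tensor_eq_zero hΩ hΩb v)).trans
      (integral_inner_grad_eq_matPair hΩ hΩb h.hasWeakGrad _).symm
  have hnorm : ‖vgrad ν v - vgrad ν w‖ ^ 2 = inner ℝ (vgrad ν v) (vgrad ν v - vgrad ν w)
      - inner ℝ (vgrad ν w) (vgrad ν v - vgrad ν w) :=
    (real_inner_self_eq_norm_sq _).symm.trans (inner_sub_left _ _ _)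
  have hrel := relForm_eq hΩ hΩb hν K hv hw h
  have hsys := sysOp_sub_eq hΩ hΩb hν f t dw hv hw h
  have hred : reducedRate f t v w = ν * inner ℝ (vgrad ν v) (vgrad ν v - vgrad ν w)
    + (∫ x in Ω, inner ℝ (grad w x) (tensor Ω v v x)) - f.pair t (v - w) := rfl
  have arith {r s n a b x y z i q p R : ℝ} (hr : r = ν * n + x + q)
      (hs : s = i + y + ν * b - p) (hn : n = a - b) (hx : x + y = z) (hR : R = ν * a + z - p) :
      r + s = R + i + q := by
    subst_vars
    ring
  exact arith hrel hsys hnorm hconv hred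

theorem reducedRate_toL2sol (hΩ : IsOpen Ω) (hΩb : Bornology.IsBounded Ω) (hν : 0 ≤ ν)
    (f : Force Ω ν T) (t : ℝ) (v : L2sol Ω) (φ : SolField Ω) :
    reducedRate f t v φ.toL2sol = ν * inner ℝ (grad v) (grad v - φ.gradL2)
        + (∫ x in Ω, ∑ i, ∑ j, ((v : L2 Ω) x i * (v : L2 Ω) x j) * gradField φ.toFun x (i, j))
        - f.pair t (v - φ.toL2sol) := by
  have hgrad := φ.grad_toL2sol hΩ hΩb
  have hvisc : ν * inner ℝ (vgrad ν v) (vgrad ν v - vgrad ν φ.toL2sol)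
      = ν * inner ℝ (grad v) (grad v - φ.gradL2) := by
    obtain rfl | hpos := hν.eq_or_lt
    · rw [zero_mul, zero_mul]
    · exact congrArg (ν * ·) (congrArg₂ (fun A B => inner ℝ A (A - B)) (vgrad_of_pos hpos v)
        ((vgrad_of_pos hpos _).trans hgrad))
  have hconv : ∫ x in Ω, inner ℝ (grad φ.toL2sol x) (tensor Ω v v x)
      = ∫ x in Ω, ∑ i, ∑ j,
          ((v : L2 Ω) x i * (v : L2 Ω) x j) * gradField φ.toFun x (i, j) := by
    rw [hgrad]
    have hrep : φ.gradL2 =ᵐ[volume.restrict Ω] gradField φ.toFun := φ.memLp_grad.coeFn_toLp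
    refine integral_congr_ae ?_
    filter_upwards [coeFn_tensor (v : L2 Ω) (v : L2 Ω), hrep] with x hx hφ
    rw [hx, inner_outer, hφ]
    exact Finset.sum_congr rfl fun i _ => Finset.sum_congr rfl fun j _ => by ring
  exact congrArg (· - _) (congrArg₂ (· + ·) hvisc hconv)

theorem affine_identity {E F : Type*} [NormedAddCommGroup E] [InnerProductSpace ℝ E]
    [NormedAddCommGroup F] [InnerProductSpace ℝ F] (ν m : ℝ) (v w g : E) (A B g₁ : F) :
    ν * inner ℝ A (A - B) + m - (inner ℝ g (v - w) + inner ℝ g₁ (A - B))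
      = ν * inner ℝ A A - inner ℝ g v - inner ℝ g₁ A
        + inner ℝ B (g₁ - ν • A) + m + inner ℝ w g := by
  simp only [inner_sub_right, real_inner_smul_right, real_inner_comm A B,
    real_inner_comm g₁ B, real_inner_comm g w]
  ring

theorem reducedRate_eq (hΩ : IsOpen Ω) (hΩb : Bornology.IsBounded Ω) {f : Force Ω ν T} {t : ℝ}
    {g : L2 Ω} {g₁ : L2Mat Ω} (hf : f.IsReprAt t g g₁) {v w : L2sol Ω}
    (hv : 0 < ν → MemH10sol v) (hw : 0 < ν → MemH10sol w) :
    reducedRate f t v w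
      = ν * inner ℝ (vgrad ν v) (vgrad ν v) - inner ℝ g (v : L2 Ω) - inner ℝ g₁ (vgrad ν v)
        + inner ℝ (vgrad ν w) (g₁ - ν • vgrad ν v)
        + (∫ x in Ω, inner ℝ (grad w x) (tensor Ω v v x)) + inner ℝ (w : L2 Ω) g :=
  (congrArg (_ - ·) (hf.pair_sub hΩ hΩb hv hw)).trans
    (affine_identity ν _ (v : L2 Ω) (w : L2 Ω) g (vgrad ν v) (vgrad ν w) g₁)

end Rates

section Doubling

variable {T : ℝ} {β γ : ℝ → ℝ → ℝ}

/-- The averages of `β` along the mollifiers of `t - s` converge to the integral over the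
diagonal. -/
structure Mollifies (T : ℝ) (β : ℝ → ℝ → ℝ) : Prop where
  integrable_diag : IntegrableOn (fun t => β t t) (Ioo 0 T)
  integrable : ∀ n, Integrable (fun q : ℝ × ℝ => mollifier ℝ n (q.2 - q.1) * β q.1 q.2)
    ((timeMeas T).prod (timeMeas T))
  tendsto : Tendsto (fun n => ∫ s in Ioo 0 T, ∫ t in Ioo 0 T, mollifier ℝ n (t - s) * β s t)
    atTop (𝓝 (∫ t in Ioo 0 T, β t t))

namespace Mollifies

theorem neg (h : Mollifies T β) : Mollifies T fun s t => -β s t where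
  integrable_diag := h.integrable_diag.neg
  integrable n := (h.integrable n).neg.congr (Eventually.of_forall fun q => (mul_neg _ _).symm)
  tendsto := by simpa only [mul_neg, integral_neg] using h.tendsto.neg

theorem add (h : Mollifies T β) (h' : Mollifies T γ) : Mollifies T fun s t => β s t + γ s t where
  integrable_diag := h.integrable_diag.add h'.integrable_diag
  integrable n := ((h.integrable n).add (h'.integrable n)).congr
    (Eventually.of_forall fun q => (mul_add _ _ _).symm)
  tendsto := by
    rw [integral_add h.integrable_diag h'.integrable_diag]
    refine (h.tendsto.add h'.tendsto).congr fun n => ?_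
    rw [← integral_add (h.integrable n).integral_prod_left (h'.integrable n).integral_prod_left]
    refine integral_congr_ae ?_
    filter_upwards [(h.integrable n).prod_right_ae, (h'.integrable n).prod_right_ae] with s hs hs'
    simp only [mul_add]
    rw [integral_add hs hs']

theorem sub (h : Mollifies T β) (h' : Mollifies T γ) : Mollifies T fun s t => β s t - γ s t := by
  simpa only [sub_eq_add_neg] using h.add h'.neg

theorem swap (h : Mollifies T β) : Mollifies T fun s t => β t s where
  integrable_diag := h.integrable_diag
  integrable n := (h.integrable n).swap.congr <| Eventually.of_forall fun q => by
    simp only [Function.comp_apply, Prod.fst_swap, Prod.snd_swap, mollifier_sub_comm n q.1]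
  tendsto := h.tendsto.congr fun n => by
    rw [integral_integral_swap (h.integrable n)]
    simp only [mollifier_sub_comm n]

end Mollifies

section Bilinear

variable {X Y : Type*} [NormedAddCommGroup X] [NormedSpace ℝ X] [NormedAddCommGroup Y]
  [NormedSpace ℝ Y] (B : X →L[ℝ] Y →L[ℝ] ℝ) {a : ℝ → X} {b : ℝ → Y}

theorem integrable_mollifier_mul_bilin {μ : Measure ℝ} (ha : Integrable a μ)
    (hb : Integrable b μ) (n : ℕ) :
    Integrable (fun q : ℝ × ℝ => mollifier ℝ n (q.2 - q.1) * B (a q.1) (b q.2)) (μ.prod μ) := by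
  obtain ⟨C, hC⟩ := exists_bound_mollifier (E := ℝ) n
  exact (ha.op_fst_snd (op := fun x y => B x y) (by fun_prop) ⟨‖B‖, B.le_opNorm₂⟩ hb).bdd_mul
    ((continuous_mollifier n).comp (continuous_snd.sub continuous_fst)).aestronglyMeasurable
    (Eventually.of_forall fun q => hC _)

theorem integral_mollifier_mul_bilin [CompleteSpace X] {S : Set ℝ} (hS : MeasurableSet S)
    (ha : IntegrableOn a S) (n : ℕ) (t : ℝ) (y : Y) :
    ∫ s in S, mollifier ℝ n (t - s) * B (a s) y
      = B (∫ s, mollifier ℝ n (t - s) • S.indicator a s) y := by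
  obtain ⟨C, hC⟩ := exists_bound_mollifier (E := ℝ) n
  have hint : Integrable fun s => mollifier ℝ n (t - s) • S.indicator a s :=
    ((integrable_indicator_iff hS).2 ha).bdd_smul C
      ((continuous_mollifier n).comp (continuous_const.sub continuous_id)).aestronglyMeasurable
      (Eventually.of_forall fun s => hC _)
  rw [← integral_indicator hS]
  refine Eq.trans ?_ ((B.flip y).integral_comp_comm hint)
  refine integral_congr_ae (Eventually.of_forall fun s => ?_)
  by_cases hs : s ∈ S <;> simp [hs]

theorem mollifies_bilin [CompleteSpace X] (ha : MemLp a ⊤ (timeMeas T))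
    (hb : Integrable b (timeMeas T)) : Mollifies T fun s t => B (a s) (b t) := by
  have hai : IntegrableOn a (Ioo 0 T) := ha.integrable le_top
  have hint := integrable_mollifier_mul_bilin B hai hb
  refine ⟨?_, hint, ?_⟩
  · refine (hb.norm.const_mul (‖B‖ * lpNorm a ⊤ (timeMeas T))).mono'
      (B.aestronglyMeasurable_comp₂ ha.1 hb.1) ?_
    filter_upwards [ae_le_lpNorm_exponent_top ha] with t ht
    refine (B.le_opNorm₂ _ _).trans ?_
    gcongr
  · have hlim := tendsto_setIntegral_bilin_mollifier_smul B
      ((memLp_indicator_iff_restrict measurableSet_Ioo).2 ha) hb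
    rw [setIntegral_congr_fun measurableSet_Ioo fun t ht => by rw [indicator_of_mem ht]] at hlim
    refine hlim.congr fun n => ?_
    rw [integral_integral_swap (hint n)]
    exact integral_congr_ae (Eventually.of_forall fun t =>
      (integral_mollifier_mul_bilin B measurableSet_Ioo hai n t (b t)).symm)

theorem mollifies_mul_bilin [CompleteSpace X] {χ : ℝ → ℝ} (hχ : MemLp χ ⊤ (timeMeas T))
    (ha : MemLp a ⊤ (timeMeas T)) (hb : Integrable b (timeMeas T)) :
    Mollifies T fun s t => χ t * B (a s) (b t) := by
  have h := mollifies_bilin B ha (hb.smul_of_top_right hχ)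
  simpa only [Pi.smul_apply', map_smul, smul_eq_mul] using h

theorem mollifies_mul_bilin_swap [CompleteSpace X] {χ : ℝ → ℝ} (hχ : MemLp χ ⊤ (timeMeas T))
    (ha : MemLp a ⊤ (timeMeas T)) (hb : Integrable b (timeMeas T)) :
    Mollifies T fun s t => χ t * B (a t) (b s) := by
  have hχa : MemLp (χ • a) ⊤ (timeMeas T) := ha.smul hχ
  have h := (mollifies_bilin B hχa hb).swap
  simpa only [Pi.smul_apply', map_smul, smul_apply, smul_eq_mul] using h

end Bilinear

theorem mollifies_mul {χ e : ℝ → ℝ} (hχ : MemLp χ ⊤ (timeMeas T))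
    (he : Integrable e (timeMeas T)) : Mollifies T fun _ t => χ t * e t := by
  simpa only [ContinuousLinearMap.mul_apply', one_mul] using
    mollifies_mul_bilin (ContinuousLinearMap.mul ℝ ℝ) hχ (memLp_const (1 : ℝ)) he

end Doubling

section Primitives

variable {T : ℝ} {V : Type*} [NormedAddCommGroup V]

/-- On `[0, T]`, the curve `w` is a primitive of the integrable function `dw`; this is how the
absolutely continuous test functions of the relative inequality enter the argument. -/
structure IsPrimitive [NormedSpace ℝ V] (T : ℝ) (w dw : ℝ → V) : Prop where
  integrable : IntegrableOn dw (Ioo 0 T)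
  eq_add_integral : ∀ t ∈ Icc 0 T, w t = w 0 + ∫ τ in (0 : ℝ)..t, dw τ

namespace IsPrimitive

variable {w dw : ℝ → V}

theorem memLp_top [NormedSpace ℝ V] (h : IsPrimitive T w dw) : MemLp w ⊤ (timeMeas T) :=
  memLp_top_of_continuousOn_Icc <|
    (continuousOn_const.add (continuousOn_primitive_Icc h.integrable)).congr h.eq_add_integral

variable [InnerProductSpace ℝ V]

theorem integral_deriv_mul_inner [CompleteSpace V] (h : IsPrimitive T w dw) {χ : ℝ → ℝ}
    (hχ : IsTimeTest T χ) (e : ℝ) (x : V) :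
    ∫ s in Ioo 0 T, deriv χ s * (e - inner ℝ x (w s))
      = ∫ s in Ioo 0 T, χ s * inner ℝ x (dw s) := by
  have hinner : ∀ s ∈ Ioo 0 T, e - inner ℝ x (w s)
      = e - inner ℝ x (w 0) + ∫ τ in (0 : ℝ)..s, -inner ℝ x (dw τ) := fun s hs => by
    have hs' : s ∈ Icc 0 T := Ioo_subset_Icc_self hs
    have hcomm : ∫ τ in (0 : ℝ)..s, inner ℝ x (dw τ) = inner ℝ x (∫ τ in (0 : ℝ)..s, dw τ) :=
      (innerSL ℝ x).intervalIntegral_comp_comm (intervalIntegrable_of_integrableOn_Ioo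
        h.integrable (left_mem_Icc.2 (hs'.1.trans hs'.2)) hs')
    rw [intervalIntegral.integral_neg, hcomm, h.eq_add_integral s hs', inner_add_right]
    ring
  rw [setIntegral_congr_fun measurableSet_Ioo fun s hs => by rw [hinner s hs]]
  refine (integral_deriv_mul_primitive hχ (h.integrable.const_inner x).neg _).trans ?_
  simp only [Pi.neg_apply, mul_neg, integral_neg, neg_neg]

end IsPrimitive

end Primitives

section DoublingTime

variable {T : ℝ} {θ E : ℝ → ℝ} {V : Type*} [NormedAddCommGroup V] [InnerProductSpace ℝ V]
  {v w dw : ℝ → V}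

theorem IsTimeTest.exists_margin (hθ : IsTimeTest T θ) :
    ∃ δ > 0, ∀ t, θ t ≠ 0 → δ < t ∧ t < T - δ := by
  obtain ⟨δ, hδ, hsub⟩ := hθ.compactSupp.isCompact.exists_cthickening_subset_open isOpen_Ioo
    hθ.supp_subset
  refine ⟨δ, hδ, fun t ht => ?_⟩
  have hball := (Metric.closedBall_subset_cthickening (subset_tsupport _ ht) δ).trans hsub
  have hleft : t - δ ∈ Ioo 0 T := hball (by simp [abs_of_pos hδ])
  have hright : t + δ ∈ Ioo 0 T := hball (by simp [abs_of_pos hδ])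
  exact ⟨sub_pos.1 hleft.1, lt_sub_iff_add_lt.2 hright.2⟩

theorem isTimeTest_mollifier_sub {n : ℕ} {t : ℝ} (h0 : (mollifierBump ℝ n).rOut < t)
    (hT : t < T - (mollifierBump ℝ n).rOut) : IsTimeTest T fun s => mollifier ℝ n (t - s) := by
  set r := (mollifierBump ℝ n).rOut
  have hsub : tsupport (fun s => mollifier ℝ n (t - s)) ⊆ Icc (t - r) (t + r) := by
    refine closure_minimal (fun s hs => ?_) isClosed_Icc
    have hlt : |t - s| < r := not_le.1 fun h => hs (mollifier_eq_zero h)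
    rw [abs_lt] at hlt
    exact ⟨by linarith, by linarith⟩
  exact ⟨(contDiff_mollifier n).comp (contDiff_const.sub contDiff_id),
    isCompact_Icc.of_isClosed_subset (isClosed_tsupport _) hsub,
    hsub.trans (Icc_subset_Ioo (by linarith) (by linarith))⟩

theorem WeakNonpos.integral_mul_test {e L : ℝ → ℝ} (h : WeakNonpos T e L)
    (he : IntegrableOn e (Ioo 0 T)) (hθ : IsTimeTest T θ) (hθ0 : ∀ t, 0 ≤ θ t) {ρ : ℝ → ℝ}
    (hρ : ContDiff ℝ ∞ ρ) (hρ0 : ∀ t, 0 ≤ ρ t) :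
    (∫ t in Ioo 0 T, ρ t * (θ t * L t)) - (∫ t in Ioo 0 T, ρ t * (deriv θ t * e t))
      - ∫ t in Ioo 0 T, θ t * deriv ρ t * e t ≤ 0 := by
  have htest := h _ (hθ.mul_contDiff hρ) fun t => mul_nonneg (hθ0 t) (hρ0 t)
  have hderiv (t : ℝ) : deriv (fun t => θ t * ρ t) t * e t
      = deriv θ t * ρ t * e t + θ t * deriv ρ t * e t := by
    rw [deriv_fun_mul (hθ.smooth.differentiable (by simp) t) (hρ.differentiable (by simp) t),
      add_mul]
  simp_rw [hderiv] at htest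
  rw [integral_add ((hθ.deriv.mul_contDiff hρ).integrable_mul he)
    ((hθ.mul_contDiff (contDiff_infty_iff_deriv.1 hρ).2).integrable_mul he)] at htest
  have hcomm (k : ℝ → ℝ) (c : ℝ) (t : ℝ) : k t * ρ t * c = ρ t * (k t * c) := by ring
  simp_rw [hcomm θ, hcomm (deriv θ)] at htest
  linarith

theorem integrable_sub_inner_prod (hE : Integrable E (timeMeas T))
    (hv : Integrable v (timeMeas T)) (hw : Integrable w (timeMeas T)) :
    Integrable (fun q : ℝ × ℝ => E q.2 - inner ℝ (v q.2) (w q.1))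
      ((timeMeas T).prod (timeMeas T)) := by
  refine (hE.comp_snd _).sub ((hw.norm.mul_prod hv.norm).mono' ?_ <|
    Eventually.of_forall fun q => (norm_inner_le_norm _ _).trans_eq (mul_comm _ _))
  exact (hv.aestronglyMeasurable.comp_quasiMeasurePreserving
      Measure.quasiMeasurePreserving_snd).inner
    (hw.aestronglyMeasurable.comp_quasiMeasurePreserving Measure.quasiMeasurePreserving_fst)

theorem integrable_mul_deriv_mollifier_mul (hθ : IsTimeTest T θ)
    (hE : Integrable E (timeMeas T)) (hv : Integrable v (timeMeas T))
    (hw : Integrable w (timeMeas T)) (n : ℕ) :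
    Integrable (fun q : ℝ × ℝ => θ q.2 * deriv (mollifier ℝ n) (q.2 - q.1)
      * (E q.2 - inner ℝ (v q.2) (w q.1))) ((timeMeas T).prod (timeMeas T)) := by
  obtain ⟨C, hC⟩ := hθ.exists_bound
  have hcont : Continuous (deriv (mollifier ℝ n)) :=
    (contDiff_mollifier n).continuous_deriv (by simp)
  have hsupp : HasCompactSupport (deriv (mollifier ℝ n)) :=
    (hasCompactSupport_mollifier (E := ℝ) n).deriv
  obtain ⟨C', hC'⟩ := hcont.bounded_above_of_compact_support hsupp
  have hkernel : Continuous fun q : ℝ × ℝ => θ q.2 * deriv (mollifier ℝ n) (q.2 - q.1) :=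
    (hθ.smooth.continuous.comp continuous_snd).mul
      (hcont.comp (continuous_snd.sub continuous_fst))
  have hbound (q : ℝ × ℝ) : ‖θ q.2 * deriv (mollifier ℝ n) (q.2 - q.1)‖ ≤ C * C' :=
    norm_mul_le_of_le (hC _) (hC' _)
  exact (integrable_sub_inner_prod hE hv hw).bdd_mul hkernel.aestronglyMeasurable
    (Eventually.of_forall hbound)

variable [CompleteSpace V]

theorem IsPrimitive.integral_deriv_mollifier (h : IsPrimitive T w dw) {n : ℕ} {δ : ℝ}
    (hδ : ∀ t, θ t ≠ 0 → δ < t ∧ t < T - δ) (hn : (mollifierBump ℝ n).rOut < δ) (t : ℝ) :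
    ∫ s in Ioo 0 T, θ t * deriv (mollifier ℝ n) (t - s) * (E t - inner ℝ (v t) (w s))
      = -∫ s in Ioo 0 T, mollifier ℝ n (t - s) * (θ t * inner ℝ (v t) (dw s)) := by
  by_cases ht : θ t = 0
  · simp [ht]
  obtain ⟨ht0, htT⟩ := hδ t ht
  have hparts := h.integral_deriv_mul_inner
    (isTimeTest_mollifier_sub (hn.trans ht0) (htT.trans (by linarith))) (E t) (v t)
  simp only [deriv_comp_const_sub, neg_mul, integral_neg] at hparts
  simp only [mul_assoc, mul_left_comm (mollifier ℝ n _), integral_const_mul, ← hparts, mul_neg,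
    neg_neg]

theorem IsPrimitive.integral_integral_deriv_mollifier (hw : IsPrimitive T w dw)
    (hE : Integrable E (timeMeas T)) (hv : MemLp v ⊤ (timeMeas T)) (hθ : IsTimeTest T θ) :
    ∀ᶠ n in atTop, ∫ s in Ioo 0 T, ∫ t in Ioo 0 T,
        θ t * deriv (mollifier ℝ n) (t - s) * (E t - inner ℝ (v t) (w s))
      = -∫ s in Ioo 0 T, ∫ t in Ioo 0 T, mollifier ℝ n (t - s) * (θ t * inner ℝ (v t) (dw s)) := by
  obtain ⟨δ, hδ, hmargin⟩ := hθ.exists_margin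
  have hprim : Mollifies T fun s t => θ t * inner ℝ (v t) (dw s) :=
    mollifies_mul_bilin_swap (innerB V) hθ.memLp_top hv hw.integrable
  filter_upwards [(tendsto_mollifierBump_rOut ℝ).eventually_lt_const hδ] with n hn
  have hJ := integrable_mul_deriv_mollifier_mul hθ hE (hv.integrable le_top)
    (hw.memLp_top.integrable le_top) n
  refine (integral_integral_swap hJ).trans
    (Eq.trans ?_ (congrArg Neg.neg (integral_integral_swap (hprim.integrable n)).symm))
  rw [← integral_neg]
  exact integral_congr_ae (Eventually.of_forall (hw.integral_deriv_mollifier hmargin hn))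

/-- Doubling of the time variable: the inequality for the frozen values `w s`, tested in `t` with
`θ t` times a mollifier of `t - s` and integrated in `s`; the derivative of the mollifier is moved
onto `w`. -/
theorem weakNonpos_diagonal {L : ℝ → ℝ → ℝ} (hE : Integrable E (timeMeas T))
    (hv : MemLp v ⊤ (timeMeas T)) (hw : IsPrimitive T w dw)
    (hL : ∀ θ, IsTimeTest T θ → Mollifies T fun s t => θ t * L s t)
    (h : ∀ᵐ s ∂timeMeas T, WeakNonpos T (fun t => E t - inner ℝ (v t) (w s)) (L s)) :
    WeakNonpos T (fun t => E t - inner ℝ (v t) (w t))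
      fun t => L t t + inner ℝ (v t) (dw t) := by
  intro θ hθ hθ0
  have hvi : Integrable v (timeMeas T) := hv.integrable le_top
  have hwi : Integrable w (timeMeas T) := hw.memLp_top.integrable le_top
  have hLθ := hL θ hθ
  have hinner : Mollifies T fun s t => deriv θ t * inner ℝ (v t) (w s) :=
    mollifies_mul_bilin_swap (innerB V) hθ.deriv.memLp_top hv hwi
  have henergy : Mollifies T fun s t => deriv θ t * (E t - inner ℝ (v t) (w s)) := by
    simpa only [mul_sub] using (mollifies_mul hθ.deriv.memLp_top hE).sub hinner
  have hprim : Mollifies T fun s t => θ t * inner ℝ (v t) (dw s) :=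
    mollifies_mul_bilin_swap (innerB V) hθ.memLp_top hv hw.integrable
  have hle := le_of_tendsto ((hLθ.tendsto.sub henergy.tendsto).add hprim.tendsto) (b := 0) <| by
    filter_upwards [hw.integral_integral_deriv_mollifier hE hv hθ] with n hn
    have hkernel := integrable_mul_deriv_mollifier_mul hθ hE hvi hwi n
    have hfrozen : ∀ᵐ s ∂timeMeas T,
        (∫ t in Ioo 0 T, mollifier ℝ n (t - s) * (θ t * L s t))
          - (∫ t in Ioo 0 T, mollifier ℝ n (t - s) * (deriv θ t * (E t - inner ℝ (v t) (w s))))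
          - ∫ t in Ioo 0 T, θ t * deriv (mollifier ℝ n) (t - s) * (E t - inner ℝ (v t) (w s))
        ≤ 0 := by
      filter_upwards [h] with s hs
      have htest := hs.integral_mul_test (hE.sub (hvi.inner_const (w s))) hθ hθ0
        (ρ := fun t => mollifier ℝ n (t - s))
        ((contDiff_mollifier n).comp (contDiff_id.sub contDiff_const))
        (fun t => mollifier_nonneg n _)
      simpa only [deriv_comp_sub_const] using htest
    have hint := integral_nonpos_of_ae hfrozen
    have hdiff : Integrable (fun s =>
        (∫ t in Ioo 0 T, mollifier ℝ n (t - s) * (θ t * L s t))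
          - ∫ t in Ioo 0 T, mollifier ℝ n (t - s) * (deriv θ t * (E t - inner ℝ (v t) (w s))))
        (timeMeas T) :=
      (hLθ.integrable n).integral_prod_left.sub (henergy.integrable n).integral_prod_left
    rw [integral_sub hdiff hkernel.integral_prod_left,
      integral_sub (hLθ.integrable n).integral_prod_left
        (henergy.integrable n).integral_prod_left, hn] at hint
    linarith
  beta_reduce
  simp only [mul_add]
  rw [integral_add hLθ.integrable_diag hprim.integrable_diag]
  linarith

theorem IsPrimitive.weakNonpos_inner_smul (hw : IsPrimitive T w dw) (c : ℝ) :
    WeakNonpos T (fun t => 0 - inner ℝ (c • w t) (w t))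
      fun t => inner ℝ (c • w t) (dw t) + inner ℝ (c • w t) (dw t) := by
  have hcw : MemLp (fun t => c • w t) ⊤ (timeMeas T) := hw.memLp_top.const_smul c
  refine weakNonpos_diagonal (E := fun _ => 0) (integrable_zero _ _ _) hcw hw
    (L := fun s t => inner ℝ (c • w s) (dw t))
    (fun θ hθ => mollifies_mul_bilin (innerB V) hθ.memLp_top hcw hw.integrable)
    (Eventually.of_forall fun s θ hθ _ => ?_)
  have hparts := hw.integral_deriv_mul_inner hθ 0 (c • w s)
  have hsymm (t : ℝ) : inner ℝ (c • w t) (w s) = inner ℝ (c • w s) (w t) := by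
    rw [real_inner_smul_left, real_inner_smul_left, real_inner_comm]
  simp only [hsymm, hparts, neg_add_cancel, le_refl]

theorem IsPrimitive.integral_deriv_mul_norm_sq (hw : IsPrimitive T w dw) (hθ : IsTimeTest T θ)
    (hθ0 : ∀ t, 0 ≤ θ t) :
    ∫ t in Ioo 0 T, deriv θ t * ‖w t‖ ^ 2 = -(2 * ∫ t in Ioo 0 T, θ t * inner ℝ (w t) (dw t)) := by
  have hle := hw.weakNonpos_inner_smul 1 θ hθ hθ0
  have hge := hw.weakNonpos_inner_smul (-1) θ hθ hθ0
  simp only [one_smul, neg_smul, inner_neg_left, real_inner_self_eq_norm_sq, zero_sub, neg_neg,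
    mul_neg, integral_neg, ← two_mul, mul_left_comm (θ _), integral_const_mul] at hle hge
  linarith

end DoublingTime

section AffineRate

theorem integrable_bilin {α X Y Z : Type*} [MeasurableSpace α] {μ : Measure α}
    [NormedAddCommGroup X] [NormedSpace ℝ X] [NormedAddCommGroup Y] [NormedSpace ℝ Y]
    [NormedAddCommGroup Z] [NormedSpace ℝ Z] (B : X →L[ℝ] Y →L[ℝ] Z) {p q : ENNReal}
    [p.HolderConjugate q] {a : α → X} {b : α → Y} (ha : MemLp a p μ) (hb : MemLp b q μ) :
    Integrable (fun t => B (a t) (b t)) μ :=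
  memLp_one_iff_integrable.1 (B.memLp_of_bilin 1 ha hb)

theorem memLp_coe {α E : Type*} [MeasurableSpace α] {μ : Measure α} {p : ENNReal}
    [NormedAddCommGroup E] [NormedSpace ℝ E] {S : Submodule ℝ E} {v : α → S} (hv : MemLp v p μ) :
    MemLp (fun t => (v t : E)) p μ :=
  hv.continuousLinearMap_comp S.subtypeL

variable {d : ℕ} {Ω : Set (Vec d)} {ν T : ℝ}

theorem MemX.memLp_vgrad {v : ℝ → L2sol Ω} (hv : MemX ν T v) :
    MemLp (fun t => vgrad ν (v t)) 2 (timeMeas T) := by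
  by_cases hν : 0 < ν
  · exact (hv.grad_memLp hν).ae_eq (ae_of_all _ fun t => (vgrad_of_pos hν _).symm)
  · exact MemLp.zero.ae_eq (ae_of_all _ fun t => (vgrad_of_not_pos hν _).symm)

theorem MemX.ae_memH10sol {v : ℝ → L2sol Ω} (hv : MemX ν T v) :
    ∀ᵐ t ∂timeMeas T, 0 < ν → MemH10sol (v t) :=
  eventually_imp_distrib_left.2 hv.memH10sol

variable (Ω T) in
/-- The time-dependent affine functional `w ↦ c + (h, ∇w) + (M; ∇w) + (g, w)`, with coefficients
in the spaces against which the topology of an admissible form is tested. -/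
structure AffineRate where
  c : ℝ → ℝ
  h : ℝ → L2Mat Ω
  M : ℝ → Lp (Mat d) 1 (volume.restrict Ω)
  g : ℝ → L2 Ω
  integrable_c : IntegrableOn c (Ioo 0 T)
  memLp_h : MemLp h 2 (timeMeas T)
  memLp_M : MemLp M ⊤ (timeMeas T)
  integrable_g : IntegrableOn g (Ioo 0 T)

namespace AffineRate

/-- The value of the functional at `w` and time `t`. The term with `h` is present only in the
viscous case. -/
def eval (R : AffineRate Ω T) (ν t : ℝ) (w : L2sol Ω) : ℝ :=
  R.c t + inner ℝ (vgrad ν w) (R.h t) + (∫ x in Ω, inner ℝ (grad w x) (R.M t x))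
    + inner ℝ (w : L2 Ω) (R.g t)

/-- `R` is the rate of the reduced inequality for `v` and `f`. -/
def Represents (R : AffineRate Ω T) (f : Force Ω ν T) (v : ℝ → L2sol Ω) : Prop :=
  ∀ᵐ t ∂timeMeas T, ∀ w : L2sol Ω, (0 < ν → MemH10sol w) →
    reducedRate f t (v t) w = R.eval ν t w

theorem exists_represents (hΩ : IsOpen Ω) (hΩb : Bornology.IsBounded Ω) (hν : 0 ≤ ν)
    (f : Force Ω ν T) {v : ℝ → L2sol Ω} (hv : MemX ν T v) :
    ∃ R : AffineRate Ω T, R.Represents f v := by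
  obtain ⟨g, g₁, hg, hg₁, hf⟩ := f.exists_isReprAt hν
  have hgrad := hv.memLp_vgrad
  have hv' : MemLp (fun t => (v t : L2 Ω)) ⊤ (timeMeas T) := memLp_coe hv.bounded
  have hdiss := (integrable_bilin (innerB (L2Mat Ω)) hgrad hgrad).const_mul ν
  have hgv := integrable_bilin (innerB (L2 Ω)) (memLp_one_iff_integrable.2 hg) hv'
  have hg₁v := integrable_bilin (innerB (L2Mat Ω)) hg₁ hgrad
  exact ⟨{
    c := fun t => ν * inner ℝ (vgrad ν (v t)) (vgrad ν (v t)) - inner ℝ (g t) (v t : L2 Ω)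
      - inner ℝ (g₁ t) (vgrad ν (v t))
    h := fun t => g₁ t - ν • vgrad ν (v t)
    M := fun t => tensor Ω (v t) (v t)
    g := g
    integrable_c := (hdiss.sub hgv).sub hg₁v
    memLp_h := hg₁.sub (hgrad.const_smul ν)
    memLp_M := (tensor Ω).memLp_of_bilin ⊤ hv' hv'
    integrable_g := hg },
    hv.ae_memH10sol.mono fun t ht w hw => reducedRate_eq hΩ hΩb (hf t) ht hw⟩

variable (R : AffineRate Ω T) {u : ℝ → L2sol Ω}

theorem integrable_inner_vgrad (hu : MemX ν T u) :
    IntegrableOn (fun t => inner ℝ (vgrad ν (u t)) (R.h t)) (Ioo 0 T) :=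
  integrable_bilin (innerB (L2Mat Ω)) hu.memLp_vgrad R.memLp_h

theorem integrable_integral_inner_grad (hΩ : IsOpen Ω) (hΩb : Bornology.IsBounded Ω)
    (hu : MemL1W1inf T u) :
    IntegrableOn (fun t => ∫ x in Ω, inner ℝ (grad (u t) x) (R.M t x)) (Ioo 0 T) := by
  obtain ⟨U, G, -, hG, hUG⟩ := hu
  exact (integrable_bilin (matPair Ω) (memLp_one_iff_integrable.2 hG) R.memLp_M).congr <|
    hUG.mono fun t ht => (integral_inner_grad_eq_matPair hΩ hΩb ht.2 (R.M t)).symm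

theorem integrable_inner_g (hu : MemLp u ⊤ (timeMeas T)) :
    IntegrableOn (fun t => inner ℝ (u t : L2 Ω) (R.g t)) (Ioo 0 T) :=
  integrable_bilin (innerB (L2 Ω)) (memLp_coe hu) (memLp_one_iff_integrable.2 R.integrable_g)

theorem integrable_eval (hΩ : IsOpen Ω) (hΩb : Bornology.IsBounded Ω)
    (hu : MemX ν T u) (hu' : MemL1W1inf T u) :
    IntegrableOn (fun t => R.eval ν t (u t)) (Ioo 0 T) :=
  ((Integrable.add R.integrable_c (R.integrable_inner_vgrad hu)).add
    (R.integrable_integral_inner_grad hΩ hΩb hu')).add (R.integrable_inner_g hu.bounded)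

theorem integral_eval (hΩ : IsOpen Ω) (hΩb : Bornology.IsBounded Ω)
    (hu : MemX ν T u) (hu' : MemL1W1inf T u) :
    ∫ t in Ioo 0 T, R.eval ν t (u t) = (∫ t in Ioo 0 T, R.c t)
      + (∫ t in Ioo 0 T, inner ℝ (vgrad ν (u t)) (R.h t))
      + (∫ t in Ioo 0 T, ∫ x in Ω, inner ℝ (grad (u t) x) (R.M t x))
      + ∫ t in Ioo 0 T, inner ℝ (u t : L2 Ω) (R.g t) := by
  have hh := R.integrable_inner_vgrad hu
  have hM := R.integrable_integral_inner_grad hΩ hΩb hu'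
  have hg := R.integrable_inner_g hu.bounded
  have hch := Integrable.add R.integrable_c hh
  exact (integral_add (hch.add hM) hg).trans <| congrArg (· + _) <|
    (integral_add hch hM).trans <| congrArg (· + _) <| integral_add R.integrable_c hh

end AffineRate

end AffineRate

section TestFunctions

variable {d : ℕ} {Ω : Set (Vec d)} {ν T : ℝ} {K : L2sol Ω → ENNReal} {v : ℝ → L2sol Ω} {ξ : ℝ → ℝ}

theorem WeakNonpos.congr_right {F g g' : ℝ → ℝ} (h : g =ᵐ[timeMeas T] g') :
    WeakNonpos T F g ↔ WeakNonpos T F g' := by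
  have hint (θ : ℝ → ℝ) : ∫ t in Ioo 0 T, θ t * g t = ∫ t in Ioo 0 T, θ t * g' t :=
    integral_congr_ae (h.mono fun t ht => congrArg (θ t * ·) ht)
  simp only [WeakNonpos, hint]

theorem weakNonpos_add_sub_iff {F g q r : ℝ → ℝ} (hF : IntegrableOn F (Ioo 0 T))
    (hg : IntegrableOn g (Ioo 0 T)) (hq : IntegrableOn q (Ioo 0 T)) (hr : IntegrableOn r (Ioo 0 T))
    (h : ∀ θ, IsTimeTest T θ → (∀ t, 0 ≤ θ t) →
      ∫ t in Ioo 0 T, deriv θ t * q t = -∫ t in Ioo 0 T, θ t * r t) :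
    WeakNonpos T (fun t => F t + q t) (fun t => g t - r t) ↔ WeakNonpos T F g := by
  refine forall_congr' fun θ => forall_congr' fun hθ => forall_congr' fun hθ0 => ?_
  simp only [mul_add, mul_sub]
  rw [integral_add (hθ.deriv.integrable_mul hF) (hθ.deriv.integrable_mul hq),
    integral_sub (hθ.integrable_mul hg) (hθ.integrable_mul hr), h θ hθ hθ0]
  ring_nf

theorem memLp_top_norm_sq {α V : Type*} [MeasurableSpace α] {μ : Measure α}
    [NormedAddCommGroup V] {a : α → V} (ha : MemLp a ⊤ μ) : MemLp (fun t => ‖a t‖ ^ 2) ⊤ μ := by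
  simpa only [sq, ContinuousLinearMap.mul_apply'] using
    (ContinuousLinearMap.mul ℝ ℝ).memLp_of_bilin ⊤ ha.norm ha.norm

theorem memLp_top_energy (hv : MemLp v ⊤ (timeMeas T)) (hξ : MemLp ξ ⊤ (timeMeas T)) :
    MemLp (energy v ξ) ⊤ (timeMeas T) :=
  ((memLp_top_norm_sq hv).const_mul (1 / 2)).add hξ

theorem memLp_top_energy_sub_inner {u : ℝ → L2sol Ω} (hv : MemLp v ⊤ (timeMeas T))
    (hu : MemLp u ⊤ (timeMeas T)) (hξ : MemLp ξ ⊤ (timeMeas T)) :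
    MemLp (fun t => energy v ξ t - inner ℝ (v t) (u t)) ⊤ (timeMeas T) :=
  (memLp_top_energy hv hξ).sub ((innerB (L2sol Ω)).memLp_of_bilin ⊤ hv hu)

theorem memLp_top_relEnergy_add {u : ℝ → L2sol Ω} (hv : MemLp v ⊤ (timeMeas T))
    (hu : MemLp u ⊤ (timeMeas T)) (hξ : MemLp ξ ⊤ (timeMeas T)) :
    MemLp (fun t => relEnergy (v t) (u t) + ξ t) ⊤ (timeMeas T) :=
  ((memLp_top_norm_sq (hv.sub hu)).const_mul (1 / 2)).add hξ

theorem half_norm_sub_sq_add {V : Type*} [NormedAddCommGroup V] [InnerProductSpace ℝ V]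
    (a b : V) (x : ℝ) :
    1 / 2 * ‖a - b‖ ^ 2 + x = (1 / 2 * ‖a‖ ^ 2 + x - inner ℝ a b) + 1 / 2 * ‖b‖ ^ 2 := by
  rw [norm_sub_sq_real]
  ring

theorem relEnergy_add_eq (v u : ℝ → L2sol Ω) (ξ : ℝ → ℝ) (t : ℝ) :
    relEnergy (v t) (u t) + ξ t
      = (energy v ξ t - inner ℝ (v t) (u t)) + 1 / 2 * ‖u t‖ ^ 2 :=
  half_norm_sub_sq_add (v t) (u t) (ξ t)

namespace TestFun

variable (p : TestFun ν T K)

theorem isPrimitive : IsPrimitive T p.u p.du where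
  integrable := p.memY.deriv_memLp.integrable one_le_two
  eq_add_integral := p.memY.eq_integral

theorem memLp_top : MemLp p.u ⊤ (timeMeas T) := p.memY.memX.bounded

theorem integrable_inner_du {a : ℝ → L2sol Ω} (ha : MemLp a ⊤ (timeMeas T)) :
    IntegrableOn (fun t => inner ℝ (a t) (p.du t)) (Ioo 0 T) :=
  integrable_bilin (innerB (L2sol Ω)) ha (memLp_one_iff_integrable.2 p.isPrimitive.integrable)

theorem exists_isW1inf :
    ∃ (U : ℝ → Lp (Vec d) ⊤ (volume.restrict Ω)) (G : ℝ → Lp (Mat d) ⊤ (volume.restrict Ω)),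
      ∀ᵐ t ∂timeMeas T, IsW1inf (p.u t : L2 Ω) (U t) (G t) := by
  obtain ⟨U, G, -, -, hUG⟩ := p.memY.memL1W1inf
  exact ⟨U, G, hUG.mono fun t ht => ⟨ht.1, ht.2⟩⟩

end TestFun

namespace AffineRate

variable {f : Force Ω ν T} (R : AffineRate Ω T)

/-- The rate of the reduced inequality, where the term with `K` is `K (½‖v‖² - E) = -K ξ`. -/
def netRate (ν : ℝ) (K : L2sol Ω → ENNReal) (ξ : ℝ → ℝ) (t : ℝ) (w : L2sol Ω) : ℝ :=
  R.eval ν t w - (K w).toReal * ξ t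

theorem integrable_netRate (hΩ : IsOpen Ω) (hΩb : Bornology.IsBounded Ω)
    (hξ : MemLp ξ ⊤ (timeMeas T)) (p : TestFun ν T K) :
    IntegrableOn (fun t => R.netRate ν K ξ t (p.u t)) (Ioo 0 T) :=
  (R.integrable_eval hΩ hΩb p.memY.memX p.memY.memL1W1inf).sub
    (integrable_bilin (ContinuousLinearMap.mul ℝ ℝ)
      (memLp_one_iff_integrable.2 p.integrable_K) hξ)

/-- The distributional inequality
`∂ₜ(E - (v, u)) + R(u) - K(u) ξ + (v, ∂ₜu) ≤ 0` for the time-dependent test function `u`. It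
extends the reduced inequality, and has the advantage over the relative energy inequality of being
affine in `u` up to the term with `K`. -/
def WeakIneq (ν : ℝ) (K : L2sol Ω → ENNReal) (v : ℝ → L2sol Ω) (ξ : ℝ → ℝ) (u du : ℝ → L2sol Ω) :
    Prop :=
  WeakNonpos T (fun t => energy v ξ t - inner ℝ (v t) (u t))
    fun t => R.netRate ν K ξ t (u t) + inner ℝ (v t) (du t)

variable {R}

theorem Represents.relRate_ae_eq (H : R.Represents f v) (hΩ : IsOpen Ω)
    (hΩb : Bornology.IsBounded Ω) (hν : 0 ≤ ν) (hv : MemX ν T v) (ξ : ℝ → ℝ) (p : TestFun ν T K) :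
    relRate f v ξ p =ᵐ[timeMeas T] fun t =>
      (R.netRate ν K ξ t (p.u t) + inner ℝ (v t) (p.du t)) - inner ℝ (p.u t) (p.du t) := by
  obtain ⟨U, G, hUG⟩ := p.exists_isW1inf
  filter_upwards [H, hUG, hv.ae_memH10sol, p.memY.memX.ae_memH10sol] with t hR hG hvt hut
  have hform := relForm_add_sysOp hΩ hΩb hν K f t (p.du t) hvt hut hG
  have hdu : inner ℝ (p.du t) (v t - p.u t)
      = inner ℝ (v t) (p.du t) - inner ℝ (p.u t) (p.du t) :=
    (inner_sub_right _ _ _).trans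
      (congrArg₂ (· - ·) (real_inner_comm _ _) (real_inner_comm _ _))
  have arith {F r i a b k E x y z n : ℝ} (hF : F = r + i + k * E) (hr : r = z) (hi : i = a - b)
      (hx : x = F - k * (E + y)) (hn : n = z - k * y) : x = (n + a) - b := by
    subst_vars
    ring
  exact arith hform (hR _ hut) hdu rfl rfl

theorem Represents.integrable_relRate (H : R.Represents f v) (hΩ : IsOpen Ω)
    (hΩb : Bornology.IsBounded Ω) (hν : 0 ≤ ν) (hv : MemX ν T v) (hξ : MemLp ξ ⊤ (timeMeas T))
    (p : TestFun ν T K) : IntegrableOn (relRate f v ξ p) (Ioo 0 T) :=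
  Integrable.congr (((R.integrable_netRate hΩ hΩb hξ p).add (p.integrable_inner_du hv.bounded)).sub
    (p.integrable_inner_du p.memLp_top)) (H.relRate_ae_eq hΩ hΩb hν hv ξ p).symm

theorem Represents.weakNonpos_relEnergy_iff (H : R.Represents f v) (hΩ : IsOpen Ω)
    (hΩb : Bornology.IsBounded Ω) (hν : 0 ≤ ν) (hv : MemX ν T v) (hξ : MemLp ξ ⊤ (timeMeas T))
    (p : TestFun ν T K) :
    WeakNonpos T (fun t => relEnergy (v t) (p.u t) + ξ t) (relRate f v ξ p)
      ↔ R.WeakIneq ν K v ξ p.u p.du := by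
  have hhalf (θ : ℝ → ℝ) (hθ : IsTimeTest T θ) (hθ0 : ∀ t, 0 ≤ θ t) :
      ∫ t in Ioo 0 T, deriv θ t * (1 / 2 * ‖p.u t‖ ^ 2)
        = -∫ t in Ioo 0 T, θ t * inner ℝ (p.u t) (p.du t) := by
    have hsq := p.isPrimitive.integral_deriv_mul_norm_sq hθ hθ0
    simp only [mul_left_comm _ (1 / 2 : ℝ), integral_const_mul]
    linarith
  refine (WeakNonpos.congr_right (H.relRate_ae_eq hΩ hΩb hν hv ξ p)).trans ?_
  simp only [relEnergy_add_eq]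
  exact weakNonpos_add_sub_iff
    ((memLp_top_energy_sub_inner hv.bounded p.memLp_top hξ).integrable le_top)
    ((R.integrable_netRate hΩ hΩb hξ p).add (p.integrable_inner_du hv.bounded))
    (((memLp_top_norm_sq p.memLp_top).const_mul _).integrable le_top)
    (p.integrable_inner_du p.memLp_top) hhalf

theorem Represents.localInequality_iff (H : R.Represents f v) (hΩ : IsOpen Ω)
    (hΩb : Bornology.IsBounded Ω) (hν : 0 ≤ ν) (hv : MemX ν T v) (hξ : MemLp ξ ⊤ (timeMeas T)) :
    LocalInequality K f v ξ ↔ ∀ p : TestFun ν T K, R.WeakIneq ν K v ξ p.u p.du :=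
  forall_congr' fun p =>
    (derivAddNonpos_iff_weakNonpos (memLp_top_relEnergy_add hv.bounded p.memLp_top hξ)
      (H.integrable_relRate hΩ hΩb hν hv hξ p)).trans
        (H.weakNonpos_relEnergy_iff hΩ hΩb hν hv hξ p)

theorem Represents.relativeEnergyInequality_iff (H : R.Represents f v) (hΩ : IsOpen Ω)
    (hΩb : Bornology.IsBounded Ω) (hT : 0 < T) (hν : 0 ≤ ν) (hv : MemX ν T v)
    (hξ : MemLp ξ ⊤ (timeMeas T)) :
    RelativeEnergyInequality K f v ξ ↔ ∀ p : TestFun ν T K, R.WeakIneq ν K v ξ p.u p.du :=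
  forall_congr' fun p =>
    have hrate := H.integrable_relRate hΩ hΩb hν hv hξ p
    (and_iff_right hrate).trans <|
      (limNonpos_iff_weakNonpos hT (memLp_top_relEnergy_add hv.bounded p.memLp_top hξ)
        hrate).trans (H.weakNonpos_relEnergy_iff hΩ hΩb hν hv hξ p)

end AffineRate

end TestFunctions

section ConstantTestFunctions

variable {d : ℕ} {Ω : Set (Vec d)} {ν T : ℝ} {K : L2sol Ω → ENNReal} {v : ℝ → L2sol Ω} {ξ : ℝ → ℝ}

theorem contDiff_gradField_coord (φ : TestField Ω) (ij : Fin d × Fin d) :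
    ContDiff ℝ ∞ fun x => gradField φ.toFun x ij :=
  contDiff_euclidean.1 ((φ.smooth.fderiv_right (by simp)).clm_apply contDiff_const) ij.1

theorem hasCompactSupport_gradField_coord (φ : TestField Ω) (ij : Fin d × Fin d) :
    HasCompactSupport fun x => gradField φ.toFun x ij :=
  (φ.compactSupp.fderiv (𝕜 := ℝ)).comp_left
    (g := fun L : Vec d →L[ℝ] Vec d => L (EuclideanSpace.single ij.2 1) ij.1) rfl

theorem TestField.memLp_top_gradField (φ : TestField Ω) :
    MemLp (gradField φ.toFun) ⊤ (volume.restrict Ω) :=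
  MemLp.of_eval_piLp fun ij => (contDiff_gradField_coord φ ij).continuous.memLp_of_hasCompactSupport
    (hasCompactSupport_gradField_coord φ ij)

theorem memL1W1inf_const (φ : SolField Ω) : MemL1W1inf T fun _ => φ.toL2sol :=
  have hφ : φ.toL2 =ᵐ[volume.restrict Ω] φ.toFun := φ.memLp.coeFn_toLp
  ⟨fun _ => φ.memLp_top.toLp, fun _ => φ.memLp_top_gradField.toLp, integrable_const _,
    integrable_const _, Eventually.of_forall fun _ => ⟨φ.memLp_top.coeFn_toLp.trans hφ.symm,
      φ.hasWeakGrad.congr hφ.symm φ.memLp_top_gradField.coeFn_toLp.symm⟩⟩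

/-- The tensor of the second derivatives `∂ₖ∂ⱼφᵢ`, a representative of the class asked for in
`MemL2H2`. -/
def secondDeriv (φ : Vec d → Vec d) (x : Vec d) : Tens d :=
  WithLp.toLp 2 fun ijk =>
    fderiv ℝ (fun y => gradField φ y (ijk.1, ijk.2.1)) x (EuclideanSpace.single ijk.2.2 1)

theorem TestField.memLp_secondDeriv (φ : TestField Ω) :
    MemLp (secondDeriv φ.toFun) 2 (volume.restrict Ω) :=
  MemLp.of_eval_piLp fun _ =>
    (continuous_fderiv_apply (contDiff_gradField_coord φ _) _).memLp_of_hasCompactSupport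
      (hasCompactSupport_fderiv_apply (hasCompactSupport_gradField_coord φ _) _)

theorem memL2H2_const (hΩ : IsOpen Ω) (hΩb : Bornology.IsBounded Ω) (φ : SolField Ω) :
    MemL2H2 T fun _ => φ.toL2sol := by
  have hgrad : gradField φ.toFun =ᵐ[volume.restrict Ω] grad φ.toL2sol := by
    rw [φ.grad_toL2sol hΩ hΩb]
    exact φ.memLp_grad.coeFn_toLp.symm
  exact ⟨fun _ => φ.memLp_secondDeriv.toLp, memLp_const _, Eventually.of_forall fun _ i j k =>
    (hasWeakPartial_of_contDiff (contDiff_gradField_coord φ.toTestField (i, j)) k).congr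
      (hgrad.mono fun x hx => congrArg (fun A : Mat d => A (i, j)) hx)
      (φ.memLp_secondDeriv.coeFn_toLp.mono fun x hx =>
        congrArg (fun A : Tens d => A (i, j, k)) hx.symm)⟩

variable (Ω) in
/-- The zero field, as the time derivative of a constant curve. -/
def SolField.zero : SolField Ω where
  toFun _ := 0
  smooth := contDiff_const
  compactSupp := HasCompactSupport.zero
  supp_subset := by simp [tsupport]
  div_free := by simp

theorem isC1Curve_const (φ : SolField Ω) :
    IsC1Curve T (fun _ => φ) fun _ => SolField.zero Ω where
  common_supp := ⟨_, φ.compactSupp.isCompact, φ.supp_subset, fun _ _ => Subset.rfl⟩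
  hasDeriv m x t _ := by
    have hzero : iteratedFDeriv ℝ m (SolField.zero Ω).toFun x = 0 :=
      congrFun (iteratedFDeriv_fun_zero (𝕜 := ℝ) (n := m)) x
    rw [hzero]
    exact hasDerivWithinAt_const _ _ _
  cont m := ((φ.smooth.continuous_iteratedFDeriv (by exact_mod_cast le_top)).comp
    continuous_snd).continuousOn
  cont_deriv m := ((contDiff_const.continuous_iteratedFDeriv (by exact_mod_cast le_top)).comp
    continuous_snd).continuousOn

/-- A smooth compactly supported solenoidal field as a test function which does not depend on
time. -/
def TestFun.const (hΩ : IsOpen Ω) (hΩb : Bornology.IsBounded Ω) (hK : IsAdmissible ν T K)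
    (φ : SolField Ω) : TestFun ν T K where
  u _ := φ.toL2sol
  du _ := 0
  memY :=
    { memX := ⟨memLp_top_const _, fun _ => Eventually.of_forall fun _ => φ.memH10sol hΩ hΩb,
        fun _ => memLp_const _⟩
      memL2H2 := fun _ => memL2H2_const hΩ hΩb φ
      memL1W1inf := memL1W1inf_const φ
      deriv_memLp := MemLp.zero'
      eq_integral := fun t _ => by rw [intervalIntegral.integral_zero, add_zero] }
  memDom := hK.curve_memDom _ _ (isC1Curve_const φ)

variable {f : Force Ω ν T} {R : AffineRate Ω T}

theorem AffineRate.Represents.reducedInequality_iff (H : R.Represents f v) (hΩ : IsOpen Ω)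
    (hΩb : Bornology.IsBounded Ω) (hν : 0 ≤ ν) (hK : IsAdmissible ν T K) (hv : MemX ν T v)
    (hξ : MemLp ξ ⊤ (timeMeas T)) :
    ReducedInequality K f v ξ
      ↔ ∀ φ : SolField Ω, R.WeakIneq ν K v ξ (fun _ => φ.toL2sol) fun _ => 0 := by
  refine forall_congr' fun φ => ?_
  set p := TestFun.const hΩ hΩb hK φ
  have hrate : (fun t => ν * inner ℝ (grad (v t)) (grad (v t) - φ.gradL2)
        + (∫ x in Ω, ∑ i, ∑ j,
            ((v t : L2 Ω) x i * (v t : L2 Ω) x j) * gradField φ.toFun x (i, j))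
        - f.pair t (v t - φ.toL2sol)
        + (K φ.toL2sol).toReal * (1 / 2 * ‖v t‖ ^ 2 - energy v ξ t))
      =ᵐ[timeMeas T] fun t => R.netRate ν K ξ t φ.toL2sol + inner ℝ (v t) 0 := by
    filter_upwards [H] with t hR
    have hred := (reducedRate_toL2sol hΩ hΩb hν f t (v t) φ).symm.trans
      (hR _ fun _ => φ.memH10sol hΩ hΩb)
    have arith {A z k n x e y i : ℝ} (hA : A = z) (he : e = n + x) (hy : y = z - k * x)
        (hi : i = 0) : A + k * (n - e) = y + i := by
      subst_vars
      ring
    exact arith hred rfl rfl (inner_zero_right _)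
  have hint : IntegrableOn (fun t => R.netRate ν K ξ t φ.toL2sol + inner ℝ (v t) 0) (Ioo 0 T) :=
    (R.integrable_netRate hΩ hΩb hξ p).add (p.integrable_inner_du hv.bounded)
  exact (derivAddNonpos_iff_weakNonpos (memLp_top_energy_sub_inner hv.bounded p.memLp_top hξ)
    (Integrable.congr hint hrate.symm)).trans (WeakNonpos.congr_right hrate)

end ConstantTestFunctions

section Density

variable {d : ℕ} {Ω : Set (Vec d)} {ν T : ℝ} {K : L2sol Ω → ENNReal} {v : ℝ → L2sol Ω} {ξ : ℝ → ℝ}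
  {w w' : ℝ → SolField Ω}

namespace IsC1Curve

theorem continuousOn_gradField (hw : IsC1Curve T w w') :
    ContinuousOn (fun q : ℝ × Vec d => gradField (w q.1).toFun q.2) (Icc 0 T ×ˢ univ) := by
  have hcoord (ij : Fin d × Fin d) : ContinuousOn (fun q : ℝ × Vec d =>
      iteratedFDeriv ℝ 1 (w q.1).toFun q.2 (fun _ => EuclideanSpace.single ij.2 1) ij.1)
      (Icc 0 T ×ˢ univ) := by
    have heval := (ContinuousMultilinearMap.apply ℝ (fun _ : Fin 1 => Vec d) (Vec d) fun _ =>
      EuclideanSpace.single ij.2 1).continuous.comp_continuousOn (hw.cont 1)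
    exact (EuclideanSpace.proj ij.1 : Vec d →L[ℝ] ℝ).continuous.comp_continuousOn heval
  simp only [iteratedFDeriv_one_apply] at hcoord
  exact (PiLp.continuous_toLp 2 _).comp_continuousOn (continuousOn_pi.2 hcoord)

theorem exists_bound_gradField (hw : IsC1Curve T w w') :
    ∃ C, 0 ≤ C ∧ ∀ t ∈ Icc 0 T, ∀ x, ‖gradField (w t).toFun x‖ ≤ C := by
  obtain ⟨S, hS, -, hsupp⟩ := hw.common_supp
  obtain ⟨C, hC⟩ := (isCompact_Icc.prod hS).exists_bound_of_continuousOn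
    (hw.continuousOn_gradField.mono (prod_mono_right (subset_univ S)))
  refine ⟨max C 0, le_max_right _ _, fun t ht x => ?_⟩
  by_cases hx : x ∈ S
  · exact (hC (t, x) ⟨ht, hx⟩).trans (le_max_left _ _)
  · have hzero : fderiv ℝ (w t).toFun x = 0 :=
      image_eq_zero_of_notMem_tsupport fun h => hx (hsupp t ht (tsupport_fderiv_subset ℝ h))
    have hgrad : gradField (w t).toFun x = 0 := by
      ext ij
      simp [gradField, hzero]
    rw [hgrad, norm_zero]
    exact le_max_right _ _

theorem exists_bound_gradL2 (hw : IsC1Curve T w w') (hΩb : Bornology.IsBounded Ω) :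
    ∃ C, 0 ≤ C ∧ ∀ t ∈ Icc 0 T, ‖(w t).gradL2‖ ≤ C := by
  have : IsFiniteMeasure (volume.restrict Ω) :=
    isFiniteMeasure_restrict.2 hΩb.measure_lt_top.ne
  obtain ⟨C, hC0, hC⟩ := hw.exists_bound_gradField
  exact ⟨_, by positivity, fun t ht => Lp.norm_le_of_ae_bound hC0 <|
    (w t).memLp_grad.coeFn_toLp.mono fun x hx => (congrArg norm hx).trans_le (hC t ht x)⟩

theorem memLp_top_vgrad (hw : IsC1Curve T w w') (hΩ : IsOpen Ω) (hΩb : Bornology.IsBounded Ω)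
    {u : ℝ → L2sol Ω} (hu : MemX ν T u) (huw : ∀ t ∈ Icc 0 T, u t = (w t).toL2sol) :
    MemLp (fun t => vgrad ν (u t)) ⊤ (timeMeas T) := by
  obtain ⟨C, hC0, hC⟩ := hw.exists_bound_gradL2 hΩb
  refine memLp_top_of_bound hu.memLp_vgrad.1 C ?_
  filter_upwards [ae_restrict_mem measurableSet_Ioo] with t ht
  have ht' : t ∈ Icc 0 T := Ioo_subset_Icc_self ht
  by_cases hν : 0 < ν
  · have hgrad : vgrad ν (u t) = (w t).gradL2 :=
      (vgrad_of_pos hν _).trans ((congrArg grad (huw t ht')).trans ((w t).grad_toL2sol hΩ hΩb))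
    exact (congrArg norm hgrad).trans_le (hC t ht')
  · exact ((congrArg norm (vgrad_of_not_pos hν (u t))).trans norm_zero).trans_le hC0

end IsC1Curve

namespace AffineRate

variable (R : AffineRate Ω T)

/-- The rate with the time `s` of the test function separated from the time `t` of the solution.
The gradients `G` of `u` are taken in `L^∞`, where they are strongly measurable in time. -/
def doubledRate (ν : ℝ) (K : L2sol Ω → ENNReal) (ξ : ℝ → ℝ) (u : ℝ → L2sol Ω)
    (G : ℝ → Lp (Mat d) ⊤ (volume.restrict Ω)) (s t : ℝ) : ℝ :=
  R.c t + inner ℝ (vgrad ν (u s)) (R.h t) + matPair Ω (G s) (R.M t)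
    + inner ℝ (u s : L2 Ω) (R.g t) - (K (u s)).toReal * ξ t

theorem doubledRate_eq_netRate (hΩ : IsOpen Ω) (hΩb : Bornology.IsBounded Ω)
    {u : ℝ → L2sol Ω} {G : ℝ → Lp (Mat d) ⊤ (volume.restrict Ω)} {s : ℝ}
    (hG : HasWeakGrad Ω (u s : L2 Ω) (G s)) (t : ℝ) :
    R.doubledRate ν K ξ u G s t = R.netRate ν K ξ t (u s) :=
  congrArg (fun m => R.c t + inner ℝ (vgrad ν (u s)) (R.h t) + m
    + inner ℝ (u s : L2 Ω) (R.g t) - (K (u s)).toReal * ξ t)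
    (integral_inner_grad_eq_matPair hΩ hΩb hG (R.M t)).symm

theorem mollifies_doubledRate {u : ℝ → L2sol Ω} {G : ℝ → Lp (Mat d) ⊤ (volume.restrict Ω)}
    (hu : MemLp u ⊤ (timeMeas T)) (hgrad : MemLp (fun t => vgrad ν (u t)) ⊤ (timeMeas T))
    (hG : Integrable G (timeMeas T)) (hK : Integrable (fun t => (K (u t)).toReal) (timeMeas T))
    (hξ : MemLp ξ ⊤ (timeMeas T)) {θ : ℝ → ℝ} (hθ : MemLp θ ⊤ (timeMeas T)) :
    Mollifies T fun s t => θ t * R.doubledRate ν K ξ u G s t := by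
  have hc := mollifies_mul hθ R.integrable_c
  have hh := mollifies_mul_bilin (innerB (L2Mat Ω)) hθ hgrad (R.memLp_h.integrable one_le_two)
  have hM := mollifies_mul_bilin_swap (matPair Ω).flip hθ R.memLp_M hG
  have hg := mollifies_mul_bilin (innerB (L2 Ω)) hθ (memLp_coe hu) R.integrable_g
  have hKξ := mollifies_mul_bilin_swap (ContinuousLinearMap.mul ℝ ℝ).flip hθ hξ hK
  have hsplit : (fun s t => θ t * R.doubledRate ν K ξ u G s t) = fun s t =>
      θ t * R.c t + θ t * innerB (L2Mat Ω) (vgrad ν (u s)) (R.h t)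
        + θ t * (matPair Ω).flip (R.M t) (G s) + θ t * innerB (L2 Ω) (u s : L2 Ω) (R.g t)
        - θ t * (ContinuousLinearMap.mul ℝ ℝ).flip (ξ t) (K (u s)).toReal := by
    have arith {x c a m b k z : ℝ} (hz : z = c + a + m + b - k) :
        x * z = x * c + x * a + x * m + x * b - x * k := by
      subst_vars
      ring
    exact funext₂ fun s t => arith rfl
  rw [hsplit]
  exact (((hc.add hh).add hM).add hg).sub hKξ

variable {R}

theorem weakIneq_of_isC1Curve (hΩ : IsOpen Ω) (hΩb : Bornology.IsBounded Ω)
    (hv : MemLp v ⊤ (timeMeas T)) (hξ : MemLp ξ ⊤ (timeMeas T))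
    (hR : ∀ φ : SolField Ω, R.WeakIneq ν K v ξ (fun _ => φ.toL2sol) fun _ => 0)
    (hw : IsC1Curve T w w') (p : TestFun ν T K) (hp : ∀ t ∈ Icc 0 T, p.u t = (w t).toL2sol) :
    R.WeakIneq ν K v ξ p.u p.du := by
  obtain ⟨U, G, -, hG, hUG⟩ := p.memY.memL1W1inf
  have hfrozen : ∀ᵐ s ∂timeMeas T, WeakNonpos T
      (fun t => energy v ξ t - inner ℝ (v t) (p.u s)) (R.doubledRate ν K ξ p.u G s) := by
    filter_upwards [hUG, ae_restrict_mem measurableSet_Ioo] with s hs hsT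
    have hconst := hR (w s)
    rw [← hp s (Ioo_subset_Icc_self hsT)] at hconst
    refine (WeakNonpos.congr_right (Eventually.of_forall fun t => ?_)).1 hconst
    exact (congrArg₂ (· + ·) (R.doubledRate_eq_netRate hΩ hΩb hs.2 t).symm
      (inner_zero_right _)).trans (add_zero _)
  have hdiag := weakNonpos_diagonal ((memLp_top_energy hv hξ).integrable le_top) hv p.isPrimitive
    (fun θ hθ => R.mollifies_doubledRate p.memLp_top
      (hw.memLp_top_vgrad hΩ hΩb p.memY.memX hp) hG p.integrable_K hξ hθ.memLp_top) hfrozen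
  exact (WeakNonpos.congr_right (hUG.mono fun t ht =>
    congrArg (· + inner ℝ (v t) (p.du t)) (R.doubledRate_eq_netRate hΩ hΩb ht.2 t))).1 hdiag

end AffineRate

/-- The affine functional which appears when the inequality for the solution `v` is tested with
`θ`, the derivative `θ'` being put on `E - (v, w)`. -/
def AffineRate.tested (R : AffineRate Ω T) (hv : MemLp v ⊤ (timeMeas T))
    (hξ : MemLp ξ ⊤ (timeMeas T)) {θ : ℝ → ℝ} (hθ : IsTimeTest T θ) : AffineRate Ω T where
  c t := θ t * R.c t - deriv θ t * energy v ξ t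
  h := θ • R.h
  M := θ • R.M
  g := θ • R.g + deriv θ • fun t => (v t : L2 Ω)
  integrable_c := (hθ.integrable_mul R.integrable_c).sub
    (hθ.deriv.integrable_mul ((memLp_top_energy hv hξ).integrable le_top))
  memLp_h := R.memLp_h.smul hθ.memLp_top
  memLp_M := R.memLp_M.smul hθ.memLp_top
  integrable_g := Integrable.add (Integrable.smul_of_top_right R.integrable_g hθ.memLp_top)
    (((memLp_coe hv).integrable le_top).smul_of_top_right hθ.deriv.memLp_top)

namespace AffineRate

variable (R : AffineRate Ω T)

theorem eval_tested (hv : MemLp v ⊤ (timeMeas T)) (hξ : MemLp ξ ⊤ (timeMeas T)) {θ : ℝ → ℝ}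
    (hθ : IsTimeTest T θ) (t : ℝ) (w : L2sol Ω) :
    (R.tested hv hξ hθ).eval ν t w
      = θ t * R.eval ν t w - deriv θ t * (energy v ξ t - inner ℝ (v t) w) := by
  have hM : ∫ x in Ω, inner ℝ (grad w x) ((θ t • R.M t) x)
      = θ t * ∫ x in Ω, inner ℝ (grad w x) (R.M t x) := by
    refine Eq.trans (integral_congr_ae ?_) (integral_const_mul _ _)
    filter_upwards [Lp.coeFn_smul (θ t) (R.M t)] with x hx
    rw [hx, Pi.smul_apply, real_inner_smul_right]
  have hg : inner ℝ (w : L2 Ω) (θ t • R.g t + deriv θ t • (v t : L2 Ω))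
      = θ t * inner ℝ (w : L2 Ω) (R.g t) + deriv θ t * inner ℝ (v t) w :=
    (inner_add_right _ _ _).trans (congrArg₂ (· + ·) (real_inner_smul_right _ _ _)
      ((real_inner_smul_right _ _ _).trans (congrArg _ (real_inner_comm _ _))))
  have arith {x c a m b y E i a' m' b' z : ℝ} (ha : a' = x * a) (hm : m' = x * m)
      (hb : b' = x * b + y * i) (hz : z = c + a + m + b) :
      x * c - y * E + a' + m' + b' = x * z - y * (E - i) := by
    subst_vars
    ring
  exact arith (real_inner_smul_right _ _ _) hM hg rfl

end AffineRate

theorem continuous_integral_mul_of_toL1 {X α : Type*} [TopologicalSpace X] [MeasurableSpace α]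
    {μ : Measure α} {k : X → α → ℝ} (hk : ∀ p, Integrable (k p) μ)
    (hc : Continuous fun p => (hk p).toL1) {b : α → ℝ} (hb : MemLp b ⊤ μ) :
    Continuous fun p => ∫ t, b t * k p t ∂μ := by
  refine (((ContinuousLinearMap.mul ℝ ℝ).lpPairing μ ⊤ 1 hb.toLp).continuous.comp hc).congr
    fun p => ?_
  refine (ContinuousLinearMap.lpPairing_eq_integral _ _ _).trans (integral_congr_ae ?_)
  filter_upwards [hb.coeFn_toLp, (hk p).coeFn_toL1] with t hbt hkt
  rw [hbt, hkt, ContinuousLinearMap.mul_apply']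

theorem continuous_integral_inner_vgrad [TopologicalSpace (TestFun ν T K)]
    (hgrad : 0 < ν → ∀ M : ℝ → L2Mat Ω, MemLp M 2 (timeMeas T) →
      Continuous fun p : TestFun ν T K => ∫ t in Ioo 0 T, inner ℝ (grad (p.u t)) (M t))
    {h : ℝ → L2Mat Ω} (hh : MemLp h 2 (timeMeas T)) :
    Continuous fun p : TestFun ν T K => ∫ t in Ioo 0 T, inner ℝ (vgrad ν (p.u t)) (h t) := by
  by_cases hν : 0 < ν
  · exact (hgrad hν h hh).congr fun p => integral_congr_ae (Eventually.of_forall fun t =>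
      congrArg (inner ℝ · (h t)) (vgrad_of_pos hν _).symm)
  · exact (continuous_const (y := (0 : ℝ))).congr fun p => (integral_eq_zero_of_ae
      (Eventually.of_forall fun t => (congrArg (inner ℝ · (h t)) (vgrad_of_not_pos hν _)).trans
        (inner_zero_left _))).symm

theorem IsAdmissible.exists_topology_continuous_integral_eval (hK : IsAdmissible ν T K)
    (hΩ : IsOpen Ω) (hΩb : Bornology.IsBounded Ω) :
    ∃ _τ : TopologicalSpace (TestFun ν T K),
      (∀ R : AffineRate Ω T,
        Continuous fun p : TestFun ν T K => ∫ t in Ioo 0 T, R.eval ν t (p.u t)) ∧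
      (∀ b : ℝ → ℝ, MemLp b ⊤ (timeMeas T) →
        Continuous fun p : TestFun ν T K => ∫ t in Ioo 0 T, b t * (K (p.u t)).toReal) ∧
      (∀ a : ℝ → L2sol Ω, MemLp a 2 (timeMeas T) →
        Continuous fun p : TestFun ν T K => ∫ t in Ioo 0 T, inner ℝ (p.du t) (a t)) ∧
      Dense {p : TestFun ν T K | ∃ w w' : ℝ → SolField Ω, IsC1Curve T w w' ∧
        ∀ t ∈ Icc 0 T, p.u t = (w t).toL2sol} := by
  obtain ⟨τ, hcK, hcg, hcdu, hcM, hcgrad, hdense⟩ := hK.exists_topology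
  refine ⟨τ, fun R => ?_, fun b hb => continuous_integral_mul_of_toL1 _ hcK hb, hcdu, hdense⟩
  simp only [R.integral_eval hΩ hΩb (TestFun.memY _).memX (TestFun.memY _).memL1W1inf]
  exact ((continuous_const.add (continuous_integral_inner_vgrad hcgrad R.memLp_h)).add
    (hcM _ R.memLp_M)).add (hcg _ R.integrable_g)

namespace AffineRate

variable (R : AffineRate Ω T)

theorem weakIneq_iff_integral_tested (hΩ : IsOpen Ω) (hΩb : Bornology.IsBounded Ω)
    (hv : MemLp v ⊤ (timeMeas T)) (hξ : MemLp ξ ⊤ (timeMeas T)) (p : TestFun ν T K) :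
    R.WeakIneq ν K v ξ p.u p.du ↔ ∀ θ (hθ : IsTimeTest T θ), (∀ t, 0 ≤ θ t) →
      (∫ t in Ioo 0 T, (R.tested hv hξ hθ).eval ν t (p.u t))
        - (∫ t in Ioo 0 T, (θ t * ξ t) * (K (p.u t)).toReal)
        + ∫ t in Ioo 0 T, inner ℝ (p.du t) (θ t • v t) ≤ 0 := by
  refine forall_congr' fun θ => forall_congr' fun hθ => forall_congr' fun _ => ?_
  have hF : IntegrableOn (fun t => deriv θ t * (energy v ξ t - inner ℝ (v t) (p.u t)))
      (Ioo 0 T) :=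
    hθ.deriv.integrable_mul ((memLp_top_energy_sub_inner hv p.memLp_top hξ).integrable le_top)
  have hrate : IntegrableOn
      (fun t => θ t * (R.netRate ν K ξ t (p.u t) + inner ℝ (v t) (p.du t))) (Ioo 0 T) :=
    hθ.integrable_mul ((R.integrable_netRate hΩ hΩb hξ p).add (p.integrable_inner_du hv))
  have heval := (R.tested hv hξ hθ).integrable_eval hΩ hΩb p.memY.memX p.memY.memL1W1inf
  have hKξ : IntegrableOn (fun t => (θ t * ξ t) * (K (p.u t)).toReal) (Ioo 0 T) :=
    Integrable.mul_of_top_right p.integrable_K (hξ.smul hθ.memLp_top)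
  have hdu : IntegrableOn (fun t => inner ℝ (p.du t) (θ t • v t)) (Ioo 0 T) :=
    integrable_bilin (p := ⊤) (q := 1) (innerB (L2sol Ω)).flip (hv.smul (r := ⊤) hθ.memLp_top)
      (memLp_one_iff_integrable.2 p.isPrimitive.integrable)
  have hpoint (t : ℝ) : θ t * (R.netRate ν K ξ t (p.u t) + inner ℝ (v t) (p.du t))
        - deriv θ t * (energy v ξ t - inner ℝ (v t) (p.u t))
      = (R.tested hv hξ hθ).eval ν t (p.u t) - (θ t * ξ t) * (K (p.u t)).toReal
        + inner ℝ (p.du t) (θ t • v t) := by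
    have arith {e x r k y i n j s : ℝ} (he : e = x * r - s) (hn : n = r - k * y)
        (hj : j = x * i) : x * (n + i) - s = e - (x * y) * k + j := by
      subst_vars
      ring
    exact arith (R.eval_tested hv hξ hθ t _) rfl
      ((real_inner_smul_right (p.du t) (v t) (θ t)).trans
        (congrArg (θ t * ·) (real_inner_comm (v t) (p.du t))))
  have hdiff : IntegrableOn (fun t => (R.tested hv hξ hθ).eval ν t (p.u t)
      - (θ t * ξ t) * (K (p.u t)).toReal) (Ioo 0 T) := heval.sub hKξ
  rw [neg_add_eq_sub, ← integral_sub hrate hF, ← integral_sub heval hKξ,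
    ← integral_add hdiff hdu]
  exact iff_of_eq (congrArg (· ≤ 0) (integral_congr_ae (Eventually.of_forall hpoint)))

variable {R}

theorem weakIneq_of_forall_const (hΩ : IsOpen Ω) (hΩb : Bornology.IsBounded Ω)
    (hK : IsAdmissible ν T K) (hv : MemLp v ⊤ (timeMeas T)) (hξ : MemLp ξ ⊤ (timeMeas T))
    (hR : ∀ φ : SolField Ω, R.WeakIneq ν K v ξ (fun _ => φ.toL2sol) fun _ => 0)
    (p : TestFun ν T K) : R.WeakIneq ν K v ξ p.u p.du := by
  obtain ⟨τ, heval, hcK, hcdu, hdense⟩ := hK.exists_topology_continuous_integral_eval hΩ hΩb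
  have hclosed : IsClosed {p : TestFun ν T K | R.WeakIneq ν K v ξ p.u p.du} := by
    simp only [R.weakIneq_iff_integral_tested hΩ hΩb hv hξ, ofPred_forall]
    refine isClosed_iInter fun θ => isClosed_iInter fun hθ => isClosed_iInter fun _ =>
      isClosed_le ?_ continuous_const
    exact ((heval _).sub (hcK _ (hξ.smul hθ.memLp_top))).add
      (hcdu _ ((hv.smul hθ.memLp_top).mono_exponent le_top))
  refine hclosed.closure_subset_iff.2 ?_ (hdense p)
  rintro q ⟨w, w', hw, hq⟩
  exact weakIneq_of_isC1Curve hΩ hΩb hv hξ hR hw q hq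

end AffineRate

end Density

end EnergyVariational

end

open EnergyVariational in
theorem proposition2_general {d : ℕ} {Ω : Set (Vec d)} (hΩ : IsOpen Ω)
    (hΩb : Bornology.IsBounded Ω) {T : ℝ} (hT : 0 < T) {ν : ℝ} (hν : 0 ≤ ν)
    {K : L2sol Ω → ENNReal} (hK : IsAdmissible ν T K) (f : Force Ω ν T)
    {v : ℝ → L2sol Ω} (hv : MemX ν T v) {ξ : ℝ → ℝ} (hξ : MemLp ξ ⊤ (timeMeas T)) :
    (RelativeEnergyInequality K f v ξ ↔ LocalInequality K f v ξ) ∧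
    (RelativeEnergyInequality K f v ξ ↔ ReducedInequality K f v ξ) := by
  obtain ⟨R, hR⟩ := AffineRate.exists_represents hΩ hΩb hν f hv
  have hrel := hR.relativeEnergyInequality_iff (K := K) hΩ hΩb hT hν hv hξ
  have hlocal := hR.localInequality_iff (K := K) hΩ hΩb hν hv hξ
  have hred := hR.reducedInequality_iff hΩ hΩb hν hK hv hξ
  refine ⟨hrel.trans hlocal.symm, hrel.trans (Iff.trans ⟨fun h φ => ?_, fun h p => ?_⟩ hred.symm)⟩
  · exact h (TestFun.const hΩ hΩb hK φ)
  · exact AffineRate.weakIneq_of_forall_const hΩ hΩb hK hv.bounded hξ h p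

theorem proposition2 (d : ℕ) (hd : 2 ≤ d) (Ω : Set (EnergyVariational.Vec d)) (hΩ : IsOpen Ω)
    (hΩb : Bornology.IsBounded Ω) (T : ℝ) (hT : 0 < T) (ν : ℝ) (hν : 0 ≤ ν)
    (K : EnergyVariational.L2sol Ω → ENNReal) (hK : EnergyVariational.IsAdmissible ν T K)
    (f : EnergyVariational.Force Ω ν T)
    (v : ℝ → EnergyVariational.L2sol Ω) (hv : EnergyVariational.MemX ν T v)
    (ξ : ℝ → ℝ) (hξ : MemLp ξ ⊤ (volume.restrict (Ioo 0 T)))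
    (hξ0 : ∀ᵐ t ∂(volume.restrict (Ioo 0 T)), 0 ≤ ξ t) :
    (EnergyVariational.RelativeEnergyInequality K f v ξ ↔
      EnergyVariational.LocalInequality K f v ξ) ∧
    (EnergyVariational.RelativeEnergyInequality K f v ξ ↔
      EnergyVariational.ReducedInequality K f v ξ) :=
  proposition2_general hΩ hΩb hT hν hK f hv hξ
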